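/- Fix countably many atomic propositions and register variables. A finite data word is a sequence $w=(P_0,d_0)\cdots(P_{n-1},d_{n-1})$, where each $P_i$ is a finite set of atomic propositions and $d_i\in\mathbb{N}$. Formulas of $\mathsf{TPTL}$ are given by $$\varphi ::= \mathtt{true}\mid p\mid x\sim c\mid \neg\varphi\mid\varphi\wedge\varphi\mid\varphi\,\mathsf{U}\,\varphi\mid x.\varphi,$$ where $p$ is an atomic proposition, $x$ a register variable, $c\in\mathbb{Z}$ and ${\sim}\in\{<,\le,=,\ge,>\}$. For a position $0\le i<n$ and a valuation $\nu$ of the register variables by integers, satisfaction is defined by: $(w,i,\nu)\models p$ iff $p\in P_i$; $(w,i,\nu)\models x\sim c$ iff $d_i-\nu(x)\sim c$; $(w,i,\nu)\models x.\varphi$ iff $(w,i,\nu[x\mapsto d_i])\models\varphi$; $(w,i,\nu)\models\varphi_1\,\mathsf{U}\,\varphi_2$ iff there is a position $j$ with $i<j<n$ such that $(w,j,\nu)\models\varphi_2$ and $(w,k,\nu)\models\varphi_1$ for all $k$ with $i<k<j$; and as usual for $\mathtt{true}$, $\neg$ and $\wedge$. For nonempty $w$, write $w\models\varphi$ if $(w,0,\bar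 0)\models\varphi$, where $\bar 0$ maps every register variable to $d_0$. For every fixed $r\in\mathbb{N}$, the following problem belongs to the class $\mathsf{P}$ (deterministic polynomial time). Given a nonempty finite data word $w$, with its data values written in binary, and a $\mathsf{TPTL}$-formula $\varphi$ in which at most $r$ different register variables occur, with the constants $c$ of its constraints $x\sim c$ written in binary, decide whether $w\models\varphi$. (Names of propositions and of register variables are also written in binary, and every set $P_i$ is given by a list of its elements.) -/

import Mathlib

/-! ## Finite data words and the logic TPTL -/

namespace TPTL

/-- A letter `(P, d)` of a data word: a finite set `P` of atomic propositions together with a data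
value `d`.  Atomic propositions are named by natural numbers. -/
abbrev Letter : Type := Finset ℕ × ℕ

/-- Finite data words. -/
abbrev DataWord : Type := List Letter

/-- The comparison symbols `<, ≤, =, ≥, >`. -/
inductive Rel where
  | lt | le | eq | ge | gt
  deriving DecidableEq

instance : Fintype Rel :=
  ⟨{Rel.lt, Rel.le, Rel.eq, Rel.ge, Rel.gt}, by intro R; cases R <;> decide⟩

/-- The interpretation of the comparison symbols over the integers. -/
def Rel.Holds : Rel → ℤ → ℤ → Prop
  | .lt, a, b => a < b
  | .le, a, b => a ≤ b
  | .eq, a, b => a = b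
  | .ge, a, b => a ≥ b
  | .gt, a, b => a > b

/-- TPTL formulas.  Register variables are named by natural numbers. -/
inductive Formula where
  /-- `true` -/
  | tt : Formula
  /-- an atomic proposition `p` -/
  | prop (p : ℕ) : Formula
  /-- a constraint `x ∼ c` -/
  | constr (x : ℕ) (R : Rel) (c : ℤ) : Formula
  /-- `¬ φ` -/
  | neg (φ : Formula) : Formula
  /-- `φ ∧ ψ` -/
  | conj (φ ψ : Formula) : Formula
  /-- `φ U ψ` -/
  | untl (φ ψ : Formula) : Formula
  /-- `x.φ` -/
  | freeze (x : ℕ) (φ : Formula) : Formula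

/-- The register variables that occur in a formula. -/
def Formula.vars : Formula → Finset ℕ
  | .tt => ∅
  | .prop _ => ∅
  | .constr x _ _ => {x}
  | .neg φ => φ.vars
  | .conj φ ψ => φ.vars ∪ ψ.vars
  | .untl φ ψ => φ.vars ∪ ψ.vars
  | .freeze x φ => {x} ∪ φ.vars

/-- The satisfaction relation `(w, i, ν) ⊨ φ`, where `i` is a position of `w` and `ν` is a register
valuation.  The until modality is the strict one. -/
def Sat (w : DataWord) : Formula → Fin w.length → (ℕ → ℤ) → Prop
  | .tt, _, _ => True
  | .prop p, i, _ => p ∈ (w.get i).1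
  | .constr x R c, i, ν => R.Holds (((w.get i).2 : ℤ) - ν x) c
  | .neg φ, i, ν => ¬ Sat w φ i ν
  | .conj φ ψ, i, ν => Sat w φ i ν ∧ Sat w ψ i ν
  | .untl φ ψ, i, ν =>
      ∃ j, i < j ∧ Sat w ψ j ν ∧ ∀ k, i < k → k < j → Sat w φ k ν
  | .freeze x φ, i, ν => Sat w φ i (Function.update ν x ((w.get i).2 : ℤ))

/-- `w ⊨ φ`: the (nonempty) data word `w` satisfies `φ` at position `0` under the valuation that
maps all register variables to the initial data value of `w`. -/
def Models (w : DataWord) (φ : Formula) : Prop :=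
  ∃ h : 0 < w.length, Sat w φ ⟨0, h⟩ (fun _ => ((w.get ⟨0, h⟩).2 : ℤ))

/-! ## Encoding of the instances, with all numbers in binary -/

/-- The finite alphabet of the encoding. -/
inductive Symb where
  | bit (b : Bool)
  | endNum | sign (negative : Bool)
  | data | sep
  | tt | prop | var | rel (R : Rel) | neg | conj | untl | freeze
  deriving DecidableEq, Fintype

/-- The binary digits of `n` (least significant digit first), followed by an end marker. -/
def encNat (n : ℕ) : List Symb := n.bits.map Symb.bit ++ [Symb.endNum]

/-- The sign of `c`, followed by its absolute value in binary. -/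
def encInt (c : ℤ) : List Symb := Symb.sign (decide (c < 0)) :: encNat c.natAbs

/-- Formulas in prefix notation. -/
def Formula.enc : Formula → List Symb
  | .tt => [Symb.tt]
  | .prop p => Symb.prop :: encNat p
  | .constr x R c => Symb.var :: (encNat x ++ Symb.rel R :: encInt c)
  | .neg φ => Symb.neg :: φ.enc
  | .conj φ ψ => Symb.conj :: (φ.enc ++ ψ.enc)
  | .untl φ ψ => Symb.untl :: (φ.enc ++ ψ.enc)
  | .freeze x φ => Symb.freeze :: (encNat x ++ φ.enc)

/-- A data word as it is written down: the set of propositions of every letter is given by a list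
of its elements (in any order, repetitions allowed). -/
abbrev WrittenWord : Type := List (List ℕ × ℕ)

/-- The data word that is written down. -/
def WrittenWord.toDataWord (u : WrittenWord) : DataWord := u.map fun a => (a.1.toFinset, a.2)

/-- The encoding of a letter: the names of its propositions, then its data value. -/
def encLetter (a : List ℕ × ℕ) : List Symb :=
  a.1.flatMap (fun p => Symb.prop :: encNat p) ++ Symb.data :: encNat a.2

/-- The encoding of an instance of the path checking problem: the data word, letter by letter,
followed by a separator and the formula. -/
def encInstance (u : WrittenWord) (φ : Formula) : List Symb :=
  u.flatMap encLetter ++ Symb.sep :: φ.enc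

/-! The encoding is unambiguous. -/

theorem encNat_append_inj {m n : ℕ} {s t : List Symb} (h : encNat m ++ s = encNat n ++ t) :
    m = n ∧ s = t := by
  have key : ∀ (a b : List Bool) (s t : List Symb),
      a.map Symb.bit ++ Symb.endNum :: s = b.map Symb.bit ++ Symb.endNum :: t → a = b ∧ s = t := by
    intro a
    induction a with
    | nil => intro b s t h; cases b <;> simp_all
    | cons x a ih =>
      intro b s t h
      cases b with
      | nil => simp at h
      | cons y b =>
        simp only [List.map_cons, List.cons_append, List.cons.injEq, Symb.bit.injEq] at h
        obtain ⟨h1, h2⟩ := ih _ _ _ h.2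
        exact ⟨by rw [h.1, h1], h2⟩
  obtain ⟨h1, h2⟩ := key m.bits n.bits s t (by simpa [encNat] using h)
  refine ⟨Nat.eq_of_testBit_eq fun i => ?_, h2⟩
  rw [Nat.testBit_eq_inth, Nat.testBit_eq_inth, h1]

theorem encInt_append_inj {c d : ℤ} {s t : List Symb} (h : encInt c ++ s = encInt d ++ t) :
    c = d ∧ s = t := by
  simp only [encInt, List.cons_append, List.cons.injEq, Symb.sign.injEq, decide_eq_decide] at h
  obtain ⟨h1, h2⟩ := encNat_append_inj h.2
  exact ⟨by omega, h2⟩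

theorem Formula.enc_append_inj (φ : Formula) : ∀ {ψ : Formula} {s t : List Symb},
    φ.enc ++ s = ψ.enc ++ t → φ = ψ ∧ s = t := by
  induction φ with
  | tt => intro ψ s t h; cases ψ <;> simp_all [Formula.enc]
  | prop p =>
    intro ψ s t h
    cases ψ <;> simp [Formula.enc] at h
    obtain ⟨h1, h2⟩ := encNat_append_inj h
    exact ⟨by rw [h1], h2⟩
  | constr x R c =>
    intro ψ s t h
    cases ψ <;> simp [Formula.enc] at h
    obtain ⟨h1, h2⟩ := encNat_append_inj h
    simp only [List.cons.injEq, Symb.rel.injEq] at h2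
    obtain ⟨h3, h4⟩ := encInt_append_inj h2.2
    exact ⟨by rw [h1, h2.1, h3], h4⟩
  | neg φ ih =>
    intro ψ s t h
    cases ψ <;> simp [Formula.enc] at h
    obtain ⟨h1, h2⟩ := ih h
    exact ⟨by rw [h1], h2⟩
  | conj φ₁ φ₂ ih₁ ih₂ =>
    intro ψ s t h
    cases ψ <;> simp [Formula.enc] at h
    obtain ⟨h1, h2⟩ := ih₁ h
    obtain ⟨h3, h4⟩ := ih₂ h2
    exact ⟨by rw [h1, h3], h4⟩
  | untl φ₁ φ₂ ih₁ ih₂ =>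
    intro ψ s t h
    cases ψ <;> simp [Formula.enc] at h
    obtain ⟨h1, h2⟩ := ih₁ h
    obtain ⟨h3, h4⟩ := ih₂ h2
    exact ⟨by rw [h1, h3], h4⟩
  | freeze x φ ih =>
    intro ψ s t h
    cases ψ <;> simp [Formula.enc] at h
    obtain ⟨h1, h2⟩ := encNat_append_inj h
    obtain ⟨h3, h4⟩ := ih h2
    exact ⟨by rw [h1, h3], h4⟩

theorem encLetter_append_inj {a b : List ℕ × ℕ} {s t : List Symb}
    (h : encLetter a ++ s = encLetter b ++ t) : a = b ∧ s = t := by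
  obtain ⟨l, d⟩ := a
  obtain ⟨m, e⟩ := b
  induction l generalizing m with
  | nil =>
    cases m <;> simp [encLetter] at h
    obtain ⟨h1, h2⟩ := encNat_append_inj h
    exact ⟨by rw [h1], h2⟩
  | cons p l ih =>
    cases m with
    | nil => simp [encLetter] at h
    | cons q m =>
      simp only [encLetter, List.flatMap_cons, List.cons_append, List.append_assoc,
        List.cons.injEq, true_and] at h
      obtain ⟨h1, h2⟩ := encNat_append_inj h
      obtain ⟨h3, h4⟩ := ih m (by simpa [encLetter] using h2)
      simp only [Prod.mk.injEq] at h3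
      exact ⟨by rw [h1, h3.1, h3.2], h4⟩

theorem encInstance_inj {u v : WrittenWord} {φ ψ : Formula}
    (h : encInstance u φ = encInstance v ψ) : u = v ∧ φ = ψ := by
  have sep_ne : ∀ (a : List ℕ × ℕ) (s t : List Symb), encLetter a ++ s ≠ Symb.sep :: t := by
    rintro ⟨l, d⟩ s t
    cases l <;> simp [encLetter]
  induction u generalizing v with
  | nil =>
    cases v with
    | nil =>
      have h' : φ.enc ++ [] = ψ.enc ++ [] := by simpa [encInstance] using h
      exact ⟨rfl, (φ.enc_append_inj h').1⟩
    | cons b v =>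
      exact absurd (by simpa [encInstance] using h.symm) (sep_ne b _ _)
  | cons a u ih =>
    cases v with
    | nil => exact absurd (by simpa [encInstance] using h) (sep_ne a _ _)
    | cons b v =>
      obtain ⟨h1, h2⟩ := encLetter_append_inj
        (by simpa only [encInstance, List.flatMap_cons, List.append_assoc] using h)
      obtain ⟨h3, h4⟩ := ih (v := v) h2
      exact ⟨by rw [h1, h3], h4⟩

/-- The path checking problem for `TPTL^r_b` over finite binary encoded data words, as a formal
language: the encodings of all pairs of a finite data word `w` and a formula `φ` with at most `r`
different register variables such that `w ⊨ φ`. -/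
def pathChecking (r : ℕ) : Language Symb :=
  {s | ∃ (u : WrittenWord) (φ : Formula),
    s = encInstance u φ ∧ φ.vars.card ≤ r ∧ Models u.toDataWord φ}

end TPTL

/-! ## The class P -/

open Classical in
/-- A language over a finite alphabet is in `P`: its characteristic function is computed by a
deterministic (multi-stack) Turing machine in polynomially many steps in the length of the input.
The finiteness condition says that the work stacks of the machine have finite alphabets, too. -/
def InPTime {Γ : Type} [Finite Γ] (L : Language Γ) : Prop :=
  ∃ M : Turing.TM2ComputableInPolyTime (id : List Γ → List Γ) Computability.encodeBool
      (fun s => decide (s ∈ L)),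
    ∀ k, Finite (M.tm.Γ k)

/-!
Path checking for TPTL with `r` registers is solved in polynomial time by dynamic programming over
pointers into the instance.  The truth value of a subformula at a position depends only on the
subformula, the position and the values of the `r` registers, and a register only ever holds a data
value of the word.  Since subformulas, positions, register names and data values all begin at some
place of the written instance, a subproblem is a tuple of at most `2 * r + 3` places, so there are
only polynomially many subproblems.

The dynamic program is a set of Datalog rules whose variables range over the suffixes of the input
word (`Datalog.Rule`, `Datalog.Der`).  A rule may test the first letter of a suffix and may pass to
its tail, which suffices to parse the instance, to compare numbers `x + y` and `z` in binary, to
look up registers by their names, and to evaluate formulas, with until unfolded along the word.  As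
rules have no negation, the truth value is an argument of the predicates, and both truth values are
derived.  The rules are `TPTL.rule`; that they derive nothing but correct facts (`TPTL.Sem`) is
`TPTL.sem_of_der`, and that they derive all facts that are needed is `TPTL.satDerivable` and
`TPTL.der_goal`.

Any such set of rules is evaluated in polynomial time (`Datalog.inPTime_of_der`).  With `k`
variables and an input of length `n`, a pass enumerates all `(n + 1) ^ k` assignments by nested
loops, and every applicable rule adds its conclusion to a list.  Each pass finds a new fact unless
the list is closed under the rules, so that the list is complete after more passes than there are
instances of rules (`Datalog.mem_evaluate_iff`).  The loops are written as structured
programs on stacks (`StackProgram.Cmd`) with a timed big-step semantics (`StackProgram.Exec`), and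
are compiled to multi-stack Turing machines in `StackProgram.inPTime_of_exec`.
-/

/-! ### Structured programs over stacks -/

namespace StackProgram

open Turing Function

/-- Structured programs that manipulate finitely many stacks, where stack `k` has alphabet `Γ k`.
`pop k f` pops stack `k` and continues with `f` of the symbol found (`none` on the empty stack);
`loop k f` pops symbols `a` from stack `k` and runs `f a`, until stack `k` is empty. -/
inductive Cmd {K : Type} (Γ : K → Type) : Type
  | skip : Cmd Γ
  | push (k : K) (a : Γ k) : Cmd Γ
  | pop (k : K) (f : Option (Γ k) → Cmd Γ) : Cmd Γ
  | seq (c d : Cmd Γ) : Cmd Γ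
  | loop (k : K) (f : Γ k → Cmd Γ) : Cmd Γ

variable {K : Type} {Γ : K → Type}

section Exec

variable [DecidableEq K]

/-- `Exec c S T t`: started on the stacks `S`, the program `c` terminates with the stacks `T` after
at most `t` elementary steps. -/
inductive Exec : Cmd Γ → (∀ k, List (Γ k)) → (∀ k, List (Γ k)) → ℕ → Prop
  | skip {S} : Exec .skip S S 1
  | push {S k a} : Exec (.push k a) S (update S k (a :: S k)) 1
  | pop {S T k f t} (h : Exec (f (S k).head?) (update S k (S k).tail) T t) :
      Exec (.pop k f) S T (t + 1)
  | seq {S T U c d t u} (h : Exec c S T t) (h' : Exec d T U u) : Exec (.seq c d) S U (t + u)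
  | loop_nil {S k f} (h : S k = []) : Exec (.loop k f) S S 1
  | loop_cons {S T U k f a l t u} (h : S k = a :: l) (h' : Exec (f a) (update S k l) T t)
      (h'' : Exec (.loop k f) T U u) : Exec (.loop k f) S U (t + u + 1)
  | mono {S T c t u} (h : Exec c S T t) (h' : t ≤ u) : Exec c S T u

/-- No stack grows by more than the number of steps. -/
theorem Exec.length_le {c : Cmd Γ} {S T : ∀ k, List (Γ k)} {t : ℕ} (h : Exec c S T t) (k : K) :
    (T k).length ≤ (S k).length + t := by
  have upd : ∀ (S : ∀ k, List (Γ k)) (i : K) (l : List (Γ i)), l.length ≤ (S i).length + 1 →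
      (update S i l k).length ≤ (S k).length + 1 := by
    intro S i l hl
    by_cases hk : k = i
    · subst hk; simpa using hl
    · simp [update_of_ne hk]
  have upd' : ∀ (S : ∀ k, List (Γ k)) (i : K) (l : List (Γ i)), l.length ≤ (S i).length →
      (update S i l k).length ≤ (S k).length := by
    intro S i l hl
    by_cases hk : k = i
    · subst hk; simpa using hl
    · simp [update_of_ne hk]
  induction h with
  | skip => omega
  | push => exact upd _ _ _ (by simp)
  | @pop S T k f t h ih => have := upd' S k (S k).tail (by simp); omega
  | seq h h' ih ih' => omega
  | loop_nil h => omega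
  | @loop_cons S T U k f a l t u h h' h'' ih ih' => have := upd' S k l (by simp [h]); omega
  | mono h h' ih => omega

end Exec

/-! ### Compilation of structured programs to Turing machines -/

/-- The labels of the machine that runs a program: one for every program point. -/
def Lab : Cmd Γ → Type
  | .skip => Unit
  | .push _ _ => Unit
  | .pop _ f => Option (Σ o, Lab (f o))
  | .seq c d => Lab c ⊕ Lab d
  | .loop _ f => Option (Σ a, Lab (f a))

theorem finite_lab [∀ k, Finite (Γ k)] (c : Cmd Γ) : Finite (Lab c) := by
  induction c with
  | skip => exact inferInstanceAs (Finite Unit)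
  | push => exact inferInstanceAs (Finite Unit)
  | pop k f ih => exact inferInstanceAs (Finite (Option (Σ o, Lab (f o))))
  | seq c d ih ih' => exact inferInstanceAs (Finite (Lab c ⊕ Lab d))
  | loop k f ih => exact inferInstanceAs (Finite (Option (Σ a, Lab (f a))))

/-- The program point at which a program starts. -/
def entry : (c : Cmd Γ) → Lab c
  | .skip => ()
  | .push _ _ => ()
  | .pop _ _ => none
  | .seq c _ => .inl (entry c)
  | .loop _ _ => none

theorem iterate_bind_trans {α : Type} (f : α → Option α) {a b : α} {c : Option α} {m n : ℕ}
    (h : (flip bind f)^[m] (some a) = some b) (h' : (flip bind f)^[n] (some b) = c) :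
    (flip bind f)^[n + m] (some a) = c := by
  rw [iterate_add_apply, h, h']

variable [DecidableEq K]

/-- The statement at a program point of `c`, inside of a larger machine with labels `Λ`.  The
program points of `c` are embedded into `Λ` by `emb`, and the program ends with a jump to `exit`.
The internal state stores the symbols that were popped last. -/
def code : (c : Cmd Γ) → {Λ : Type} → (emb : Lab c → Λ) → (exit : Λ) → Lab c →
    TM2.Stmt Γ Λ (∀ k, Option (Γ k))
  | .skip, _, _, exit, _ => .goto fun _ => exit
  | .push k a, _, _, exit, _ => .push k (fun _ => a) (.goto fun _ => exit)
  | .pop k f, _, emb, exit, l => match l with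
    | none => .pop k (fun st o => update st k o)
        (.goto fun st => emb (some ⟨st k, entry (f (st k))⟩))
    | some ⟨o, l⟩ => code (f o) (fun l => emb (some ⟨o, l⟩)) exit l
  | .seq c d, _, emb, exit, l => match l with
    | .inl l => code c (fun l => emb (.inl l)) (emb (.inr (entry d))) l
    | .inr l => code d (fun l => emb (.inr l)) exit l
  | .loop k f, _, emb, exit, l => match l with
    | none => .pop k (fun st o => update st k o) (.goto fun st => match st k with
        | none => exit
        | some a => emb (some ⟨a, entry (f a)⟩))
    | some ⟨a, l⟩ => code (f a) (fun l => emb (some ⟨a, l⟩)) (emb none) l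

/-- The machine `M` gets from one configuration to another one in at most `t` steps. -/
def Reach {Λ σ : Type} (M : Λ → TM2.Stmt Γ Λ σ) (c d : TM2.Cfg Γ Λ σ) (t : ℕ) : Prop :=
  ∃ m ≤ t, (flip bind (TM2.step M))^[m] (some c) = some d

theorem Reach.trans {Λ σ : Type} {M : Λ → TM2.Stmt Γ Λ σ} {c d e : TM2.Cfg Γ Λ σ} {t u : ℕ}
    (h : Reach M c d t) (h' : Reach M d e u) : Reach M c e (t + u) := by
  obtain ⟨m, hm, h⟩ := h
  obtain ⟨n, hn, h'⟩ := h'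
  exact ⟨n + m, by omega, iterate_bind_trans _ h h'⟩

theorem Reach.single {Λ σ : Type} {M : Λ → TM2.Stmt Γ Λ σ} {c d : TM2.Cfg Γ Λ σ}
    (h : TM2.step M c = some d) : Reach M c d 1 :=
  ⟨1, le_rfl, h⟩

/-- The compiled program simulates the structured program. -/
theorem Exec.reach {c : Cmd Γ} {S T : ∀ k, List (Γ k)} {t : ℕ} (h : Exec c S T t) :
    ∀ {Λ : Type} (M : Λ → TM2.Stmt Γ Λ (∀ k, Option (Γ k))) (emb : Lab c → Λ) (exit : Λ)
      (_ : ∀ l, M (emb l) = code c emb exit l) (st : ∀ k, Option (Γ k)),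
      ∃ st', Reach M ⟨some (emb (entry c)), st, S⟩ ⟨some exit, st', T⟩ t := by
  induction h with
  | skip =>
    intro Λ M emb exit hM st
    exact ⟨st, .single (by simp [hM, code])⟩
  | push =>
    intro Λ M emb exit hM st
    exact ⟨st, .single (by simp [hM, code])⟩
  | @pop S T k f t h ih =>
    intro Λ M emb exit hM st
    obtain ⟨st', h'⟩ := ih M (fun l => emb (some ⟨(S k).head?, l⟩)) exit
      (fun l => hM (some ⟨(S k).head?, l⟩)) (update st k (S k).head?)
    refine ⟨st', ?_⟩
    rw [add_comm]
    refine .trans (.single ?_) h'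
    have h₀ := hM none
    simp only [code] at h₀
    have h₁ : ∀ o, update st k o k = o := fun o => update_self ..
    simp only [entry, TM2.step, h₀, TM2.stepAux]
    rw [h₁]
  | seq h h' ih ih' =>
    intro Λ M emb exit hM st
    obtain ⟨st', h1⟩ := ih M (fun l => emb (.inl l)) (emb (.inr (entry _)))
      (fun l => hM (.inl l)) st
    obtain ⟨st'', h2⟩ := ih' M (fun l => emb (.inr l)) exit (fun l => hM (.inr l)) st'
    exact ⟨st'', h1.trans h2⟩
  | @loop_nil S k f h =>
    intro Λ M emb exit hM st
    refine ⟨update st k none, .single ?_⟩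
    have := hM none
    simp only [code] at this
    have hS : update S k [] = S := by rw [← h]; simp
    simp [entry, this, h, hS]
  | @loop_cons S T U k f a l t u h h' h'' ih ih' =>
    intro Λ M emb exit hM st
    obtain ⟨st', h1⟩ := ih M (fun l => emb (some ⟨a, l⟩)) (emb none)
      (fun l => hM (some ⟨a, l⟩)) (update st k (some a))
    obtain ⟨st'', h2⟩ := ih' M emb exit hM st'
    refine ⟨st'', ?_⟩
    rw [add_comm]
    refine .trans (.single ?_) (h1.trans h2)
    have := hM none
    simp only [code] at this
    simp [entry, this, h]
  | mono h h' ih =>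
    intro Λ M emb exit hM st
    obtain ⟨st', m, hm, h1⟩ := ih M emb exit hM st
    exact ⟨st', m, hm.trans h', h1⟩

/-- The machine that runs a program and then halts; the label `none` is the exit of the program. -/
noncomputable def machine [Fintype K] [∀ k, Finite (Γ k)] (c : Cmd Γ) (k₀ k₁ : K) : FinTM2 :=
  letI : Fintype (Lab c) := @Fintype.ofFinite _ (finite_lab c)
  letI : ∀ k, Fintype (Γ k) := fun k => Fintype.ofFinite (Γ k)
  { K := K
    k₀ := k₀
    k₁ := k₁
    Γ := Γ
    Λ := Option (Lab c)
    main := some (entry c)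
    σ := ∀ k, Option (Γ k)
    initialState := fun _ => none
    m := fun l => match l with
      | none => .load (fun _ _ => none) .halt
      | some l => code c some none l }

theorem dite_eq_update (k₀ : K) (l : List (Γ k₀)) :
    (fun k => @dite (List (Γ k)) (k = k₀) _ (fun h => by rw [h]; exact l) fun _ => []) =
      update (fun _ => []) k₀ l := by
  funext k
  by_cases hk : k = k₀
  · subst hk; simp
  · simp [hk]

theorem initList_machine [Fintype K] [∀ k, Finite (Γ k)] (c : Cmd Γ) (k₀ k₁ : K)
    (l : List (Γ k₀)) : initList (machine c k₀ k₁) l =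
      ⟨some (some (entry c)), fun _ => none, update (fun _ => []) k₀ l⟩ :=
  congrArg (TM2.Cfg.mk _ _) (dite_eq_update k₀ l)

theorem haltList_machine [Fintype K] [∀ k, Finite (Γ k)] (c : Cmd Γ) (k₀ k₁ : K)
    (l : List (Γ k₁)) : haltList (machine c k₀ k₁) l =
      ⟨none, fun _ => none, update (fun _ => []) k₁ l⟩ :=
  congrArg (TM2.Cfg.mk _ _) (dite_eq_update k₁ l)

/-- Removes all symbols from the stacks in a list. -/
def clearAll : List K → Cmd Γ
  | [] => .skip
  | k :: ks => .seq (.loop k fun _ => .skip) (clearAll ks)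

theorem exec_clear (k : K) (S : ∀ k, List (Γ k)) :
    Exec (.loop k fun _ => .skip) S (update S k []) (2 * (S k).length + 1) := by
  generalize hl : S k = l
  induction l generalizing S with
  | nil => rw [← hl, update_eq_self]; exact (Exec.loop_nil hl).mono (by simp)
  | cons a l ih =>
    have := ih (update S k l) (by simp)
    rw [update_idem] at this
    exact (Exec.loop_cons hl .skip this).mono (by simp; omega)

theorem exec_clearAll (N : ℕ) (ks : List K) (S : ∀ k, List (Γ k)) (hS : ∀ k, (S k).length ≤ N) :
    Exec (clearAll ks) S (fun k => if k ∈ ks then [] else S k) (ks.length * (2 * N + 1) + 1) := by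
  induction ks generalizing S with
  | nil => simpa [clearAll] using Exec.skip
  | cons k ks ih =>
    have h := ih (update S k []) (fun i => by
      by_cases h : i = k
      · subst h; simp
      · simp [update_of_ne h, hS])
    have hT : (fun i => if i ∈ ks then [] else update S k [] i) =
        fun i => if i ∈ k :: ks then [] else S i := by
      funext i
      by_cases h : i = k
      · subst h; simp
      · simp [h]
    rw [hT] at h
    refine ((exec_clear k S).seq h).mono ?_
    have := hS k
    simp only [List.length_cons]
    nlinarith

/-- A language is in `P` if there is a structured program that, in polynomial time, leaves a symbol
on the stack `res` exactly for the members of the language.  The stack `out` receives the answer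
of the machine, after all other stacks have been emptied. -/
theorem inPTime_of_exec {A : Type} [Finite A] [Fintype K] [∀ k, Finite (Γ k)] (L : Language A)
    (k₀ k₁ res : K) (e₀ : Γ k₀ ≃ A) (e₁ : Γ k₁ ≃ Bool) (c : Cmd Γ) (p : Polynomial ℕ)
    (h : ∀ s : List A, ∃ T, Exec c (update (fun _ => []) k₀ (s.map e₀.symm)) T (p.eval s.length) ∧
      (T res ≠ [] ↔ s ∈ L)) :
    InPTime L := by
  classical
  let ks : List K := Finset.univ.toList
  let prog : Cmd Γ := .seq c (.pop res fun o =>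
    .seq (clearAll ks) (.push k₁ (e₁.symm o.isSome)))
  -- the three summands pay for the program, for clearing the stacks and for the output
  let q : Polynomial ℕ := p + (.C ks.length * (2 * (.X + p) + 1) + 5)
  refine ⟨⟨⟨machine prog k₀ k₁, e₀, e₁⟩, q, ?_⟩, fun k => ‹∀ k, Finite (Γ k)› k⟩
  intro s
  have key : ∃ t ≤ q.eval s.length, (flip bind (machine prog k₀ k₁).step)^[t]
      (some (initList (machine prog k₀ k₁) (s.map e₀.symm))) =
      some (haltList (machine prog k₀ k₁) ((Computability.encodeBool (decide (s ∈ L))).map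
        e₁.symm)) := by
    obtain ⟨T, hT, hL⟩ := h s
    set S₀ : ∀ k, List (Γ k) := update (fun _ => []) k₀ (s.map e₀.symm) with hS₀
    have hlen : ∀ k, (T k).length ≤ s.length + p.eval s.length := by
      intro k
      refine (hT.length_le k).trans ?_
      by_cases hk : k = k₀
      · subst hk; simp [hS₀]
      · simp [hS₀, update_of_ne hk]
    have h2 := exec_clearAll (s.length + p.eval s.length) ks (update T res (T res).tail) (by
      intro k
      by_cases hk : k = res
      · subst hk; simpa using (Nat.sub_le _ _).trans (hlen k)
      · simpa [update_of_ne hk] using hlen k)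
    have hks : ∀ k, k ∈ ks := fun k => by simp [ks]
    simp only [hks, if_true] at h2
    have hdec : (T res).head?.isSome = decide (s ∈ L) := by
      rw [Bool.eq_iff_iff, decide_eq_true_iff, ← hL]
      rcases T res with _ | ⟨a, l⟩ <;> simp
    have h3 : Exec prog S₀ _ _ := hT.seq (.pop (h2.seq .push))
    obtain ⟨st, m, hm, hreach⟩ := h3.reach (machine prog k₀ k₁).m some none (fun l => rfl)
      (fun _ => none)
    rw [hdec] at hreach
    refine ⟨1 + m, ?_, iterate_bind_trans _
      (b := ⟨some none, st, update (fun _ => []) k₁ [e₁.symm (decide (s ∈ L))]⟩) ?_ ?_⟩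
    · simp only [q, Polynomial.eval_add, Polynomial.eval_mul, Polynomial.eval_C,
        Polynomial.eval_one, Polynomial.eval_X, Polynomial.eval_ofNat]
      omega
    · exact (congrArg (fun c => (flip bind (machine prog k₀ k₁).step)^[m] (some c))
        (initList_machine prog k₀ k₁ _)).trans hreach
    · exact congrArg some (haltList_machine prog k₀ k₁ [e₁.symm (decide (s ∈ L))]).symm
  exact ⟨⟨key.choose, key.choose_spec.2⟩, key.choose_spec.1⟩

end StackProgram

/-! ### Datalog programs over the suffixes of a word -/

namespace Datalog

open StackProgram Function

section

/-- A Datalog rule whose variables `x : V` range over the suffixes of the input word.  A term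
`(x, b)` denotes the suffix `x` itself if `b` is false, and the tail of `x` if `b` is true.  A guard
`(x, p)` tests the first letter of `x` (`none` if `x` is empty).  Atoms are predicates `q : Q`
applied to lists of terms. -/
structure Rule (A V Q : Type) where
  /-- the tests of first letters -/
  guard : List (V × (Option A → Bool))
  /-- the premises -/
  body : List (Q × List (V × Bool))
  /-- the conclusion -/
  head : Q × List (V × Bool)

variable {A V X Q ι : Type}

/-- The value of a term. -/
def termVal (v : V → List A) (t : V × Bool) : List A := if t.2 then (v t.1).tail else v t.1

/-- The facts that are derivable by the rules over the suffixes of `s`. -/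
inductive Der (rule : ι → Rule A V Q) (s : List A) : Q → List (List A) → Prop
  | mk (i : ι) (v : V → List A) (hv : ∀ x, v x <:+ s)
      (hg : ∀ g ∈ (rule i).guard, g.2 (v g.1).head? = true)
      (hb : ∀ a ∈ (rule i).body, Der rule s a.1 (a.2.map (termVal v))) :
      Der rule s (rule i).head.1 ((rule i).head.2.map (termVal v))

/-- The fact that an atom denotes under the assignment `v`.  In facts, suffixes of the input are
represented by their lengths. -/
def atomVal (v : V → List A) (a : Q × List (V × Bool)) : Q × List ℕ :=
  (a.1, a.2.map fun t => (termVal v t).length)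

/-! ### The store of the evaluator -/

/-- The stacks of the evaluator: the input, an auxiliary stack, a stack for the value of each
variable, two stacks that hold the word of a fact, two stacks for the list of the derived facts,
two stacks that serve as flags, and the output. -/
inductive Stk (X : Type) : Type
  | inp | tmp | var (x : X) | word | word' | base | base' | bad | found | out
  deriving DecidableEq, Fintype

/-- The letters for writing facts. -/
inductive Sym (Q : Type) : Type
  | pred (q : Q) | one | arg | fin
  deriving DecidableEq, Fintype

/-- The alphabets of the stacks. -/
abbrev Alph (A X Q : Type) : Stk X → Type
  | .inp | .tmp | .var _ => A
  | .word | .word' | .base | .base' => Sym Q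
  | .bad | .found => Unit
  | .out => Bool

instance [Finite A] [Finite Q] : ∀ k, Finite (Alph A X Q k)
  | .inp | .tmp | .var _ => inferInstanceAs (Finite A)
  | .word | .word' | .base | .base' =>
    letI := Fintype.ofFinite Q
    inferInstanceAs (Finite (Sym Q))
  | .bad | .found => inferInstanceAs (Finite Unit)
  | .out => inferInstanceAs (Finite Bool)

/-- The contents of the stacks of the evaluator. -/
structure Store (A X Q : Type) where
  /-- the input -/
  inp : List A
  /-- an auxiliary stack -/
  tmp : List A
  /-- the values of the variables -/
  var : X → List A
  /-- the word of a fact, reversed -/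
  word : List (Sym Q)
  /-- the word of a fact -/
  word' : List (Sym Q)
  /-- the derived facts -/
  base : List (Sym Q)
  /-- the facts that have been inspected in the current search -/
  base' : List (Sym Q)
  /-- nonempty if a difference was found in a comparison -/
  bad : List Unit
  /-- nonempty if a search was successful -/
  found : List Unit
  /-- the output -/
  out : List Bool

/-- A store as a family of stacks. -/
def Store.toFun (σ : Store A X Q) : ∀ k, List (Alph A X Q k)
  | .inp => σ.inp
  | .tmp => σ.tmp
  | .var x => σ.var x
  | .word => σ.word
  | .word' => σ.word'
  | .base => σ.base
  | .base' => σ.base'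
  | .bad => σ.bad
  | .found => σ.found
  | .out => σ.out

theorem Store.toFun_injective : Injective (Store.toFun : Store A X Q → _) := by
  intro σ τ h
  cases σ; cases τ
  simp only [Store.mk.injEq]
  exact ⟨congrFun h .inp, congrFun h .tmp, funext fun x => congrFun h (.var x), congrFun h .word,
    congrFun h .word', congrFun h .base, congrFun h .base', congrFun h .bad, congrFun h .found,
    congrFun h .out⟩

variable [DecidableEq X]

/-- Replaces the contents of one stack. -/
def Store.set (σ : Store A X Q) : (k : Stk X) → List (Alph A X Q k) → Store A X Q
  | .inp, l => { σ with inp := l }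
  | .tmp, l => { σ with tmp := l }
  | .var x, l => { σ with var := update σ.var x l }
  | .word, l => { σ with word := l }
  | .word', l => { σ with word' := l }
  | .base, l => { σ with base := l }
  | .base', l => { σ with base' := l }
  | .bad, l => { σ with bad := l }
  | .found, l => { σ with found := l }
  | .out, l => { σ with out := l }

theorem Store.toFun_set (σ : Store A X Q) (k : Stk X) (l : List (Alph A X Q k)) :
    (σ.set k l).toFun = update σ.toFun k l := by
  funext i
  by_cases h : i = k
  · subst h
    rw [update_self]
    cases i <;> simp [set, toFun]
  · rw [update_of_ne h]
    cases k <;> cases i <;> simp_all [set, toFun]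

/-- `Runs c σ τ t`: the program `c` turns the store `σ` into `τ` in at most `t` steps. -/
def Runs (c : Cmd (Alph A X Q)) (σ τ : Store A X Q) (t : ℕ) : Prop := Exec c σ.toFun τ.toFun t

namespace Runs

variable {c d : Cmd (Alph A X Q)} {σ τ ρ : Store A X Q} {t u : ℕ} {k : Stk X}

theorem mono (h : Runs c σ τ t) (h' : t ≤ u) : Runs c σ τ u := Exec.mono h h'

theorem congr {τ' : Store A X Q} (h : Runs c σ τ t) (hτ : τ = τ') (h' : t ≤ u) :
    Runs c σ τ' u := hτ ▸ h.mono h'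

theorem skip : Runs .skip σ σ 1 := Exec.skip

theorem seq (h : Runs c σ τ t) (h' : Runs d τ ρ u) : Runs (.seq c d) σ ρ (t + u) := Exec.seq h h'

theorem push (a : Alph A X Q k) : Runs (.push k a) σ (σ.set k (a :: σ.toFun k)) 1 := by
  rw [Runs, Store.toFun_set]; exact .push

theorem pop_nil {f : Option (Alph A X Q k) → Cmd (Alph A X Q)} (hk : σ.toFun k = [])
    (h : Runs (f none) σ τ t) : Runs (.pop k f) σ τ (t + 1) := by
  refine Exec.pop ?_
  rw [hk]
  have : update σ.toFun k [] = σ.toFun := by rw [← hk, update_eq_self]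
  simp only [List.head?_nil, List.tail_nil, this]
  exact h

theorem pop_cons {f : Option (Alph A X Q k) → Cmd (Alph A X Q)} {a : Alph A X Q k}
    {l : List (Alph A X Q k)} (hk : σ.toFun k = a :: l)
    (h : Runs (f (some a)) (σ.set k l) τ t) : Runs (.pop k f) σ τ (t + 1) := by
  refine Exec.pop ?_
  rw [hk, List.head?_cons, List.tail_cons, ← Store.toFun_set]
  exact h

theorem loop_nil {f : Alph A X Q k → Cmd (Alph A X Q)} (hk : σ.toFun k = []) :
    Runs (.loop k f) σ σ 1 := Exec.loop_nil hk

theorem loop_cons {f : Alph A X Q k → Cmd (Alph A X Q)} {a : Alph A X Q k}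
    {l : List (Alph A X Q k)} (hk : σ.toFun k = a :: l)
    (h : Runs (f a) (σ.set k l) τ t) (h' : Runs (.loop k f) τ ρ u) :
    Runs (.loop k f) σ ρ (t + u + 1) :=
  Exec.loop_cons hk (by rw [← Store.toFun_set]; exact h) h'

end Runs

theorem Store.set_self (σ : Store A X Q) (k : Stk X) : σ.set k (σ.toFun k) = σ := by
  cases k <;> simp [set, toFun]

theorem Store.toFun_set_self (σ : Store A X Q) (k : Stk X) (l : List (Alph A X Q k)) :
    (σ.set k l).toFun k = l := by
  rw [toFun_set, update_self]

theorem Store.toFun_set_of_ne (σ : Store A X Q) {k i : Stk X} (h : i ≠ k)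
    (l : List (Alph A X Q k)) : (σ.set k l).toFun i = σ.toFun i := by
  rw [toFun_set, update_of_ne h]

/-! ### Elementary programs -/

/-- Clearing a stack. -/
theorem runs_clear (σ : Store A X Q) (k : Stk X) :
    Runs (.loop k fun _ => .skip) σ (σ.set k []) (2 * (σ.toFun k).length + 1) := by
  rw [Runs, Store.toFun_set]
  exact exec_clear k _

/-- Moving the contents of a stack `k` to a stack `i`. -/
theorem runs_move (σ : Store A X Q) {k i : Stk X} (h : i ≠ k) (f : Alph A X Q k → Alph A X Q i) :
    Runs (.loop k fun a => .push i (f a)) σ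
      ((σ.set k []).set i (((σ.toFun k).map f).reverse ++ σ.toFun i))
      (2 * (σ.toFun k).length + 1) := by
  generalize hl : σ.toFun k = l
  induction l generalizing σ with
  | nil =>
    have : σ.set k [] = σ := by rw [← hl, Store.set_self]
    rw [this, List.map_nil, List.reverse_nil, List.nil_append, Store.set_self]
    exact (Runs.loop_nil hl).mono (by simp)
  | cons a l ih =>
    have h1 := ih ((σ.set k l).set i (f a :: σ.toFun i)) (by
      rw [Store.toFun_set_of_ne _ h.symm, Store.toFun_set_self])
    have h2 := Runs.push (σ := σ.set k l) (k := i) (f a)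
    rw [Store.toFun_set_of_ne _ h] at h2
    refine (Runs.loop_cons hl h2 (u := 2 * l.length + 1) ?_).mono (by simp; omega)
    convert h1 using 1
    apply Store.toFun_injective
    simp only [Store.toFun_set]
    funext m
    by_cases hm : m = i
    · subst hm; simp
    by_cases hm' : m = k
    · subst hm'; simp [update_of_ne h.symm]
    simp [update_of_ne hm, update_of_ne hm']

/-- Moving the contents of a stack `k` to two stacks `i` and `j`. -/
theorem runs_move₂ (σ : Store A X Q) {k i j : Stk X} (h : i ≠ k) (h' : j ≠ k) (hij : j ≠ i)
    (f : Alph A X Q k → Alph A X Q i) (g : Alph A X Q k → Alph A X Q j) :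
    Runs (.loop k fun a => .seq (.push i (f a)) (.push j (g a))) σ
      (((σ.set k []).set i (((σ.toFun k).map f).reverse ++ σ.toFun i)).set j
        (((σ.toFun k).map g).reverse ++ σ.toFun j))
      (3 * (σ.toFun k).length + 1) := by
  generalize hl : σ.toFun k = l
  induction l generalizing σ with
  | nil =>
    have : σ.set k [] = σ := by rw [← hl, Store.set_self]
    rw [this, List.map_nil, List.reverse_nil, List.nil_append, Store.set_self, List.map_nil,
      List.reverse_nil, List.nil_append, Store.set_self]
    exact (Runs.loop_nil hl).mono (by simp)
  | cons a l ih =>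
    have h1 := ih (((σ.set k l).set i (f a :: σ.toFun i)).set j (g a :: σ.toFun j)) (by
      rw [Store.toFun_set_of_ne _ h'.symm, Store.toFun_set_of_ne _ h.symm, Store.toFun_set_self])
    have h2 := Runs.push (σ := σ.set k l) (k := i) (f a)
    rw [Store.toFun_set_of_ne _ h] at h2
    have h3 := Runs.push (σ := (σ.set k l).set i (f a :: σ.toFun i)) (k := j) (g a)
    rw [Store.toFun_set_of_ne _ hij, Store.toFun_set_of_ne _ h'] at h3
    refine (Runs.loop_cons hl (h2.seq h3) (u := 3 * l.length + 1) ?_).mono (by simp; omega)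
    convert h1 using 1
    apply Store.toFun_injective
    simp only [Store.toFun_set]
    funext m
    by_cases hm : m = j
    · subst hm; simp
    by_cases hm' : m = i
    · subst hm'; simp [update_of_ne hij.symm]
    by_cases hm'' : m = k
    · subst hm''; simp [update_of_ne h.symm, update_of_ne h'.symm]
    simp [update_of_ne hm, update_of_ne hm', update_of_ne hm'']

end

section

variable {A V X Q ι : Type}

/-! ### Words for facts -/

/-- The word for the fact `q(n₁, …, nₖ)`, with numbers in unary. -/
def factWord (q : Q) : List ℕ → List (Sym Q)
  | [] => [.pred q]
  | n :: ns => List.replicate n .one ++ .arg :: factWord q ns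

theorem factWord_injective {q q' : Q} {ns ns' : List ℕ} (h : factWord q ns = factWord q' ns') :
    q = q' ∧ ns = ns' := by
  have key : ∀ (m n : ℕ) (r r' : List (Sym Q)), List.replicate m .one ++ .arg :: r =
      List.replicate n .one ++ .arg :: r' → m = n ∧ r = r' := by
    intro m
    induction m with
    | zero => intro n r r' h; cases n <;> simp_all [List.replicate_succ]
    | succ m ih =>
      intro n r r' h
      cases n with
      | zero => simp [List.replicate_succ] at h
      | succ n =>
        simp only [List.replicate_succ, List.cons_append, List.cons.injEq, true_and] at h
        obtain ⟨h1, h2⟩ := ih _ _ _ h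
        exact ⟨by rw [h1], h2⟩
  induction ns generalizing ns' with
  | nil =>
    cases ns' with
    | nil => simpa [factWord] using h
    | cons n ns' => cases n <;> simp [factWord, List.replicate_succ] at h
  | cons m ns ih =>
    cases ns' with
    | nil => cases m <;> simp [factWord, List.replicate_succ] at h
    | cons n ns' =>
      obtain ⟨h1, h2⟩ := key _ _ _ _ h
      obtain ⟨h3, h4⟩ := ih h2
      exact ⟨h3, by rw [h1, h4]⟩

theorem fin_notMem_factWord (q : Q) (ns : List ℕ) : Sym.fin ∉ factWord q ns := by
  induction ns with
  | nil => simp [factWord]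
  | cons n ns ih => simp [factWord, ih]

theorem length_factWord_le (q : Q) {ns : List ℕ} {n : ℕ} (h : ∀ m ∈ ns, m ≤ n) :
    (factWord q ns).length ≤ ns.length * (n + 1) + 1 := by
  induction ns with
  | nil => simp [factWord]
  | cons m ns ih =>
    have h1 := ih fun m hm => h m (by simp [hm])
    have h2 := h m (by simp)
    simp only [factWord, List.length_append, List.length_replicate, List.length_cons]
    nlinarith

/-- The contents of the stack `base` for a list of facts. -/
def baseWord (D : List (Q × List ℕ)) : List (Sym Q) :=
  D.flatMap fun f => (factWord f.1 f.2).reverse ++ [.fin]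

variable [DecidableEq X]

/-- The state of the evaluator between two operations on the list of facts. -/
def conf (s : List A) (v : X → List A) (D : List (Q × List ℕ)) : Store A X Q :=
  ⟨s, [], v, [], [], baseWord D, [], [], [], []⟩

/-! ### Writing the word of a fact -/

/-- Writes the length of the value of a variable. -/
def emitLen (x : X) : Cmd (Alph A X Q) :=
  .seq (.loop (.var x) fun a => .seq (.push .tmp a) (.push .word .one))
    (.loop .tmp fun a => .push (.var x) a)

/-- Writes the length of the value of a term. -/
def emitTerm (t : X × Bool) : Cmd (Alph A X Q) :=
  if t.2 then
    .pop (.var t.1) fun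
      | none => emitLen t.1
      | some a => .seq (emitLen t.1) (.push (.var t.1) a)
  else emitLen t.1

/-- Writes the word of a fact. -/
def emit (q : Q) : List (X × Bool) → Cmd (Alph A X Q)
  | [] => .push .word (.pred q)
  | t :: ts => .seq (emit q ts) (.seq (.push .word .arg) (emitTerm t))

theorem runs_emitLen (σ : Store A X Q) (h : σ.tmp = []) (x : X) :
    Runs (emitLen x) σ (σ.set .word (List.replicate (σ.var x).length .one ++ σ.word))
      (5 * (σ.var x).length + 2) := by
  have h1 := runs_move₂ σ (k := .var x) (i := .tmp) (j := .word) (by simp) (by simp) (by simp)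
    id fun _ => .one
  have h2 := h1.seq (runs_move _ (k := .tmp) (i := .var x) (by simp) id)
  cases σ
  simp only at h
  subst h
  exact h2.congr (by simp [Store.set, Store.toFun]) (by simp [Store.set, Store.toFun]; omega)

theorem runs_emitTerm (σ : Store A X Q) (h : σ.tmp = []) (t : X × Bool) (n : ℕ)
    (hn : (σ.var t.1).length ≤ n) :
    Runs (emitTerm t) σ
      (σ.set .word (List.replicate (termVal σ.var t).length .one ++ σ.word)) (5 * n + 4) := by
  obtain ⟨x, b⟩ := t
  simp only [emitTerm, termVal] at hn ⊢
  cases b with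
  | false => simpa using (runs_emitLen σ h x).mono (by omega)
  | true =>
    simp only [if_true]
    cases hx : σ.var x with
    | nil =>
      exact (Runs.pop_nil (σ := σ) (k := .var x) hx (runs_emitLen σ h x)).congr (by simp [hx])
        (by simp [hx])
    | cons a l =>
      have h1 := runs_emitLen (σ.set (.var x) l) (by simpa [Store.set] using h) x
      have h2 := h1.seq (Runs.push (k := .var x) a)
      refine (Runs.pop_cons (σ := σ) (k := .var x) hx h2).congr ?_ ?_
      · cases σ
        simp only at hx
        simp [Store.set, Store.toFun, hx]
      · rw [hx, List.length_cons] at hn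
        simp [Store.set]
        omega

theorem runs_emit (σ : Store A X Q) (h : σ.tmp = []) (q : Q) (ts : List (X × Bool)) (n : ℕ)
    (hn : ∀ x, (σ.var x).length ≤ n) :
    Runs (emit q ts) σ
      (σ.set .word (factWord q (ts.map fun t => (termVal σ.var t).length) ++ σ.word))
      (ts.length * (5 * n + 5) + 1) := by
  induction ts with
  | nil => exact (Runs.push (σ := σ) (k := .word) (Sym.pred q)).congr rfl (by simp)
  | cons t ts ih =>
    have h1 := Runs.push (k := .word) (Sym.arg)
      (σ := σ.set .word (factWord q (ts.map fun t => (termVal σ.var t).length) ++ σ.word))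
    have h2 := ih.seq (h1.seq (runs_emitTerm _ (by simpa [Store.set] using h) t n
      (by simpa [Store.set] using hn t.1)))
    refine h2.congr ?_ ?_
    · simp [Store.set, Store.toFun, factWord]
    · simp only [List.length_cons]
      nlinarith

/-! ### Searching for a fact -/

variable [DecidableEq Q]

/-- One step of the search for `word'` in `base`, where `a` is the symbol that has been read. -/
def scanStep (a : Sym Q) : Cmd (Alph A X Q) :=
  .seq (.push .base' a) <|
    if a = .fin then
      .seq
        (.pop .word' fun
          | none => .pop .bad fun
            | none => .push .found ()
            | some _ => .skip
          | some b => .push .word' b)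
        (.seq (.loop .bad fun _ => .skip) (.loop .word fun b => .push .word' b))
    else
      .pop .word' fun
        | none => .push .bad ()
        | some b => .seq (.push .word b) (if b = a then .skip else .push .bad ())

theorem runs_scan_entry (e : List (Sym Q)) (he : Sym.fin ∉ e) (σ τ : Store A X Q) (u : ℕ)
    (r : List (Sym Q)) (hb : σ.base = e ++ .fin :: r)
    (h : Runs (.loop .base scanStep)
      { σ with
        base := r
        base' := .fin :: e.reverse ++ σ.base'
        word := []
        word' := σ.word.reverse ++ σ.word'
        bad := []
        found := if σ.bad = [] ∧ e = σ.word' then () :: σ.found else σ.found } τ u) :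
    Runs (.loop .base scanStep) σ τ
      (u + 12 * (e.length + 1) + 2 * σ.bad.length + 2 * σ.word.length) := by
  induction e generalizing σ with
  | nil =>
    obtain ⟨inp, tmp, var, word, word', base, base', bad, found, out⟩ := σ
    simp only [List.nil_append] at hb
    subst hb
    -- what happens when the end of an entry is reached, after the test for equality
    have aux : ∀ (w' : List (Sym Q)) (bd fd : List Unit), bd.length ≤ bad.length →
        Runs (.seq (.loop .bad fun _ => .skip) (.loop .word fun b => .push .word' b))
          (⟨inp, tmp, var, word, w', r, .fin :: base', bd, fd, out⟩ : Store A X Q)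
          ⟨inp, tmp, var, [], word.reverse ++ w', r, .fin :: base', [], fd, out⟩
          (2 * bad.length + 2 * word.length + 2) := by
      intro w' bd fd hbd
      have h1 := runs_clear (⟨inp, tmp, var, word, w', r, .fin :: base', bd, fd, out⟩ :
        Store A X Q) .bad
      have h2 := runs_move (⟨inp, tmp, var, word, w', r, .fin :: base', [], fd, out⟩ :
        Store A X Q) (k := .word) (i := .word') (by simp) id
      exact (h1.seq h2).congr (by simp [Store.set, Store.toFun])
        (by simp [Store.toFun]; omega)
    have key : ∃ t ≤ 2 * bad.length + 2 * word.length + 6, Runs (scanStep .fin)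
        (⟨inp, tmp, var, word, word', r, base', bad, found, out⟩ : Store A X Q)
        ⟨inp, tmp, var, [], word.reverse ++ word', r, .fin :: base', [],
          if bad = [] ∧ [] = word' then () :: found else found, out⟩ t := by
      cases word' with
      | cons b w' =>
        exact ⟨_, by omega, Runs.push (k := .base') _ |>.seq ((Runs.pop_cons (k := .word') rfl
          (Runs.push (k := .word') b)).seq (aux (b :: w') bad found le_rfl)) |>.congr
          (by simp) (u := 2 * bad.length + 2 * word.length + 6) (by omega)⟩
      | nil =>
        cases bad with
        | nil =>
          exact ⟨_, by omega, Runs.push (k := .base') _ |>.seq ((Runs.pop_nil (k := .word') rfl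
            (Runs.pop_nil (k := .bad) rfl (Runs.push (k := .found) ()))).seq
            (aux [] [] (() :: found) le_rfl)) |>.congr
            (by simp) (u := 2 * ([] : List Unit).length + 2 * word.length + 6) (by omega)⟩
        | cons b bad =>
          exact ⟨_, by omega, Runs.push (k := .base') _ |>.seq ((Runs.pop_nil (k := .word') rfl
            (Runs.pop_cons (k := .bad) rfl Runs.skip)).seq
            (aux [] bad found (by simp))) |>.congr
            (by simp) (u := 2 * (b :: bad).length + 2 * word.length + 6) (by omega)⟩
    obtain ⟨t, ht, hrun⟩ := key
    exact (Runs.loop_cons (k := .base) rfl hrun h).mono (by simp; omega)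
  | cons a e ih =>
    obtain ⟨inp, tmp, var, word, word', base, base', bad, found, out⟩ := σ
    simp only [List.cons_append] at hb
    subst hb
    simp only [List.mem_cons, not_or] at he
    have hne : a ≠ .fin := fun h => he.1 h.symm
    cases word' with
    | nil =>
      have h1 : Runs (scanStep a)
          (⟨inp, tmp, var, word, [], e ++ .fin :: r, base', bad, found, out⟩ : Store A X Q)
          ⟨inp, tmp, var, word, [], e ++ .fin :: r, a :: base', () :: bad, found, out⟩
          (1 + (1 + 1)) := by
        rw [scanStep, if_neg hne]
        refine Runs.seq (Runs.push (k := .base') a) ?_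
        refine Runs.pop_nil (k := .word') rfl ?_
        exact Runs.push (k := .bad) ()
      have h2 := ih he.2 ⟨inp, tmp, var, word, [], e ++ .fin :: r, a :: base', () :: bad, found,
        out⟩ rfl (by simpa using h)
      exact (Runs.loop_cons (k := .base) rfl h1 h2).mono (by simp; omega)
    | cons b w' =>
      by_cases hab : b = a
      · have h1 : Runs (scanStep a)
            (⟨inp, tmp, var, word, b :: w', e ++ .fin :: r, base', bad, found, out⟩ : Store A X Q)
            ⟨inp, tmp, var, b :: word, w', e ++ .fin :: r, a :: base', bad, found, out⟩
            (1 + (1 + 1 + 1)) := by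
          rw [scanStep, if_neg hne]
          refine Runs.seq (Runs.push (k := .base') a) ?_
          refine Runs.pop_cons (k := .word') rfl ?_
          refine Runs.seq (Runs.push (k := .word) b) ?_
          rw [if_pos hab]
          exact Runs.skip
        have h2 := ih he.2 ⟨inp, tmp, var, b :: word, w', e ++ .fin :: r, a :: base', bad, found,
          out⟩ rfl (by simpa [hab] using h)
        exact (Runs.loop_cons (k := .base) rfl h1 h2).mono (by simp; omega)
      · have h1 : Runs (scanStep a)
            (⟨inp, tmp, var, word, b :: w', e ++ .fin :: r, base', bad, found, out⟩ : Store A X Q)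
            ⟨inp, tmp, var, b :: word, w', e ++ .fin :: r, a :: base', () :: bad, found, out⟩
            (1 + (1 + 1 + 1)) := by
          rw [scanStep, if_neg hne]
          refine Runs.seq (Runs.push (k := .base') a) ?_
          refine Runs.pop_cons (k := .word') rfl ?_
          refine Runs.seq (Runs.push (k := .word) b) ?_
          rw [if_neg hab]
          exact Runs.push (k := .bad) ()
        have h2 := ih he.2 ⟨inp, tmp, var, b :: word, w', e ++ .fin :: r, a :: base', () :: bad,
          found, out⟩ rfl (by simpa [Ne.symm hab] using h)
        exact (Runs.loop_cons (k := .base) rfl h1 h2).mono (by simp; omega)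

theorem runs_scan (es : List (List (Sym Q))) (hes : ∀ e ∈ es, Sym.fin ∉ e) (σ : Store A X Q)
    (hb : σ.base = es.flatMap (· ++ [.fin])) (hw : σ.word = []) (hbad : σ.bad = []) :
    Runs (.loop .base scanStep) σ
      { σ with
        base := []
        base' := σ.base.reverse ++ σ.base'
        found := List.replicate (es.count σ.word') () ++ σ.found } (12 * σ.base.length + 1) := by
  induction es generalizing σ with
  | nil =>
    obtain ⟨inp, tmp, var, word, word', base, base', bad, found, out⟩ := σ
    simp only [List.flatMap_nil] at hb
    subst hb
    exact (Runs.loop_nil (k := .base) rfl).mono (by simp)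
  | cons e es ih =>
    obtain ⟨inp, tmp, var, word, word', base, base', bad, found, out⟩ := σ
    simp only [List.flatMap_cons, List.append_assoc, List.singleton_append] at hb hw hbad
    subst hb hw hbad
    have h := fun σ hb => ih (fun e he => hes e (by simp [he])) σ hb
    generalize es.flatMap (· ++ [Sym.fin]) = B at h ⊢
    refine (runs_scan_entry e (hes e (by simp)) _ _ _ _ rfl (h _ rfl rfl rfl)).congr ?_
      (by simp; omega)
    by_cases h : e = word'
    · subst h
      simp [List.replicate_succ']
    · simp [h]

/-- Searches for a fact; for every occurrence a symbol is pushed to the stack `found`. -/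
def query (q : Q) (ts : List (X × Bool)) : Cmd (Alph A X Q) :=
  .seq (emit q ts) <|
  .seq (.loop .word fun a => .push .word' a) <|
  .seq (.loop .base scanStep) <|
  .seq (.loop .base' fun a => .push .base a) (.loop .word' fun _ => .skip)

theorem runs_query (s : List A) (v : X → List A) (D : List (Q × List ℕ))
    (a : Q × List (X × Bool)) (n : ℕ) (hn : ∀ x, (v x).length ≤ n) :
    Runs (query a.1 a.2) (conf s v D)
      { conf s v D with found := List.replicate (D.count (atomVal v a)) () }
      (a.2.length * (9 * n + 9) + 14 * (baseWord D).length + 9) := by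
  set w := factWord a.1 (a.2.map fun t => (termVal v t).length) with hw
  have hwlen : w.length ≤ a.2.length * (n + 1) + 1 := by
    refine (length_factWord_le (n := n) _ ?_).trans (by simp)
    intro m hm
    simp only [List.mem_map] at hm
    obtain ⟨t, -, rfl⟩ := hm
    rw [termVal]
    split
    · exact (by simp : _ ≤ (v t.1).length).trans (hn _)
    · exact hn _
  have hcount : (D.map fun f => (factWord f.1 f.2).reverse).count w.reverse =
      D.count (atomVal v a) := by
    have : w.reverse = (fun f : Q × List ℕ => (factWord f.1 f.2).reverse) (atomVal v a) := rfl
    rw [this]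
    refine List.count_map_of_injective D (fun f : Q × List ℕ => (factWord f.1 f.2).reverse)
      (fun f g hfg => ?_) _
    obtain ⟨h1, h2⟩ := factWord_injective (List.reverse_injective hfg)
    exact Prod.ext h1 h2
  have hbase : baseWord D =
      (D.map fun f => (factWord f.1 f.2).reverse).flatMap (· ++ [.fin]) := by
    simp [baseWord, List.flatMap_map]
  have h1 := runs_emit (conf s v D) rfl a.1 a.2 n hn
  have h2 := runs_move (⟨s, [], v, w, [], baseWord D, [], [], [], []⟩ : Store A X Q)
    (k := .word) (i := .word') (by simp) id
  have h3 := runs_scan (D.map fun f => (factWord f.1 f.2).reverse)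
    (by rintro e he; obtain ⟨f, -, rfl⟩ := List.mem_map.1 he; simp [fin_notMem_factWord])
    (⟨s, [], v, [], w.reverse, baseWord D, [], [], [], []⟩ : Store A X Q) hbase rfl rfl
  have h4 := runs_move
    (⟨s, [], v, [], w.reverse, [], (baseWord D).reverse, [],
      List.replicate (D.count (atomVal v a)) (), []⟩ : Store A X Q)
    (k := .base') (i := .base) (by simp) id
  have h5 := runs_clear
    (⟨s, [], v, [], w.reverse, baseWord D, [], [],
      List.replicate (D.count (atomVal v a)) (), []⟩ : Store A X Q) .word'
  have h1' : Runs (emit a.1 a.2) (conf s v D) ⟨s, [], v, w, [], baseWord D, [], [], [], []⟩ _ :=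
    h1.congr (by simp [Store.set, conf, hw]) le_rfl
  refine (h1'.seq ((h2.congr (by simp [Store.set, Store.toFun]) le_rfl).seq ((h3.congr
    (by simp [hcount]) le_rfl).seq ((h4.congr (by simp [Store.set, Store.toFun]) le_rfl).seq
    h5)))).congr rfl ?_
  simp [Store.toFun]
  nlinarith

end

section

variable {A V X Q ι : Type}

/-! ### Applying a rule -/

/-- Renames the variables of a rule. -/
def Rule.map (e : V → X) (R : Rule A V Q) : Rule A X Q where
  guard := R.guard.map (Prod.map e id)
  body := R.body.map (Prod.map id (List.map (Prod.map e id)))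
  head := Prod.map id (List.map (Prod.map e id)) R.head

theorem atomVal_map (e : V → X) (v : X → List A) (a : Q × List (V × Bool)) :
    atomVal v (Prod.map id (List.map (Prod.map e id)) a) = atomVal (v ∘ e) a := by
  simp [atomVal, termVal]

variable [DecidableEq Q]

/-- The rule is applicable under the assignment `v` if the facts in `D` have been derived. -/
def Rule.fires (R : Rule A X Q) (v : X → List A) (D : List (Q × List ℕ)) : Bool :=
  (R.guard.all fun g => g.2 (v g.1).head?) && R.body.all fun a => decide (atomVal v a ∈ D)

/-- The effect of a rule, under a given assignment, on the list of derived facts. -/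
def Rule.apply (R : Rule A X Q) (v : X → List A) (D : List (Q × List ℕ)) : List (Q × List ℕ) :=
  if R.fires v D then atomVal v R.head :: D else D

theorem Rule.apply_map (e : V → X) (R : Rule A V Q) (v : X → List A) (D : List (Q × List ℕ)) :
    (R.map e).apply v D = R.apply (v ∘ e) D := by
  have h : (R.map e).fires v D = R.fires (v ∘ e) D := by
    simp only [Rule.fires, Rule.map, List.all_map, Function.comp_def, atomVal_map]
    rfl
  simp only [Rule.apply, h]
  simp only [Rule.map, atomVal_map]

variable [DecidableEq X]

/-- Continues with `c` if the guards hold. -/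
def checkGuards : List (X × (Option A → Bool)) → Cmd (Alph A X Q) → Cmd (Alph A X Q)
  | [], c => c
  | (x, p) :: gs, c => .pop (.var x) fun
    | none => if p none then checkGuards gs c else .skip
    | some a => .seq (.push (.var x) a) (if p (some a) then checkGuards gs c else .skip)

/-- Continues with `c` if the premises have been derived. -/
def checkBody : List (Q × List (X × Bool)) → Cmd (Alph A X Q) → Cmd (Alph A X Q)
  | [], c => c
  | a :: as, c => .seq (query a.1 a.2) <| .pop .found fun
    | none => .skip
    | some _ => .seq (.loop .found fun _ => .skip) (checkBody as c)

/-- Adds a fact to the list of derived facts. -/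
def addFact (a : Q × List (X × Bool)) : Cmd (Alph A X Q) :=
  .seq (emit a.1 a.2) (.seq (.push .base .fin) (.loop .word fun a => .push .base a))

/-- Applies a rule under the current assignment. -/
def ruleCmd (R : Rule A X Q) : Cmd (Alph A X Q) :=
  checkGuards R.guard (checkBody R.body (addFact R.head))

/-- Applies several rules under the current assignment. -/
def rulesCmd : List (Rule A X Q) → Cmd (Alph A X Q)
  | [] => .skip
  | R :: Rs => .seq (ruleCmd R) (rulesCmd Rs)

omit [DecidableEq Q] [DecidableEq X] in
theorem length_termVal_le {v : X → List A} {n : ℕ} (hn : ∀ x, (v x).length ≤ n) (t : X × Bool) :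
    (termVal v t).length ≤ n := by
  rw [termVal]
  split
  · exact (by simp : _ ≤ (v t.1).length).trans (hn _)
  · exact hn _

omit [DecidableEq Q] [DecidableEq X] in
theorem length_word_atomVal_le {v : X → List A} {n : ℕ} (hn : ∀ x, (v x).length ≤ n)
    (a : Q × List (X × Bool)) :
    (factWord (atomVal v a).1 (atomVal v a).2).length ≤ a.2.length * (n + 1) + 1 := by
  refine (length_factWord_le (n := n) _ ?_).trans (by simp [atomVal])
  intro m hm
  simp only [atomVal, List.mem_map] at hm
  obtain ⟨t, -, rfl⟩ := hm
  exact length_termVal_le hn t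

omit [DecidableEq Q] in
theorem runs_checkGuards (gs : List (X × (Option A → Bool))) (c : Cmd (Alph A X Q)) (s : List A)
    (v : X → List A) (D D' : List (Q × List ℕ)) (t : ℕ) (h : Runs c (conf s v D) (conf s v D') t) :
    Runs (checkGuards gs c) (conf s v D)
      (conf s v (if gs.all fun g => g.2 (v g.1).head? then D' else D))
      (3 * gs.length + t + 1) := by
  induction gs with
  | nil => simpa [checkGuards] using h.mono (by omega)
  | cons g gs ih =>
    obtain ⟨x, p⟩ := g
    rw [checkGuards]
    -- the continuation after the top of the stack has been tested
    have key : Runs (if p (v x).head? then checkGuards gs c else .skip) (conf s v D)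
        (conf s v (if ((x, p) :: gs).all fun g => g.2 (v g.1).head? then D' else D))
        (3 * gs.length + t + 1) := by
      rw [List.all_cons]
      change Runs _ _ (conf s v (if (p (v x).head? && _) = true then D' else D)) _
      cases p (v x).head? with
      | true => exact ih
      | false => exact Runs.skip.mono (by omega)
    cases hx : v x with
    | nil =>
      refine Runs.mono (Runs.pop_nil (t := 3 * gs.length + t + 1) (σ := conf s v D) (k := .var x)
        hx ?_) (by simp)
      rw [hx] at key
      exact key
    | cons a l =>
      have h1 : Runs (.push (.var x) a) ((conf s v D).set (.var x) l) (conf s v D) 1 :=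
        (Runs.push (k := .var x) a).congr (by simp [Store.set, conf, Store.toFun, ← hx]) le_rfl
      refine Runs.mono (Runs.pop_cons (t := 1 + (3 * gs.length + t + 1)) (σ := conf s v D)
        (k := .var x) hx (h1.seq ?_)) (by simp; omega)
      rw [hx] at key
      exact key

omit [DecidableEq Q] [DecidableEq X] in
theorem length_le_baseWord (D : List (Q × List ℕ)) : D.length ≤ (baseWord D).length := by
  induction D with
  | nil => simp
  | cons f D ih => simp [baseWord] at ih ⊢; omega

theorem runs_checkBody (as : List (Q × List (X × Bool))) (c : Cmd (Alph A X Q)) (s : List A)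
    (v : X → List A) (n : ℕ) (hn : ∀ x, (v x).length ≤ n) (D D' : List (Q × List ℕ)) (t : ℕ)
    (h : Runs c (conf s v D) (conf s v D') t) :
    Runs (checkBody as c) (conf s v D)
      (conf s v (if as.all fun a => decide (atomVal v a ∈ D) then D' else D))
      ((as.map fun a => a.2.length + 1).sum * (20 * (n + (baseWord D).length + 1)) + t + 1) := by
  induction as with
  | nil => simpa [checkBody] using h.mono (by omega)
  | cons a as ih =>
    have h1 := runs_query s v D a n hn
    have hB := (List.count_le_length (l := D) (a := atomVal v a)).trans (length_le_baseWord D)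
    by_cases ha : atomVal v a ∈ D
    · obtain ⟨m, hm⟩ : ∃ m, D.count (atomVal v a) = m + 1 :=
        ⟨_, (Nat.sub_add_cancel (List.count_pos_iff.2 ha)).symm⟩
      have h2 := runs_clear ({ conf s v D with found := List.replicate m () } : Store A X Q) .found
      rw [checkBody]
      refine Runs.congr (h1.seq (Runs.pop_cons (k := .found) (l := List.replicate m ()) (a := ())
        (by simp [hm, Store.toFun, List.replicate_succ]) (h2.seq ih)))
        (by rw [List.all_cons, decide_eq_true ha]; rfl) ?_
      simp only [Store.toFun, List.length_replicate, List.map_cons, List.sum_cons]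
      generalize (as.map fun a => a.2.length + 1).sum = S
      nlinarith [Nat.zero_le (a.2.length * (baseWord D).length)]
    · have hm : D.count (atomVal v a) = 0 := List.count_eq_zero.2 ha
      rw [hm] at h1
      rw [checkBody]
      refine Runs.congr (h1.seq (Runs.pop_nil (k := .found) rfl Runs.skip))
        (by rw [List.all_cons, decide_eq_false ha]; rfl) ?_
      simp only [List.map_cons, List.sum_cons]
      generalize (as.map fun a => a.2.length + 1).sum = S
      nlinarith [Nat.zero_le (a.2.length * (baseWord D).length),
        Nat.zero_le (S * (baseWord D).length), Nat.zero_le (S * n)]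

omit [DecidableEq Q] in
theorem runs_addFact (a : Q × List (X × Bool)) (s : List A)
    (v : X → List A) (n : ℕ) (hn : ∀ x, (v x).length ≤ n) (D : List (Q × List ℕ)) :
    Runs (addFact a) (conf s v D) (conf s v (atomVal v a :: D))
      (a.2.length * (7 * n + 7) + 5) := by
  have h1 := runs_emit (conf s v D) rfl a.1 a.2 n hn
  have h2 := h1.seq ((Runs.push (k := .base) (Sym.fin)).seq
    (runs_move _ (k := .word) (i := .base) (by simp) id))
  refine h2.congr ?_ ?_
  · simp [Store.set, Store.toFun, conf, atomVal, baseWord]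
  · have := length_word_atomVal_le hn a
    simp only [atomVal] at this
    simp [Store.set, Store.toFun, conf]
    nlinarith

/-- Applying a rule takes linear time, and increases the list of facts by `O(n)`. -/
theorem exists_runs_ruleCmd (R : Rule A X Q) : ∃ C : ℕ, ∀ (s : List A) (v : X → List A) (n : ℕ)
    (_ : ∀ x, (v x).length ≤ n) (D : List (Q × List ℕ)),
    Runs (ruleCmd R) (conf s v D) (conf s v (R.apply v D))
      (C * (n + (baseWord D).length + 1)) ∧
    (baseWord (R.apply v D)).length ≤ (baseWord D).length + C * (n + 1) := by
  refine ⟨3 * R.guard.length + (R.body.map fun a => a.2.length + 1).sum * 20 +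
    7 * R.head.2.length + 7, fun s v n hn D => ⟨?_, ?_⟩⟩
  · refine (runs_checkGuards _ _ s v D _ _ (runs_checkBody R.body _ s v n hn D _ _
      (runs_addFact R.head s v n hn D))).congr ?_ ?_
    · rw [Rule.apply, Rule.fires]
      cases R.guard.all fun g => g.2 (v g.1).head? <;> rfl
    · generalize (R.body.map fun a => a.2.length + 1).sum = S
      generalize (baseWord D).length = B
      ring_nf
      nlinarith
  · rw [Rule.apply]
    split
    · have := length_word_atomVal_le hn R.head
      simp only [baseWord, List.flatMap_cons, List.length_append, List.length_reverse,
        List.length_singleton] at this ⊢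
      generalize (R.body.map fun a => a.2.length + 1).sum = S
      have : 0 ≤ S * 20 * n + 3 * R.guard.length * n + 6 * R.head.2.length * n := by positivity
      nlinarith
    · omega

/-- Applies several rules. -/
def applyRules (Rs : List (Rule A X Q)) (v : X → List A) (D : List (Q × List ℕ)) :
    List (Q × List ℕ) :=
  Rs.foldl (fun D R => R.apply v D) D

theorem exists_runs_rulesCmd (Rs : List (Rule A X Q)) : ∃ C : ℕ, ∀ (s : List A) (v : X → List A)
    (n : ℕ) (_ : ∀ x, (v x).length ≤ n) (D : List (Q × List ℕ)),
    Runs (rulesCmd Rs) (conf s v D) (conf s v (applyRules Rs v D))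
      (C * (n + (baseWord D).length + 1)) ∧
    (baseWord (applyRules Rs v D)).length ≤ (baseWord D).length + C * (n + 1) := by
  induction Rs with
  | nil => exact ⟨1, fun s v n hn D => ⟨Runs.skip.mono (by omega), by simp [applyRules]⟩⟩
  | cons R Rs ih =>
    obtain ⟨C, hC⟩ := exists_runs_ruleCmd R
    obtain ⟨C', hC'⟩ := ih
    refine ⟨C + C' * (C + 1), fun s v n hn D => ?_⟩
    obtain ⟨h1, h2⟩ := hC s v n hn D
    obtain ⟨h3, h4⟩ := hC' s v n hn (R.apply v D)
    refine ⟨(h1.seq h3).mono ?_, h4.trans ?_⟩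
    · have := Nat.mul_le_mul_left C' h2
      generalize (baseWord (R.apply v D)).length = B' at *
      generalize (baseWord D).length = B at *
      nlinarith [Nat.zero_le (C' * C * B)]
    · nlinarith [Nat.zero_le (C' * C * (n + 1))]

end

section

variable {A V X Q ι : Type}

/-! ### Loops over all suffixes of the input -/

/-- The effect of nested loops, one for each variable in a list, over the suffixes of `s`. -/
def nestFun (s : List A) [DecidableEq X]
    (F : (X → List A) → List (Q × List ℕ) → List (Q × List ℕ)) :
    List X → (X → List A) → List (Q × List ℕ) → List (Q × List ℕ)
  | [], v, D => F v D
  | x :: xs, v, D => s.tails.foldl (fun D l => nestFun s F xs (update v x l) D) D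

variable [DecidableEq X]

/-- Copies the input to the stack of a variable. -/
def copyInp (x : X) : Cmd (Alph A X Q) :=
  .seq (.loop .inp fun a => .push .tmp a)
    (.loop .tmp fun a => .seq (.push .inp a) (.push (.var x) a))

/-- Nested loops over the suffixes of the input.  The additional letter on top of the input makes
the loop start with the input itself. -/
def nest [Inhabited A] : List X → Cmd (Alph A X Q) → Cmd (Alph A X Q)
  | [], c => c
  | x :: xs, c => .seq (copyInp x) (.seq (.push (.var x) default)
      (.loop (.var x) fun _ => nest xs c))

/-- Repeats a program `m` times. -/
def rep (c : Cmd (Alph A X Q)) : ℕ → Cmd (Alph A X Q)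
  | 0 => .skip
  | m + 1 => .seq c (rep c m)

theorem runs_copyInp (s : List A) (v : X → List A) (D : List (Q × List ℕ)) (x : X) (hx : v x = []) :
    Runs (copyInp x) (conf s v D) (conf s (update v x s) D) (5 * s.length + 2) := by
  have h1 := runs_move (conf s v D) (k := .inp) (i := .tmp) (by simp) id
  have h2 := h1.seq (runs_move₂ _ (k := .tmp) (i := .inp) (j := .var x) (by simp) (by simp)
    (by simp) id id)
  exact h2.congr (by simp [Store.set, Store.toFun, conf, hx])
    (by simp [Store.set, Store.toFun, conf]; omega)

/-- A program whose effect on the facts is described by `F` on the assignments satisfying `P`; as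
long as the list of facts has length at most `M`, it takes time at most `τ` and makes the list
longer by at most `δ`. -/
def Implements (s : List A) (M : ℕ) (P : (X → List A) → Prop) (c : Cmd (Alph A X Q))
    (F : (X → List A) → List (Q × List ℕ) → List (Q × List ℕ)) (δ τ : ℕ) : Prop :=
  ∀ v D, P v → (baseWord D).length + δ ≤ M →
    Runs c (conf s v D) (conf s v (F v D)) τ ∧
    (baseWord (F v D)).length ≤ (baseWord D).length + δ

theorem Implements.rep {s : List A} {M : ℕ} {P : (X → List A) → Prop} {c : Cmd (Alph A X Q)}
    {F : (X → List A) → List (Q × List ℕ) → List (Q × List ℕ)} {δ τ : ℕ}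
    (h : Implements s M P c F δ τ) (m : ℕ) :
    Implements s M P (rep c m) (fun v => (F v)^[m]) (m * δ) (m * τ + 1) := by
  induction m with
  | zero => exact fun v D _ _ => ⟨Runs.skip.mono (by omega), by simp⟩
  | succ m ih =>
    intro v D hv hD
    rw [Nat.succ_mul] at hD
    obtain ⟨h1, h2⟩ := h v D hv (by omega)
    obtain ⟨h3, h4⟩ := ih v (F v D) hv (by omega)
    refine ⟨(h1.seq h3).mono (by rw [Nat.succ_mul]; omega), ?_⟩
    rw [Nat.succ_mul]
    exact h4.trans (by omega)

theorem Implements.nest [Inhabited A] {s : List A} {M : ℕ} {P : (X → List A) → Prop}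
    {c : Cmd (Alph A X Q)} {F : (X → List A) → List (Q × List ℕ) → List (Q × List ℕ)} {δ τ : ℕ}
    (h : Implements s M P c F δ τ) (xs : List X) (hxs : xs.Nodup)
    (hP : ∀ v, P v → ∀ x ∈ xs, ∀ l, l <:+ s → P (update v x l)) :
    Implements s M (fun v => P v ∧ ∀ x ∈ xs, v x = []) (nest xs c) (nestFun s F xs)
      ((s.length + 1) ^ xs.length * δ) ((s.length + 1) ^ xs.length * (τ + 6 * xs.length)) := by
  induction xs with
  | nil => simpa [Implements, Datalog.nest, nestFun] using h
  | cons x xs ih =>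
    have ih := ih (List.nodup_cons.1 hxs).2 fun v hv x hx => hP v hv x (by simp [hx])
    set δ' := (s.length + 1) ^ xs.length * δ
    set τ' := (s.length + 1) ^ xs.length * (τ + 6 * xs.length)
    have upd : ∀ v l y, (∀ y ∈ xs, v y = ([] : List A)) → y ∈ xs → update v x l y = [] := by
      intro v l y h hy
      rw [update_of_ne (ne_of_mem_of_not_mem hy (List.nodup_cons.1 hxs).1), h y hy]
    have loop : ∀ (l : List A) (a : A) (v : X → List A) (D : List (Q × List ℕ)), l <:+ s → P v →
        (∀ y ∈ xs, v y = []) → (baseWord D).length + (l.length + 1) * δ' ≤ M →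
        Runs (.loop (.var x) fun _ => Datalog.nest xs c) (conf s (update v x (a :: l)) D)
          (conf s (update v x [])
            (l.tails.foldl (fun D l => nestFun s F xs (update v x l) D) D))
          ((l.length + 1) * (τ' + 1) + 1) ∧
        (baseWord (l.tails.foldl (fun D l => nestFun s F xs (update v x l) D) D)).length ≤
          (baseWord D).length + (l.length + 1) * δ' := by
      intro l
      have pop : ∀ (v : X → List A) (a : A) l D, ((conf s (update v x (a :: l)) D) :
          Store A X Q).set (.var x) l = conf s (update v x l) D := by
        intro v a l D
        simp [conf, Store.set]
      have top : ∀ (v : X → List A) l D, ((conf s (update v x l) D) :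
          Store A X Q).toFun (.var x) = l := by
        intro v l D
        simp [conf, Store.toFun]
      induction l with
      | nil =>
        intro a v D hl hv hxs' hD
        obtain ⟨h1, h2⟩ := ih (update v x []) D ⟨hP v hv x (by simp) _ hl, fun y => upd v _ y hxs'⟩
          (by simpa using hD)
        rw [← pop v a] at h1
        refine ⟨(Runs.loop_cons (k := .var x) (top ..) h1 ?_).mono
          (t := τ' + 1 + 1) (by simp), by simpa using h2⟩
        exact Runs.loop_nil (k := .var x) (top ..)
      | cons b l ih' =>
        intro a v D hl hv hxs' hD
        rw [List.length_cons, Nat.succ_mul] at hD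
        obtain ⟨h1, h2⟩ := ih (update v x (b :: l)) D ⟨hP v hv x (by simp) _ hl,
          fun y => upd v _ y hxs'⟩ (by omega)
        obtain ⟨h3, h4⟩ := ih' b v (nestFun s F xs (update v x (b :: l)) D)
          ((List.suffix_cons b l).trans hl) hv hxs' (by omega)
        rw [List.tails_cons, List.foldl_cons, List.length_cons, Nat.succ_mul _ δ', Nat.succ_mul]
        rw [← pop v a] at h1
        exact ⟨(Runs.loop_cons (k := .var x) (top ..) h1 h3).mono (by omega), by omega⟩
    rintro v D ⟨hv, hvx⟩ hD
    have hx : v x = [] := hvx x (by simp)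
    have hδ : (s.length + 1) ^ (x :: xs).length * δ = (s.length + 1) * δ' := by
      simp only [List.length_cons, δ']
      ring
    rw [hδ] at hD ⊢
    have h1 := runs_copyInp s v D x hx
    have h2 : Runs (.push (.var x) default) (conf s (update v x s) D)
        (conf s (update v x (default :: s)) D) 1 :=
      (Runs.push (k := .var x) (default : A)).congr (by simp [conf, Store.set, Store.toFun]) le_rfl
    obtain ⟨h3, h4⟩ := loop s default v D List.suffix_rfl hv (fun y hy => hvx y (by simp [hy])) hD
    have hvx' : update v x [] = v := by rw [← hx, update_eq_self]
    rw [hvx'] at h3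
    refine ⟨(h1.seq (h2.seq h3)).mono ?_, h4⟩
    have hτ : (s.length + 1) ^ (x :: xs).length * (τ + 6 * (x :: xs).length) =
        (s.length + 1) * (τ' + 6 * (s.length + 1) ^ xs.length) := by
      simp only [List.length_cons, τ']
      ring
    have hpos : 1 ≤ (s.length + 1) ^ xs.length := Nat.one_le_pow _ _ (by omega)
    rw [hτ]
    nlinarith

/-! ### The effect of the loops on the facts -/

omit [DecidableEq X] in
/-- A counter that every element of a list increases by `m`. -/
theorem foldl_counter {α β : Type} {J : ℕ → β → Prop} {m : ℕ} (l : List α) (f : β → α → β)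
    (h : ∀ a ∈ l, ∀ t b, J t b → J (t + m) (f b a)) (t : ℕ) (b : β) (hb : J t b) :
    J (t + l.length * m) (l.foldl f b) := by
  induction l generalizing t b with
  | nil => simpa using hb
  | cons a l ih =>
    have := ih (fun a ha => h a (by simp [ha])) _ _ (h a (by simp) t b hb)
    rw [List.length_cons, Nat.succ_mul, List.foldl_cons]
    convert this using 1
    omega

omit [DecidableEq X] in
/-- If all steps are extensive, then each step takes effect. -/
theorem foldl_visit {α γ : Type} (l : List α) (f : List γ → α → List γ)
    (h : ∀ a ∈ l, ∀ D, D ⊆ f D a) (D : List γ) :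
    D ⊆ l.foldl f D ∧ ∀ a ∈ l, ∃ D', D ⊆ D' ∧ f D' a ⊆ l.foldl f D := by
  induction l generalizing D with
  | nil => simp
  | cons b l ih =>
    obtain ⟨h1, h2⟩ := ih (fun a ha => h a (by simp [ha])) (f D b)
    have hb := h b (by simp) D
    refine ⟨List.Subset.trans hb h1, fun a ha => ?_⟩
    rcases List.mem_cons.1 ha with rfl | ha
    · exact ⟨D, List.Subset.refl _, h1⟩
    · obtain ⟨D', h3, h4⟩ := h2 a ha
      exact ⟨D', List.Subset.trans hb h3, h4⟩

/-- A counter that every execution of the loop body increases by `m`. -/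
theorem nestFun_counter {s : List A}
    {F : (X → List A) → List (Q × List ℕ) → List (Q × List ℕ)} {P : (X → List A) → Prop}
    {J : ℕ → List (Q × List ℕ) → Prop} {m : ℕ}
    (h : ∀ v, P v → ∀ t D, J t D → J (t + m) (F v D)) (xs : List X)
    (hP : ∀ v, P v → ∀ x ∈ xs, ∀ l, l <:+ s → P (update v x l)) (v : X → List A) (hv : P v) (t : ℕ)
    (D : List (Q × List ℕ)) (hD : J t D) :
    J (t + (s.length + 1) ^ xs.length * m) (nestFun s F xs v D) := by
  induction xs generalizing v t D with
  | nil => simpa [nestFun] using h v hv t D hD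
  | cons x xs ih =>
    have := foldl_counter (m := (s.length + 1) ^ xs.length * m) s.tails
      (fun D l => nestFun s F xs (update v x l) D) (fun l hl t D hD =>
        ih (fun v hv x hx => hP v hv x (by simp [hx])) _
          (hP v hv x (by simp) l ((List.mem_tails _ _).1 hl)) t D hD) t D hD
    rw [List.length_tails] at this
    rw [nestFun, List.length_cons, pow_succ, mul_comm (_ ^ _) (_ + 1), mul_assoc]
    exact this

/-- The loop body is executed for every assignment of suffixes to the loop variables. -/
theorem nestFun_visit {s : List A}
    {F : (X → List A) → List (Q × List ℕ) → List (Q × List ℕ)}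
    (h : ∀ v D, D ⊆ F v D) (xs : List X) (v : X → List A) (D : List (Q × List ℕ)) :
    D ⊆ nestFun s F xs v D ∧ ∀ v' : X → List A, (∀ x ∈ xs, v' x <:+ s) →
      (∀ x, x ∉ xs → v' x = v x) → ∃ D', D ⊆ D' ∧ F v' D' ⊆ nestFun s F xs v D := by
  induction xs generalizing v D with
  | nil =>
    refine ⟨h v D, fun v' _ hv' => ⟨D, List.Subset.refl _, ?_⟩⟩
    rw [show v' = v from funext fun x => hv' x (by simp)]
    exact List.Subset.refl _
  | cons x xs ih =>
    obtain ⟨h1, h2⟩ := foldl_visit s.tails (fun D l => nestFun s F xs (update v x l) D)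
      (fun l _ D => (ih _ D).1) D
    refine ⟨h1, fun v' hs hv' => ?_⟩
    obtain ⟨D', h3, h4⟩ := h2 (v' x) ((List.mem_tails _ _).2 (hs x (by simp)))
    obtain ⟨D'', h5, h6⟩ := (ih (update v x (v' x)) D').2 v' (fun y hy => hs y (by simp [hy]))
      (fun y hy => by
        by_cases hyx : y = x
        · subst hyx; simp
        · rw [update_of_ne hyx]; exact hv' y (by simp [hyx, hy]))
    exact ⟨D'', List.Subset.trans h3 h5, List.Subset.trans h6 h4⟩

end

section

variable {A V X Q ι : Type}

/-! ### The least fixed point -/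

theorem termVal_suffix {s : List A} {v : V → List A} (hv : ∀ x, v x <:+ s) (t : V × Bool) :
    termVal v t <:+ s := by
  rw [termVal]
  split
  · exact (List.tail_suffix _).trans (hv _)
  · exact hv _

theorem Der.suffix {rule : ι → Rule A V Q} {s : List A} {q : Q} {as : List (List A)}
    (h : Der rule s q as) : ∀ a ∈ as, a <:+ s := by
  cases h with
  | mk i v hv hg hb =>
    intro a ha
    obtain ⟨t, -, rfl⟩ := List.mem_map.1 ha
    exact termVal_suffix hv t

/-- Suffixes of a word are determined by their lengths. -/
theorem eq_of_map_length_eq {s : List A} {as bs : List (List A)} (ha : ∀ a ∈ as, a <:+ s)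
    (hb : ∀ b ∈ bs, b <:+ s) (h : as.map List.length = bs.map List.length) : as = bs := by
  induction as generalizing bs with
  | nil => cases bs <;> simp_all
  | cons a as ih =>
    cases bs with
    | nil => simp at h
    | cons b bs =>
      simp only [List.map_cons, List.cons.injEq] at h
      have h1 : a = b := (List.suffix_of_suffix_length_le (ha a (by simp)) (hb b (by simp))
        h.1.le).eq_of_length h.1
      rw [h1, ih (fun a ha' => ha a (by simp [ha'])) (fun b hb' => hb b (by simp [hb'])) h.2]

variable [DecidableEq Q]

/-- All facts in the list `D` are derivable. -/
def Sound (rule : ι → Rule A V Q) (s : List A) (D : List (Q × List ℕ)) : Prop :=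
  ∀ f ∈ D, ∃ as, Der rule s f.1 as ∧ f.2 = as.map List.length

/-- The list `D` of facts is closed under the application of rules. -/
def Closed (rule : ι → Rule A V Q) (s : List A) (D : List (Q × List ℕ)) : Prop :=
  ∀ i v, (∀ x, v x <:+ s) → (rule i).fires v D = true → atomVal v (rule i).head ∈ D

theorem Rule.fires_iff {R : Rule A V Q} {v : V → List A} {D : List (Q × List ℕ)} :
    R.fires v D = true ↔
      (∀ g ∈ R.guard, g.2 (v g.1).head? = true) ∧ ∀ a ∈ R.body, atomVal v a ∈ D := by
  simp [Rule.fires]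

theorem Rule.fires_mono {R : Rule A V Q} {v : V → List A} {D D' : List (Q × List ℕ)} (h : D ⊆ D')
    (hR : R.fires v D = true) : R.fires v D' = true := by
  rw [Rule.fires_iff] at hR ⊢
  exact ⟨hR.1, fun a ha => h (hR.2 a ha)⟩

theorem Rule.subset_apply (R : Rule A V Q) (v : V → List A) (D : List (Q × List ℕ)) :
    D ⊆ R.apply v D := by
  rw [Rule.apply]
  split
  · exact List.subset_cons_self _ _
  · exact List.Subset.refl _

theorem Sound.apply {rule : ι → Rule A V Q} {s : List A} {D : List (Q × List ℕ)}
    (h : Sound rule s D) (i : ι) {v : V → List A} (hv : ∀ x, v x <:+ s) :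
    Sound rule s ((rule i).apply v D) := by
  rw [Rule.apply]
  split
  · rename_i hf
    rw [Rule.fires_iff] at hf
    intro f hf'
    rcases List.mem_cons.1 hf' with rfl | hf'
    · refine ⟨_, Der.mk i v hv hf.1 fun a ha => ?_, by simp [atomVal]⟩
      obtain ⟨as, h1, h2⟩ := h _ (hf.2 a ha)
      have : a.2.map (termVal v) = as := by
        refine eq_of_map_length_eq ?_ h1.suffix (by simpa [atomVal, Function.comp_def] using h2)
        intro b hb
        obtain ⟨t, -, rfl⟩ := List.mem_map.1 hb
        exact termVal_suffix hv t
      rw [this]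
      exact h1
    · exact h f hf'
  · exact h

/-- A closed list contains all derivable facts. -/
theorem Closed.mem {rule : ι → Rule A V Q} {s : List A} {D : List (Q × List ℕ)}
    (h : Closed rule s D) {q : Q} {as : List (List A)} (hd : Der rule s q as) :
    (q, as.map List.length) ∈ D := by
  induction hd with
  | mk i v hv hg hb ih =>
    have := h i v hv (Rule.fires_iff.2 ⟨hg, fun a ha => by
      simpa [atomVal, Function.comp_def] using ih a ha⟩)
    simpa [atomVal, Function.comp_def] using this

variable [Fintype V] [DecidableEq V] [Fintype ι]

/-- The conclusions of all instances of the rules. -/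
def heads (rule : ι → Rule A V Q) (s : List A) : Finset (Q × List ℕ) :=
  (Finset.univ : Finset (ι × (V → Fin (s.length + 1)))).image fun p =>
    atomVal (fun x => s.drop (p.2 x)) (rule p.1).head

theorem card_heads_le (rule : ι → Rule A V Q) (s : List A) :
    (heads rule s).card ≤ Fintype.card ι * (s.length + 1) ^ Fintype.card V := by
  refine Finset.card_image_le.trans ?_
  simp

theorem mem_heads (rule : ι → Rule A V Q) (s : List A) (i : ι) {v : V → List A}
    (hv : ∀ x, v x <:+ s) : atomVal v (rule i).head ∈ heads rule s := by
  refine Finset.mem_image.2 ⟨(i, fun x => ⟨s.length - (v x).length, by omega⟩),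
    Finset.mem_univ _, ?_⟩
  congr 1
  funext x
  exact (List.suffix_iff_eq_drop.1 (hv x)).symm

/-- The rules, as rules for the variables of the inner loops of the evaluator. -/
noncomputable def innerRules (rule : ι → Rule A V Q) : List (Rule A (V ⊕ V) Q) :=
  Finset.univ.toList.map fun i => (rule i).map Sum.inl

/-- The variables of the inner loops. -/
noncomputable def innerVars (V : Type) [Fintype V] : List (V ⊕ V) :=
  Finset.univ.toList.map Sum.inl

/-- The variables of the outer loops, which occur in no rule: the outer loops serve to repeat the
passes polynomially often. -/
noncomputable def outerVars (V : Type) [Fintype V] : List (V ⊕ V) :=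
  Finset.univ.toList.map Sum.inr

/-- One pass of the evaluator: all rules are applied under all assignments. -/
noncomputable def pass (rule : ι → Rule A V Q) (s : List A) (v : V ⊕ V → List A)
    (D : List (Q × List ℕ)) : List (Q × List ℕ) :=
  nestFun s (applyRules (innerRules rule)) (innerVars V) v D

/-- The facts that the evaluator finds.  There are more passes than instances of the rules. -/
noncomputable def evaluate (rule : ι → Rule A V Q) (s : List A) : List (Q × List ℕ) :=
  nestFun s (fun v => (pass rule s v)^[Fintype.card ι + 1]) (outerVars V) (fun _ => []) []

omit [Fintype ι] [DecidableEq V] [Fintype V] in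
theorem applyRules_invariant {rule : ι → Rule A V Q} {I : List (Q × List ℕ) → Prop}
    (l : List ι) {v : V ⊕ V → List A}
    (h : ∀ i D, I D → I ((rule i).apply (v ∘ Sum.inl) D)) {D : List (Q × List ℕ)} (hD : I D) :
    I (applyRules (l.map fun i => (rule i).map Sum.inl) v D) := by
  rw [applyRules, List.foldl_map]
  refine foldl_counter (J := fun _ => I) (m := 0) l _ (fun i _ _ D hD => ?_) 0 D hD
  rw [Rule.apply_map]
  exact h i D hD

omit [Fintype ι] [DecidableEq V] [Fintype V] in
theorem applyRules_visit {rule : ι → Rule A V Q} (l : List ι) (v : V ⊕ V → List A)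
    (D : List (Q × List ℕ)) :
    D ⊆ applyRules (l.map fun i => (rule i).map Sum.inl) v D ∧ ∀ i ∈ l, ∃ D', D ⊆ D' ∧
      (rule i).apply (v ∘ Sum.inl) D' ⊆ applyRules (l.map fun i => (rule i).map Sum.inl) v D := by
  simp only [applyRules, List.foldl_map, Rule.apply_map]
  exact foldl_visit l (fun D i => (rule i).apply (v ∘ Sum.inl) D)
    (fun i _ D => Rule.subset_apply _ _ _) D

theorem pass_invariant {rule : ι → Rule A V Q} {s : List A} {I : List (Q × List ℕ) → Prop}
    (h : ∀ i v D, (∀ x, v x <:+ s) → I D → I ((rule i).apply v D)) {v : V ⊕ V → List A}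
    (hv : ∀ x, v x <:+ s) {D : List (Q × List ℕ)} (hD : I D) : I (pass rule s v D) := by
  refine nestFun_counter (J := fun _ => I) (m := 0) (P := fun v => ∀ x, v x <:+ s)
    (fun v hv _ D hD => applyRules_invariant _ (fun i D => h i _ D fun x => hv _) hD) _
    (fun v hv x _ l hl y => ?_) v hv 0 D hD
  by_cases hy : y = x
  · subst hy; simpa using hl
  · simpa [hy] using hv y

theorem subset_pass (rule : ι → Rule A V Q) (s : List A) (v : V ⊕ V → List A)
    (D : List (Q × List ℕ)) : D ⊆ pass rule s v D :=
  (nestFun_visit (fun v D => (applyRules_visit _ v D).1) _ v D).1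

/-- In every pass, all applicable rules are applied. -/
theorem mem_pass (rule : ι → Rule A V Q) (s : List A) (v : V ⊕ V → List A)
    (D : List (Q × List ℕ)) (i : ι) {v' : V → List A} (hv' : ∀ x, v' x <:+ s)
    (hf : (rule i).fires v' D = true) : atomVal v' (rule i).head ∈ pass rule s v D := by
  obtain ⟨D', h1, h2⟩ := (nestFun_visit (s := s) (F := applyRules (innerRules rule))
    (fun v D => (applyRules_visit _ v D).1) (innerVars V) v D).2 (Sum.elim v' (v ∘ Sum.inr))
    (by simp [innerVars, hv']) (by simp [innerVars])
  obtain ⟨D'', h3, h4⟩ := (applyRules_visit (rule := rule) Finset.univ.toList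
    (Sum.elim v' (v ∘ Sum.inr)) D').2 i (by simp)
  refine h2 (h4 ?_)
  rw [Sum.elim_comp_inl, Rule.apply, if_pos (Rule.fires_mono (List.Subset.trans h1 h3) hf)]
  exact List.mem_cons_self

/-- After a pass the list of facts is closed, or it has a new element. -/
theorem closed_or_card_pass {rule : ι → Rule A V Q} {s : List A} {v : V ⊕ V → List A}
    (hv : ∀ x, v x <:+ s) {t : ℕ} {D : List (Q × List ℕ)}
    (h : Closed rule s D ∨ t ≤ D.toFinset.card) :
    Closed rule s (pass rule s v D) ∨ t + 1 ≤ (pass rule s v D).toFinset.card := by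
  have hsub := subset_pass rule s v D
  by_cases hc : Closed rule s D
  · left
    have hsub' : pass rule s v D ⊆ D := by
      refine pass_invariant (I := fun D' => D' ⊆ D) (fun i v D' hv hD' => ?_) hv
        (List.Subset.refl _)
      rw [Rule.apply]
      split
      · rename_i hf
        exact List.cons_subset.2 ⟨hc i v hv (Rule.fires_mono hD' hf), hD'⟩
      · exact hD'
    exact fun i v hv hf => hsub (hc i v hv (Rule.fires_mono hsub' hf))
  · right
    have ht := h.resolve_left hc
    simp only [Closed, not_forall] at hc
    obtain ⟨i, v', hv', hf, hmem⟩ := hc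
    refine Nat.succ_le_of_lt (ht.trans_lt (Finset.card_lt_card ?_))
    refine Finset.ssubset_iff_subset_ne.2 ⟨fun f hf => ?_, fun heq => hmem ?_⟩
    · rw [List.mem_toFinset] at hf ⊢
      exact hsub hf
    · rw [← List.mem_toFinset, heq, List.mem_toFinset]
      exact mem_pass rule s v D i hv' hf

omit [DecidableEq Q] [DecidableEq V] [Fintype ι] [Fintype V] in
/-- A counter that every application of a function increases by one. -/
theorem iterate_counter {β : Type} {J : ℕ → β → Prop} (f : β → β)
    (h : ∀ t b, J t b → J (t + 1) (f b)) (m t : ℕ) (b : β) (hb : J t b) : J (t + m) (f^[m] b) := by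
  induction m generalizing t b with
  | zero => exact hb
  | succ m ih =>
    have := ih _ _ (h t b hb)
    rw [Function.iterate_succ_apply]
    convert this using 1
    omega

/-- A counter that every pass increases by one. -/
theorem evaluate_counter {rule : ι → Rule A V Q} {s : List A} {J : ℕ → List (Q × List ℕ) → Prop}
    (h : ∀ v t D, (∀ x, v x <:+ s) → J t D → J (t + 1) (pass rule s v D)) (h₀ : J 0 []) :
    J ((s.length + 1) ^ Fintype.card V * (Fintype.card ι + 1)) (evaluate rule s) := by
  have := nestFun_counter (J := J) (m := Fintype.card ι + 1) (P := fun v => ∀ x, v x <:+ s)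
    (F := fun v => (pass rule s v)^[Fintype.card ι + 1])
    (fun v hv t D hD => iterate_counter _ (fun t D => h v t D hv) _ t D hD) (outerVars V)
    (fun v hv x _ l hl y => by
      by_cases hy : y = x
      · subst hy; simpa using hl
      · simpa [hy] using hv y)
    (fun _ => []) (fun _ => List.nil_suffix) 0 [] h₀
  have hlen : (outerVars V).length = Fintype.card V := by simp [outerVars]
  rwa [zero_add, hlen] at this

/-- The evaluator finds exactly the derivable facts. -/
theorem mem_evaluate_iff (rule : ι → Rule A V Q) (s : List A) (q : Q) (as : List (List A))
    (has : ∀ a ∈ as, a <:+ s) :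
    (q, as.map List.length) ∈ evaluate rule s ↔ Der rule s q as := by
  have hsound : Sound rule s (evaluate rule s) :=
    evaluate_counter (J := fun _ => Sound rule s)
      (fun v t D hv hD => pass_invariant (fun i v D hv hD => hD.apply i hv) hv hD)
      (fun f hf => by simp at hf)
  have hheads : ∀ f ∈ evaluate rule s, f ∈ heads rule s := by
    refine evaluate_counter (J := fun _ D => ∀ f ∈ D, f ∈ heads rule s)
      (fun v t D hv hD => pass_invariant (I := fun D => ∀ f ∈ D, f ∈ heads rule s)
        (fun i v D hv hD => ?_) hv hD) (fun f hf => by simp at hf)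
    rw [Rule.apply]
    split
    · exact List.forall_mem_cons.2 ⟨mem_heads rule s i hv, hD⟩
    · exact hD
  have hcard : (evaluate rule s).toFinset.card ≤ (heads rule s).card :=
    Finset.card_le_card fun f hf => hheads f (List.mem_toFinset.1 hf)
  have hclosed : Closed rule s (evaluate rule s) := by
    rcases evaluate_counter (J := fun t D => Closed rule s D ∨ t ≤ D.toFinset.card)
      (fun v t D hv hD => closed_or_card_pass hv hD) (Or.inr (Nat.zero_le _)) with h | h
    · exact h
    · -- more passes than facts
      have h1 := (h.trans hcard).trans (card_heads_le rule s)
      have h2 : 0 < (s.length + 1) ^ Fintype.card V := by positivity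
      nlinarith
  refine ⟨fun h => ?_, fun h => hclosed.mem h⟩
  obtain ⟨bs, h1, h2⟩ := hsound _ h
  rw [eq_of_map_length_eq has h1.suffix h2]
  exact h1

/-! ### Datalog queries are evaluated in polynomial time -/

/-- The program that evaluates the rules and then looks for the fact that `q` holds of the input. -/
noncomputable def evalCmd [Inhabited A] (rule : ι → Rule A V Q) (q : Q) (x : V) :
    Cmd (Alph A (V ⊕ V) Q) :=
  .seq (nest (outerVars V)
    (rep (nest (innerVars V) (rulesCmd (innerRules rule))) (Fintype.card ι + 1)))
    (.seq (copyInp (.inl x)) (query q [(.inl x, false)]))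

theorem exists_runs_evalCmd [Inhabited A] (rule : ι → Rule A V Q) (q : Q) (x : V) :
    ∃ p : Polynomial ℕ, ∀ s : List A, ∃ τ : Store A (V ⊕ V) Q,
      Runs (evalCmd rule q x) (conf s (fun _ => []) []) τ (p.eval s.length) ∧
      (τ.found ≠ [] ↔ Der rule s q [s]) := by
  obtain ⟨C, hC⟩ := exists_runs_rulesCmd (innerRules rule)
  let k := Fintype.card V
  let m := Fintype.card ι + 1
  -- the maximal growth of the list of facts in one pass, its maximal length, and the time needed
  -- for the application of the rules, the inner loops, and the outer loops
  let δ : Polynomial ℕ := (.X + 1) ^ k * (.C C * (.X + 1))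
  let M : Polynomial ℕ := (.X + 1) ^ k * (.C m * δ)
  let τ₁ : Polynomial ℕ := .C C * (.X + M + 1)
  let τ₂ : Polynomial ℕ := (.X + 1) ^ k * (τ₁ + 6 * .C k)
  let τ₃ : Polynomial ℕ := (.X + 1) ^ k * (.C m * τ₂ + 1 + 6 * .C k)
  refine ⟨τ₃ + (5 * .X + 2) + (9 * .X + 14 * M + 18), fun s => ?_⟩
  set n := s.length with hn
  have hinner : (innerVars V).length = k := by simp [innerVars, k]
  have houter : (outerVars V).length = k := by simp [outerVars, k]
  have h1 : Implements s (M.eval n) (fun v => ∀ x, v x <:+ s) (rulesCmd (innerRules rule))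
      (applyRules (innerRules rule)) (C * (n + 1)) (τ₁.eval n) := by
    intro v D hv hD
    obtain ⟨h1, h2⟩ := hC s v n (fun x => (hv x).length_le) D
    refine ⟨h1.mono ?_, h2⟩
    simp only [τ₁, Polynomial.eval_mul, Polynomial.eval_add, Polynomial.eval_C, Polynomial.eval_X,
      Polynomial.eval_one]
    exact Nat.mul_le_mul_left _ (by omega)
  have hP : ∀ v : V ⊕ V → List A, (∀ x, v x <:+ s) → ∀ (x : V ⊕ V) (l : List A), l <:+ s →
      ∀ y, update v x l y <:+ s := by
    intro v hv x l hl y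
    by_cases hy : y = x
    · subst hy; simpa using hl
    · simpa [hy] using hv y
  have h2 := (h1.nest (innerVars V) (Finset.univ.nodup_toList.map Sum.inl_injective)
    fun v hv x _ => hP v hv x).rep m
  have h3 := h2.nest (outerVars V) (Finset.univ.nodup_toList.map Sum.inr_injective)
    fun v hv x hx l hl => ⟨hP v hv.1 x l hl, fun y hy => by
      have : y ≠ x := by
        rintro rfl
        simp only [innerVars, outerVars, List.mem_map] at hx hy
        obtain ⟨a, -, rfl⟩ := hx
        obtain ⟨b, -, hb⟩ := hy
        cases hb
      rw [update_of_ne this, hv.2 y hy]⟩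
  rw [hinner, houter, ← hn] at h3
  have hM : (n + 1) ^ k * (m * ((n + 1) ^ k * (C * (n + 1)))) = M.eval n := by
    simp [M, δ]
  have hτ : (n + 1) ^ k * (m * ((n + 1) ^ k * (τ₁.eval n + 6 * k)) + 1 + 6 * k) = τ₃.eval n := by
    simp [τ₃, τ₂]
  rw [hM, hτ] at h3
  obtain ⟨h4, h5⟩ := h3 (fun _ => []) [] ⟨⟨fun _ => List.nil_suffix, by simp⟩, by simp⟩
    (by simp [baseWord])
  change Runs _ _ (conf s _ (evaluate rule s)) _ at h4
  change (baseWord (evaluate rule s)).length ≤ _ at h5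
  have h6 := runs_copyInp s (fun _ => []) (evaluate rule s) (Sum.inl x : V ⊕ V) rfl
  have h7 := runs_query s (update (fun _ => []) (Sum.inl x : V ⊕ V) s) (evaluate rule s)
    (q, [((Sum.inl x : V ⊕ V), false)]) n (fun y => by
      by_cases hy : y = (Sum.inl x : V ⊕ V)
      · subst hy; simp [hn]
      · simp [hy])
  refine ⟨_, (h4.seq (h6.seq h7)).mono ?_, ?_⟩
  · simp only [baseWord, List.flatMap_nil, List.length_nil, zero_add] at h5
    simp only [baseWord, Polynomial.eval_add, Polynomial.eval_mul, Polynomial.eval_X,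
      Polynomial.eval_ofNat, List.length_singleton]
    omega
  · rw [← mem_evaluate_iff rule s q [s] (by simp)]
    simp [atomVal, termVal, List.count_eq_zero]

omit [Fintype ι] [DecidableEq V] [Fintype V] [DecidableEq Q] in
theorem toFun_conf_nil [DecidableEq X] (s : List A) :
    (conf s (fun _ => []) [] : Store A X Q).toFun =
      update (β := fun k => List (Alph A X Q k)) (fun _ => []) .inp s := by
  funext k
  cases k <;> simp [Store.toFun, conf, baseWord]

/-- Languages that are defined by Datalog rules over the suffixes of a word belong to `P`. -/
theorem inPTime_of_der [Finite A] [Inhabited A] [Finite Q] (rule : ι → Rule A V Q) (q : Q) (x : V)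
    (L : Language A) (hL : ∀ s, s ∈ L ↔ Der rule s q [s]) : InPTime L := by
  obtain ⟨p, hp⟩ := exists_runs_evalCmd rule q x
  refine inPTime_of_exec L (K := Stk (V ⊕ V)) (Γ := Alph A (V ⊕ V) Q) .inp .out .found
    (Equiv.refl A) (Equiv.refl Bool) (evalCmd rule q x) p fun s => ?_
  obtain ⟨τ, h1, h2⟩ := hp s
  refine ⟨τ.toFun, ?_, by rw [hL]; exact h2⟩
  change Exec _ (update (β := fun k => List (Alph A (V ⊕ V) Q k)) (fun _ => []) .inp
    (s.map id)) _ _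
  rw [List.map_id, ← toFun_conf_nil]
  exact h1

end

end Datalog

/-! ### TPTL over suffixes of written words -/

namespace TPTL

open Function Datalog

/-- The truth value of an until formula over the remainder of a written word; `P` and `Q` are the
meanings of the two arguments, at a letter followed by a remainder. -/
def UntilHolds (P Q : List ℕ × ℕ → WrittenWord → Prop) : WrittenWord → Prop
  | [] => False
  | a :: u => Q a u ∨ P a u ∧ UntilHolds P Q u

/-- The satisfaction relation at the first letter `a` of the written word `a :: u`. -/
def Formula.Holds : Formula → List ℕ × ℕ → WrittenWord → (ℕ → ℤ) → Prop
  | .tt, _, _, _ => True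
  | .prop p, a, _, _ => p ∈ a.1
  | .constr x R c, a, _, ν => R.Holds ((a.2 : ℤ) - ν x) c
  | .neg φ, a, u, ν => ¬ φ.Holds a u ν
  | .conj φ ψ, a, u, ν => φ.Holds a u ν ∧ ψ.Holds a u ν
  | .untl φ ψ, _, u, ν => UntilHolds (fun a u => φ.Holds a u ν) (fun a u => ψ.Holds a u ν) u
  | .freeze x φ, a, u, ν => φ.Holds a u (update ν x a.2)

theorem untilHolds_iff {P Q : List ℕ × ℕ → WrittenWord → Prop} {u : WrittenWord} :
    UntilHolds P Q u ↔ ∃ (j : ℕ) (hj : j < u.length), Q u[j] (u.drop (j + 1)) ∧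
      ∀ (k : ℕ) (hk : k < j), P u[k] (u.drop (k + 1)) := by
  induction u with
  | nil => simp [UntilHolds]
  | cons a u ih =>
    rw [UntilHolds, ih]
    constructor
    · rintro (h | ⟨h, j, hj, h1, h2⟩)
      · exact ⟨0, by simp, by simpa using h, by simp⟩
      · refine ⟨j + 1, by simpa using hj, by simpa using h1, fun k hk => ?_⟩
        cases k with
        | zero => simpa using h
        | succ k => simpa using h2 k (by omega)
    · rintro ⟨j, hj, h1, h2⟩
      cases j with
      | zero => exact .inl (by simpa using h1)
      | succ j =>
        refine .inr ⟨by simpa using h2 0 (by omega), j, by simpa using hj, by simpa using h1,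
          fun k hk => by simpa using h2 (k + 1) (by omega)⟩

theorem sat_iff_holds (u : WrittenWord) (φ : Formula) : ∀ (i : Fin u.toDataWord.length)
    (hi : i.1 < u.length) (ν : ℕ → ℤ),
    Sat u.toDataWord φ i ν ↔ φ.Holds u[i.1] (u.drop (i.1 + 1)) ν := by
  induction φ with
  | tt => simp [Sat, Formula.Holds]
  | prop p => simp [Sat, Formula.Holds, WrittenWord.toDataWord]
  | constr x R c => simp [Sat, Formula.Holds, WrittenWord.toDataWord]
  | neg φ ih => intro i hi ν; rw [Sat, Formula.Holds, ih i hi]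
  | conj φ ψ ih₁ ih₂ => intro i hi ν; rw [Sat, Formula.Holds, ih₁ i hi, ih₂ i hi]
  | freeze x φ ih =>
    intro i hi ν
    have e : (u.toDataWord.get i).2 = u[i.1].2 := by
      rw [List.get_eq_getElem]
      simp [WrittenWord.toDataWord]
    rw [Sat, Formula.Holds, ih i hi, e]
  | untl φ ψ ih₁ ih₂ =>
    intro i hi ν
    have hl : u.toDataWord.length = u.length := by simp [WrittenWord.toDataWord]
    rw [Sat, Formula.Holds, untilHolds_iff]
    constructor
    · rintro ⟨j, hij, h1, h2⟩
      have hij' : i.1 < j.1 := hij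
      have hj : j.1 < u.length := hl ▸ j.2
      refine ⟨j.1 - (i.1 + 1), by simp; omega, ?_, fun k hk => ?_⟩
      · have e : i.1 + 1 + (j.1 - (i.1 + 1)) = j.1 := by omega
        have e' : i.1 + 1 + (j.1 - (i.1 + 1) + 1) = j.1 + 1 := by omega
        simp only [List.getElem_drop, List.drop_drop, e, e']
        exact (ih₂ j hj ν).1 h1
      · have := (ih₁ ⟨i.1 + 1 + k, by omega⟩ (by simp only; omega) ν).1
          (h2 _ (Fin.lt_def.2 (by simp only; omega)) (Fin.lt_def.2 (by simp only; omega)))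
        simpa only [List.getElem_drop, List.drop_drop, add_assoc] using this
    · rintro ⟨j, hj, h1, h2⟩
      rw [List.length_drop] at hj
      refine ⟨⟨i.1 + 1 + j, by omega⟩, Fin.lt_def.2 (by simp only; omega), ?_, fun k hk hk' => ?_⟩
      · refine (ih₂ _ (by simp only; omega) ν).2 ?_
        simpa only [List.getElem_drop, List.drop_drop, add_assoc] using h1
      · rw [Fin.lt_def] at hk hk'
        simp only at hk'
        refine (ih₁ _ (by omega) ν).2 ?_
        have := h2 (k.1 - (i.1 + 1)) (by omega)
        have e : i.1 + 1 + (k.1 - (i.1 + 1)) = k.1 := by omega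
        have e' : i.1 + 1 + (k.1 - (i.1 + 1) + 1) = k.1 + 1 := by omega
        simpa only [List.getElem_drop, List.drop_drop, e, e'] using this

theorem models_iff_holds (u : WrittenWord) (φ : Formula) : Models u.toDataWord φ ↔
    ∃ a v, u = a :: v ∧ φ.Holds a v (fun _ => (a.2 : ℤ)) := by
  cases u with
  | nil => simp [Models, WrittenWord.toDataWord]
  | cons a v =>
    have h : 0 < (WrittenWord.toDataWord (a :: v)).length := by simp [WrittenWord.toDataWord]
    have := sat_iff_holds (a :: v) φ ⟨0, h⟩ (by simp) (fun _ => (a.2 : ℤ))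
    constructor
    · rintro ⟨_, h'⟩
      exact ⟨a, v, rfl, this.1 h'⟩
    · rintro ⟨a', v', e, h'⟩
      obtain ⟨rfl, rfl⟩ := List.cons.inj e
      exact ⟨h, this.2 h'⟩

/-! ### Numbers in binary -/

/-- The digit that a letter stands for. -/
def digit : Option Symb → Option Bool
  | some (.bit b) => some b
  | _ => none

/-- The value of a digit; a missing digit counts as zero. -/
def digitVal (b : Option Bool) : ℕ := (b.getD false).toNat

/-- The number whose digits stand at the beginning of a word. -/
def val : List Symb → ℕ
  | .bit b :: l => b.toNat + 2 * val l
  | _ => 0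

theorem encNat_zero : encNat 0 = [Symb.endNum] := rfl

theorem encNat_odd (m : ℕ) : encNat (2 * m + 1) = Symb.bit true :: encNat m := by
  simp [encNat, Nat.bit1_bits]

theorem encNat_even {m : ℕ} (h : m ≠ 0) : encNat (2 * m) = Symb.bit false :: encNat m := by
  simp [encNat, Nat.bit0_bits m h]

/-- Induction along the binary digits of a number. -/
theorem bits_induction {P : ℕ → Prop} (h0 : P 0) (h1 : ∀ m, P m → P (2 * m + 1))
    (h2 : ∀ m, m ≠ 0 → P m → P (2 * m)) (n : ℕ) : P n := by
  induction n using Nat.strong_induction_on with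
  | _ n ih =>
    rcases Nat.even_or_odd' n with ⟨m, rfl | rfl⟩
    · rcases eq_or_ne m 0 with rfl | hm
      · exact h0
      · exact h2 m hm (ih m (by omega))
    · exact h1 m (ih m (by omega))

@[simp]
theorem val_encNat (n : ℕ) (y : List Symb) : val (encNat n ++ y) = n := by
  induction n using bits_induction with
  | h0 => simp [encNat_zero, val]
  | h1 m ih => simp [encNat_odd, val, ih]; omega
  | h2 m hm ih => simp [encNat_even hm, val, ih]

theorem val_eq_digit (x : List Symb) :
    val x = digitVal (digit x.head?) +
      2 * val (if (digit x.head?).isSome then x.tail else x) := by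
  cases x with
  | nil => simp [val, digit, digitVal]
  | cons a x => cases a <;> simp [val, digit, digitVal]

theorem val_eq_zero {x : List Symb} (h : digit x.head? = none) : val x = 0 := by
  cases x with
  | nil => rfl
  | cons a x => cases a <;> simp_all [val, digit]

theorem digitVal_le (b : Option Bool) : digitVal b ≤ 1 := by
  cases b <;> simp [digitVal, Bool.toNat_le]

/-- Numbers are compared by their leading digits first. -/
theorem compare_digit {σ δ m n : ℕ} (hσ : σ ≤ 1) (hδ : δ ≤ 1) :
    compare (σ + 2 * m) (δ + 2 * n) = (compare m n).then (compare σ δ) := by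
  rcases lt_trichotomy m n with h | rfl | h
  · rw [compare_lt_iff_lt.2 h, Ordering.lt_then, compare_lt_iff_lt]
    omega
  · rw [compare_eq_iff_eq.2 rfl, Ordering.eq_then]
    rcases lt_trichotomy σ δ with h | rfl | h
    · rw [compare_lt_iff_lt.2 h, compare_lt_iff_lt]; omega
    · simp
    · rw [compare_gt_iff_gt.2 h, compare_gt_iff_gt]; omega
  · rw [compare_gt_iff_gt.2 h, Ordering.gt_then, compare_gt_iff_gt]
    omega

/-- The truth value of a comparison, given the order of the compared numbers. -/
def Rel.truth : Rel → Ordering → Bool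
  | .lt, o => o.isLT
  | .le, o => o.isLE
  | .eq, o => o.isEq
  | .ge, o => o.isGE
  | .gt, o => o.isGT

theorem Rel.truth_compare (R : Rel) (m n : ℕ) :
    R.truth (compare m n) = true ↔ R.Holds (m : ℤ) (n : ℤ) := by
  cases R <;> simp [Rel.truth, Rel.Holds, compare_lt_iff_lt, compare_gt_iff_gt, Nat.isLE_compare,
    Nat.isGE_compare]

/-! ### Datalog rules for path checking -/

/-- The predicates of the rules.  Their meaning is given by `Sem`. -/
inductive Pred
  | num (pos : Bool) | int | tail | cmp (carry : Bool) (o : Ordering) | eq (b : Bool)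
  | mem (b : Bool) | dat | next | word | form | sat (b : Bool) | unt (b : Bool) | goal
  deriving DecidableEq, Fintype

/-- The variables of the rules.  For each of the `r` registers there is a variable `nm j` for a
place where its name is written, and a variable `rg j` for a place where its value is written. -/
inductive Var (r : ℕ)
  | f | g | w | w' | d | x | y | z | nm (j : Fin r) | rg (j : Fin r)
  deriving DecidableEq, Fintype

set_option synthInstance.maxSize 1000 in
set_option synthInstance.maxHeartbeats 200000 in
/-- The index type of the rules. -/
inductive RuleName (r : ℕ)
  | numEnd | numOdd | numEven | numWeaken | int (neg : Bool) | tail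
  | cmpNil (carry : Bool)
  | cmpCons (a b c : Option Bool) (carry carry' : Bool) (o : Ordering)
  | eq (o : Ordering)
  | memNil | memHead | memTail (b : Bool) | datHead | datTail | nextLast | nextTail
  | wordNil | wordCons
  | formTt | formProp | formConstr (j : Fin r) | formNeg | formConj | formUntl
  | formFreeze (j : Fin r)
  | satTt | satProp (b : Bool) | satNeg (b : Bool) | satConj (b₁ b₂ : Bool)
  | satConstr (R : Rel) (neg : Bool) (o : Ordering) (j : Fin r)
  | satUntl (b : Bool) | satFreeze (b : Bool) (j : Fin r)
  | untNil | untCons (b₁ b₂ b₃ : Bool)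
  | goal
  deriving Fintype

/-- The test for a given letter. -/
def is (a : Symb) (o : Option Symb) : Bool := decide (o = some a)

/-- The places of the names of the registers. -/
def names (r : ℕ) : List (Var r × Bool) := List.ofFn fun j => (.nm j, false)

/-- The places of the values of the registers. -/
def values (r : ℕ) : List (Var r × Bool) := List.ofFn fun j => (.rg j, false)

/-- The premises which say that `j` is the first register whose name is written at `t`. -/
def lookup {r : ℕ} (t : Var r × Bool) (j : Fin r) : List (Pred × List (Var r × Bool)) :=
  (.eq true, [t, (.nm j, false)]) ::
    ((List.finRange r).filter (· < j)).map fun i => (.eq false, [t, (.nm i, false)])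

/-- The rules for path checking.  Every argument of a predicate is the remainder of the input word
from the place where a number, a formula or a letter begins, or ends. -/
def rule (r : ℕ) : RuleName r → Rule Symb (Var r) Pred
  | .numEnd => ⟨[(.x, is .endNum)], [], (.num false, [(.x, false), (.x, true)])⟩
  | .numOdd => ⟨[(.x, is (.bit true))], [(.num false, [(.x, true), (.y, false)])],
      (.num true, [(.x, false), (.y, false)])⟩
  | .numEven => ⟨[(.x, is (.bit false))], [(.num true, [(.x, true), (.y, false)])],
      (.num true, [(.x, false), (.y, false)])⟩
  | .numWeaken => ⟨[], [(.num true, [(.x, false), (.y, false)])],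
      (.num false, [(.x, false), (.y, false)])⟩
  | .int neg => ⟨[(.x, is (.sign neg))], [(.num neg, [(.x, true), (.y, false)])],
      (.int, [(.x, false), (.y, false)])⟩
  | .tail => ⟨[], [], (.tail, [(.x, false), (.x, true)])⟩
  | .cmpNil carry => ⟨[(.x, fun o => decide (digit o = none)),
        (.y, fun o => decide (digit o = none)), (.z, fun o => decide (digit o = none))], [],
      (.cmp carry (compare carry.toNat 0), [(.x, false), (.y, false), (.z, false)])⟩
  | .cmpCons a b c carry carry' o => ⟨[(.x, fun o => decide (digit o = a)),
        (.y, fun o => decide (digit o = b)), (.z, fun o => decide (digit o = c)),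
        -- a condition on the name of the rule: `carry'` is the carry of the addition of the digits
        (.x, fun _ => decide
          (carry'.toNat = (digitVal a + digitVal b + carry.toNat) / 2))],
      [(.cmp carry' o, [(.x, a.isSome), (.y, b.isSome), (.z, c.isSome)])],
      (.cmp carry (o.then (compare ((digitVal a + digitVal b + carry.toNat) % 2) (digitVal c))),
        [(.x, false), (.y, false), (.z, false)])⟩
  | .eq o => ⟨[(.z, fun o => decide (digit o = none))],
      [(.cmp false o, [(.x, false), (.z, false), (.y, false)])],
      (.eq o.isEq, [(.x, false), (.y, false)])⟩
  | .memNil => ⟨[(.w, is .data)], [], (.mem false, [(.w, false), (.x, false)])⟩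
  | .memHead => ⟨[(.w, is .prop)], [(.eq true, [(.w, true), (.x, false)])],
      (.mem true, [(.w, false), (.x, false)])⟩
  | .memTail b => ⟨[(.w, is .prop)], [(.eq false, [(.w, true), (.x, false)]),
        (.num false, [(.w, true), (.w', false)]), (.mem b, [(.w', false), (.x, false)])],
      (.mem b, [(.w, false), (.x, false)])⟩
  | .datHead => ⟨[(.w, is .data)], [], (.dat, [(.w, false), (.w, true)])⟩
  | .datTail => ⟨[(.w, is .prop)], [(.num false, [(.w, true), (.w', false)]),
        (.dat, [(.w', false), (.d, false)])], (.dat, [(.w, false), (.d, false)])⟩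
  | .nextLast => ⟨[(.w, is .data)], [(.num false, [(.w, true), (.w', false)])],
      (.next, [(.w, false), (.w', false)])⟩
  | .nextTail => ⟨[(.w, is .prop)], [(.num false, [(.w, true), (.x, false)]),
        (.next, [(.x, false), (.w', false)])], (.next, [(.w, false), (.w', false)])⟩
  | .wordNil => ⟨[(.w, is .sep)], [], (.word, [(.w, false), (.w, true)])⟩
  | .wordCons => ⟨[], [(.next, [(.w, false), (.w', false)]), (.word, [(.w', false), (.f, false)])],
      (.word, [(.w, false), (.f, false)])⟩
  | .formTt => ⟨[(.f, is .tt)], [], (.form, (.f, false) :: (.f, true) :: names r)⟩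
  | .formProp => ⟨[(.f, is .prop)], [(.num false, [(.f, true), (.g, false)])],
      (.form, (.f, false) :: (.g, false) :: names r)⟩
  | .formConstr j => ⟨[(.f, is .var), (.y, fun o => decide (∃ R, o = some (.rel R)))],
      [(.num false, [(.f, true), (.y, false)]), (.int, [(.y, true), (.g, false)]),
        (.eq true, [(.f, true), (.nm j, false)])],
      (.form, (.f, false) :: (.g, false) :: names r)⟩
  | .formNeg => ⟨[(.f, is .neg)], [(.form, (.f, true) :: (.g, false) :: names r)],
      (.form, (.f, false) :: (.g, false) :: names r)⟩
  | .formConj => ⟨[(.f, is .conj)], [(.form, (.f, true) :: (.y, false) :: names r),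
        (.form, (.y, false) :: (.g, false) :: names r)],
      (.form, (.f, false) :: (.g, false) :: names r)⟩
  | .formUntl => ⟨[(.f, is .untl)], [(.form, (.f, true) :: (.y, false) :: names r),
        (.form, (.y, false) :: (.g, false) :: names r)],
      (.form, (.f, false) :: (.g, false) :: names r)⟩
  | .formFreeze j => ⟨[(.f, is .freeze)], [(.num false, [(.f, true), (.y, false)]),
        (.form, (.y, false) :: (.g, false) :: names r),
        (.eq true, [(.f, true), (.nm j, false)])],
      (.form, (.f, false) :: (.g, false) :: names r)⟩
  | .satTt => ⟨[(.f, is .tt)], [],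
      (.sat true, (.f, false) :: (.w, false) :: (names r ++ values r))⟩
  | .satProp b => ⟨[(.f, is .prop)], [(.mem b, [(.w, false), (.f, true)])],
      (.sat b, (.f, false) :: (.w, false) :: (names r ++ values r))⟩
  | .satNeg b => ⟨[(.f, is .neg)], [(.sat b, (.f, true) :: (.w, false) :: (names r ++ values r))],
      (.sat !b, (.f, false) :: (.w, false) :: (names r ++ values r))⟩
  | .satConj b₁ b₂ => ⟨[(.f, is .conj)], [(.form, (.f, true) :: (.g, false) :: names r),
        (.sat b₁, (.f, true) :: (.w, false) :: (names r ++ values r)),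
        (.sat b₂, (.g, false) :: (.w, false) :: (names r ++ values r))],
      (.sat (b₁ && b₂), (.f, false) :: (.w, false) :: (names r ++ values r))⟩
  | .satConstr R neg o j => ⟨[(.f, is .var), (.y, is (.rel R)), (.z, is (.sign neg))],
      [(.num false, [(.f, true), (.y, false)]), (.tail, [(.y, false), (.z, false)]),
        (.dat, [(.w, false), (.d, false)]),
        -- `d - ν x ∼ c` is decided by comparing `ν x + c` with `d`, or `d - c` with `ν x` if `c`
        -- is negative
        (.cmp false o, if neg then [(.d, false), (.z, true), (.rg j, false)]
          else [(.rg j, false), (.z, true), (.d, false)])] ++ lookup (.f, true) j,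
      (.sat (R.truth (if neg then o else o.swap)),
        (.f, false) :: (.w, false) :: (names r ++ values r))⟩
  | .satUntl b => ⟨[(.f, is .untl)], [(.form, (.f, true) :: (.g, false) :: names r),
        (.next, [(.w, false), (.w', false)]),
        (.unt b, (.f, true) :: (.g, false) :: (.w', false) :: (names r ++ values r))],
      (.sat b, (.f, false) :: (.w, false) :: (names r ++ values r))⟩
  | .satFreeze b j => ⟨[(.f, is .freeze)], [(.num false, [(.f, true), (.g, false)]),
        (.dat, [(.w, false), (.d, false)]),
        (.sat b, (.g, false) :: (.w, false) :: (names r ++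
          List.ofFn fun i => (if i = j then .d else .rg i, false)))] ++ lookup (.f, true) j,
      (.sat b, (.f, false) :: (.w, false) :: (names r ++ values r))⟩
  | .untNil => ⟨[(.w, is .sep)], [],
      (.unt false, (.f, false) :: (.g, false) :: (.w, false) :: (names r ++ values r))⟩
  | .untCons b₁ b₂ b₃ => ⟨[(.w, fun o => !is .sep o)],
      [(.sat b₁, (.f, false) :: (.w, false) :: (names r ++ values r)),
        (.sat b₂, (.g, false) :: (.w, false) :: (names r ++ values r)),
        (.next, [(.w, false), (.w', false)]),
        (.unt b₃, (.f, false) :: (.g, false) :: (.w', false) :: (names r ++ values r))],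
      (.unt (b₂ || b₁ && b₃), (.f, false) :: (.g, false) :: (.w, false) ::
        (names r ++ values r))⟩
  | .goal => ⟨[(.w, fun o => !is .sep o), (.g, fun o => decide (o = none))],
      [(.word, [(.w, false), (.f, false)]), (.form, (.f, false) :: (.g, false) :: names r),
        (.dat, [(.w, false), (.d, false)]),
        (.sat true, (.f, false) :: (.w, false) ::
          (names r ++ List.ofFn fun _ : Fin r => (.d, false)))],
      (.goal, [(.w, false)])⟩

/-! ### The meaning of the predicates -/

variable {r : ℕ}

/-- `j` is the first register whose name, written at `xs j`, is `n`. -/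
def IsFirst (xs : Fin r → List Symb) (j : Fin r) (n : ℕ) : Prop :=
  val (xs j) = n ∧ ∀ i < j, val (xs i) ≠ n

/-- The register valuation `ν` is represented by the names at `xs` and the values at `ρ`.  A name
may be listed several times: the first occurrence is decisive. -/
def Agree (ν : ℕ → ℤ) (xs ρ : Fin r → List Symb) : Prop :=
  ∀ n j, IsFirst xs j n → (val (ρ j) : ℤ) = ν n

theorem Agree.update {ν : ℕ → ℤ} {xs ρ : Fin r → List Symb} (h : Agree ν xs ρ) {j : Fin r} {n : ℕ}
    (hj : IsFirst xs j n) (d : List Symb) :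
    Agree (update ν n (val d)) xs (fun i => if i = j then d else ρ i) := by
  intro m i hi
  rcases eq_or_ne i j with rfl | hij
  · obtain rfl : n = m := hj.1.symm.trans hi.1
    simp
  · have : m ≠ n := by
      rintro rfl
      rcases lt_or_gt_of_ne hij with h' | h'
      · exact hj.2 i h' hi.1
      · exact hi.2 j h' hj.1
    simp [hij, this, h m i hi]

theorem IsFirst.exists {xs : Fin r → List Symb} {n : ℕ} (h : ∃ j, val (xs j) = n) :
    ∃ j, IsFirst xs j n := by
  have hs : (Finset.univ.filter fun j => val (xs j) = n).Nonempty := by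
    obtain ⟨j, hj⟩ := h
    exact ⟨j, by simpa using hj⟩
  have h1 := Finset.min'_mem _ hs
  refine ⟨_, by simpa using h1, fun i hi h => ?_⟩
  exact absurd (Finset.min'_le (Finset.univ.filter fun j => val (xs j) = n) i (by simpa using h))
    (not_le.2 hi)

/-- The meaning of the facts.  A fact about a word, a letter or a formula that is not written at the
place in question may be derivable, too; for such a fact nothing is claimed. -/
def Sem (r : ℕ) : Pred → List (List Symb) → Prop
  | .num pos, [x, y] => ∃ n, (pos = true → n ≠ 0) ∧ x = encNat n ++ y
  | .int, [x, y] => ∃ c, x = encInt c ++ y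
  | .tail, [x, y] => y = x.tail
  | .cmp carry o, [x, y, z] => compare (val x + val y + carry.toNat) (val z) = o
  | .eq b, [x, y] => b = true ↔ val x = val y
  | .mem b, [w, x] => ∀ a t, w = encLetter a ++ t → (b = true ↔ val x ∈ a.1)
  | .dat, [w, d] => ∀ a t, w = encLetter a ++ t → val d = a.2
  | .next, [w, w'] => ∃ a, w = encLetter a ++ w'
  | .word, [w, f] => ∃ u : WrittenWord, w = u.flatMap encLetter ++ Symb.sep :: f
  | .form, f :: g :: as => ∀ xs : Fin r → List Symb, as = List.ofFn xs →
      ∃ φ : Formula, f = φ.enc ++ g ∧ ∀ x ∈ φ.vars, ∃ j, val (xs j) = x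
  | .sat b, f :: w :: as => ∀ xs ρ : Fin r → List Symb, as = List.ofFn xs ++ List.ofFn ρ →
      ∀ (φ : Formula) (g : List Symb) (a : List ℕ × ℕ) (u : WrittenWord) (t : List Symb)
        (ν : ℕ → ℤ), f = φ.enc ++ g → w = encLetter a ++ (u.flatMap encLetter ++ Symb.sep :: t) →
        Agree ν xs ρ → (b = true ↔ φ.Holds a u ν)
  | .unt b, f :: g :: w :: as =>
      ∀ xs ρ : Fin r → List Symb, as = List.ofFn xs ++ List.ofFn ρ →
      ∀ (φ ψ : Formula) (t₁ t₂ : List Symb) (u : WrittenWord) (t : List Symb)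
        (ν : ℕ → ℤ), f = φ.enc ++ t₁ → g = ψ.enc ++ t₂ →
        w = u.flatMap encLetter ++ Symb.sep :: t → Agree ν xs ρ →
        (b = true ↔ UntilHolds (fun a u => φ.Holds a u ν) (fun a u => ψ.Holds a u ν) u)
  | .goal, [s] => s ∈ pathChecking r
  | _, _ => False

theorem ofFn_append_inj {xs ρ xs' ρ' : Fin r → List Symb} :
    List.ofFn xs ++ List.ofFn ρ = List.ofFn xs' ++ List.ofFn ρ' ↔ xs = xs' ∧ ρ = ρ' := by
  constructor
  · intro h
    obtain ⟨h1, h2⟩ := List.append_inj h (by simp)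
    exact ⟨List.ofFn_injective h1, List.ofFn_injective h2⟩
  · rintro ⟨rfl, rfl⟩; rfl

@[simp]
theorem termVal_false (v : Var r → List Symb) (t : Var r) : termVal v (t, false) = v t := rfl

@[simp]
theorem termVal_true (v : Var r → List Symb) (t : Var r) : termVal v (t, true) = (v t).tail := rfl

@[simp]
theorem map_ofFn_var (v : Var r → List Symb) (e : Fin r → Var r) :
    (List.ofFn fun j => (e j, false)).map (termVal v) = List.ofFn fun j => v (e j) := by
  simp [List.map_ofFn, Function.comp_def]

@[simp]
theorem map_names (v : Var r → List Symb) :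
    (names r).map (termVal v) = List.ofFn fun j => v (.nm j) :=
  map_ofFn_var v _

@[simp]
theorem map_values (v : Var r → List Symb) :
    (values r).map (termVal v) = List.ofFn fun j => v (.rg j) :=
  map_ofFn_var v _

@[simp]
theorem is_some_self (a : Symb) : is a (some a) = true := by simp [is]

@[simp]
theorem is_eq_true {a : Symb} {x : List Symb} : is a x.head? = true ↔ ∃ t, x = a :: t := by
  cases x <;> simp [is]

theorem forall_mem_lookup {P : Pred → List (List Symb) → Prop} {v : Var r → List Symb}
    {t : Var r × Bool} {j : Fin r}
    (h : ∀ b x y, P (.eq b) [x, y] ↔ (b = true ↔ val x = val y)) :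
    (∀ a ∈ lookup t j, P a.1 (a.2.map (termVal v))) ↔
      IsFirst (fun j => v (.nm j)) j (val (termVal v t)) := by
  simp [lookup, IsFirst, h, eq_comm (a := val (termVal v t))]

/-! ### Soundness of the rules -/

theorem encLetter_nil (d : ℕ) : encLetter ([], d) = Symb.data :: encNat d := rfl

theorem encLetter_cons (p d : ℕ) (l : List ℕ) :
    encLetter (p :: l, d) = Symb.prop :: (encNat p ++ encLetter (l, d)) := by
  simp [encLetter]

theorem encLetter_append_of_data {a : List ℕ × ℕ} {s t : List Symb}
    (h : Symb.data :: s = encLetter a ++ t) : a.1 = [] ∧ s = encNat a.2 ++ t := by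
  obtain ⟨_ | ⟨p, l⟩, d⟩ := a
  · simpa [encLetter_nil] using h
  · simp [encLetter_cons] at h

theorem encLetter_append_of_prop {a : List ℕ × ℕ} {s t : List Symb}
    (h : Symb.prop :: s = encLetter a ++ t) :
    ∃ p l d, a = (p :: l, d) ∧ s = encNat p ++ (encLetter (l, d) ++ t) := by
  obtain ⟨_ | ⟨p, l⟩, d⟩ := a
  · simp [encLetter_nil] at h
  · exact ⟨p, l, d, rfl, by simpa [encLetter_cons] using h⟩

theorem encLetter_append_ne_sep (a : List ℕ × ℕ) (s t : List Symb) :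
    encLetter a ++ s ≠ Symb.sep :: t := by
  obtain ⟨_ | ⟨p, l⟩, d⟩ := a <;> simp [encLetter_nil, encLetter_cons]

/-- The comparison by which a constraint is decided. -/
theorem truth_constr (R : Rel) (m n : ℕ) (c : ℤ) :
    R.truth (if c < 0 then compare (m + c.natAbs) n else (compare (n + c.natAbs) m).swap) = true ↔
      R.Holds ((m : ℤ) - n) c := by
  split
  · rw [Rel.truth_compare]
    cases R <;> simp only [Rel.Holds] <;> omega
  · rw [Nat.compare_swap, Rel.truth_compare]
    cases R <;> simp only [Rel.Holds] <;> omega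

/-- One step of the addition and comparison of numbers in binary. -/
theorem compare_step (x y z : List Symb) (carry carry' : Bool)
    (h : carry'.toNat =
      (digitVal (digit x.head?) + digitVal (digit y.head?) + carry.toNat) / 2) :
    compare (val x + val y + carry.toNat) (val z) =
      (compare (val (if (digit x.head?).isSome then x.tail else x) +
          val (if (digit y.head?).isSome then y.tail else y) + carry'.toNat)
        (val (if (digit z.head?).isSome then z.tail else z))).then
      (compare ((digitVal (digit x.head?) + digitVal (digit y.head?) + carry.toNat) % 2)
        (digitVal (digit z.head?))) := by
  rw [← compare_digit (by omega) (digitVal_le _), ← val_eq_digit z, h]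
  congr 1
  rw [val_eq_digit x, val_eq_digit y]
  omega

/-- Every rule preserves the meaning of the facts. -/
theorem sem_head (i : RuleName r) (v : Var r → List Symb)
    (hg : ∀ g ∈ (rule r i).guard, g.2 (v g.1).head? = true)
    (hb : ∀ a ∈ (rule r i).body, Sem r a.1 (a.2.map (termVal v))) :
    Sem r (rule r i).head.1 ((rule r i).head.2.map (termVal v)) := by
  have lk := fun t j => forall_mem_lookup (P := Sem r) (v := v) (t := t) (j := j)
    fun _ _ _ => Iff.rfl
  cases i <;> simp only [rule, List.forall_mem_cons, List.forall_mem_append, List.not_mem_nil,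
    IsEmpty.forall_iff, implies_true, and_true,
    List.map_cons, List.map_nil, List.map_append,
    termVal_false, termVal_true, map_names, map_values,
    map_ofFn_var, is_eq_true, lk] at hg hb ⊢
  all_goals clear lk
  all_goals (try simp only [Sem] at hb ⊢)
  case numEnd =>
    obtain ⟨t, ht⟩ := hg
    exact ⟨0, by simp, by simp [ht, encNat_zero]⟩
  case numOdd =>
    obtain ⟨t, ht⟩ := hg
    obtain ⟨n, -, hn⟩ := hb
    exact ⟨2 * n + 1, by simp, by simp_all [encNat_odd]⟩
  case numEven =>
    obtain ⟨t, ht⟩ := hg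
    obtain ⟨n, hn', hn⟩ := hb
    have := hn' trivial
    exact ⟨2 * n, by simpa, by simp_all [encNat_even]⟩
  case numWeaken =>
    obtain ⟨n, -, hn⟩ := hb
    exact ⟨n, by simp, hn⟩
  case int neg =>
    obtain ⟨t, ht⟩ := hg
    obtain ⟨n, hn', hn⟩ := hb
    cases neg
    · exact ⟨n, by simp_all [encInt]⟩
    · have := hn' rfl
      have h0 : (-(n : ℤ)) < 0 := by omega
      exact ⟨-n, by simp_all [encInt]⟩
  case cmpNil carry =>
    simp only [decide_eq_true_eq] at hg
    rw [val_eq_zero hg.1, val_eq_zero hg.2.1, val_eq_zero hg.2.2, zero_add, zero_add]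
  case cmpCons a b c carry carry' o =>
    simp only [decide_eq_true_eq] at hg
    obtain ⟨rfl, rfl, rfl, h⟩ := hg
    rw [compare_step _ _ _ _ _ h, ← hb]
    rfl
  case eq o =>
    simp only [decide_eq_true_eq] at hg
    rw [val_eq_zero hg] at hb
    simp [← hb]
  case memNil =>
    obtain ⟨t, ht⟩ := hg
    intro a s h
    simp [(encLetter_append_of_data (ht ▸ h)).1]
  case memHead =>
    obtain ⟨t, ht⟩ := hg
    intro a s h
    rw [ht] at h hb
    obtain ⟨p, l, d, rfl, rfl⟩ := encLetter_append_of_prop h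
    simp at hb
    simp [← hb]
  case memTail b =>
    obtain ⟨t, ht⟩ := hg
    obtain ⟨h1, ⟨n, -, h2⟩, h3⟩ := hb
    intro a s h
    rw [ht] at h h1 h2
    obtain ⟨p, l, d, rfl, rfl⟩ := encLetter_append_of_prop h
    obtain ⟨-, h4⟩ := encNat_append_inj h2
    rw [h3 (l, d) s h4.symm]
    simp at h1
    simp [Ne.symm h1]
  case datHead =>
    obtain ⟨t, ht⟩ := hg
    intro a s h
    rw [ht] at h ⊢
    simp [(encLetter_append_of_data h).2]
  case datTail =>
    obtain ⟨t, ht⟩ := hg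
    obtain ⟨⟨n, -, h2⟩, h3⟩ := hb
    intro a s h
    rw [ht] at h h2
    obtain ⟨p, l, d, rfl, rfl⟩ := encLetter_append_of_prop h
    obtain ⟨-, h4⟩ := encNat_append_inj h2
    exact h3 (l, d) s h4.symm
  case nextLast =>
    obtain ⟨t, ht⟩ := hg
    obtain ⟨n, -, h2⟩ := hb
    exact ⟨([], n), by simp_all [encLetter_nil]⟩
  case nextTail =>
    obtain ⟨t, ht⟩ := hg
    obtain ⟨⟨n, -, h2⟩, ⟨l, d⟩, h3⟩ := hb
    exact ⟨(n :: l, d), by simp_all [encLetter_cons]⟩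
  case wordNil =>
    obtain ⟨t, ht⟩ := hg
    exact ⟨[], by simp [ht]⟩
  case wordCons =>
    obtain ⟨⟨a, h1⟩, u, h2⟩ := hb
    exact ⟨a :: u, by simp [h1, h2]⟩
  case formTt =>
    obtain ⟨t, ht⟩ := hg
    intro xs _
    exact ⟨.tt, by simp [ht, Formula.enc], by simp [Formula.vars]⟩
  case formProp =>
    obtain ⟨t, ht⟩ := hg
    obtain ⟨n, -, hn⟩ := hb
    intro xs _
    exact ⟨.prop n, by simp_all [Formula.enc], by simp [Formula.vars]⟩
  case formConstr j =>
    obtain ⟨⟨t, ht⟩, hR⟩ := hg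
    obtain ⟨⟨n, -, hn⟩, ⟨c, hc⟩, hj⟩ := hb
    obtain ⟨R, hR⟩ := of_decide_eq_true hR
    obtain ⟨y, hy⟩ : ∃ y, v .y = Symb.rel R :: y := by
      cases h : v .y <;> simp_all
    intro xs hxs
    obtain rfl := List.ofFn_injective hxs
    rw [ht, List.tail_cons] at hn hj
    rw [hy, List.tail_cons] at hc
    refine ⟨.constr n R c, by simp [ht, Formula.enc, hn, hy, hc], ?_⟩
    rw [hn, val_encNat] at hj
    intro x hx
    rw [Formula.vars, Finset.mem_singleton] at hx
    exact ⟨j, by rw [hx]; exact (hj.1 trivial).symm⟩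
  case formNeg =>
    obtain ⟨t, ht⟩ := hg
    intro xs hxs
    obtain ⟨φ, h1, h2⟩ := hb xs hxs
    exact ⟨.neg φ, by simp_all [Formula.enc], h2⟩
  case formConj =>
    obtain ⟨t, ht⟩ := hg
    intro xs hxs
    obtain ⟨φ, h1, h2⟩ := hb.1 xs hxs
    obtain ⟨ψ, h3, h4⟩ := hb.2 xs hxs
    refine ⟨.conj φ ψ, by simp_all [Formula.enc], fun x hx => ?_⟩
    rw [Formula.vars, Finset.mem_union] at hx
    exact hx.elim (h2 x) (h4 x)
  case formUntl =>
    obtain ⟨t, ht⟩ := hg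
    intro xs hxs
    obtain ⟨φ, h1, h2⟩ := hb.1 xs hxs
    obtain ⟨ψ, h3, h4⟩ := hb.2 xs hxs
    refine ⟨.untl φ ψ, by simp_all [Formula.enc], fun x hx => ?_⟩
    rw [Formula.vars, Finset.mem_union] at hx
    exact hx.elim (h2 x) (h4 x)
  case formFreeze j =>
    obtain ⟨t, ht⟩ := hg
    obtain ⟨⟨n, -, hn⟩, hφ, hj⟩ := hb
    intro xs hxs
    obtain ⟨φ, h1, h2⟩ := hφ xs hxs
    obtain rfl := List.ofFn_injective hxs
    rw [ht, List.tail_cons] at hn hj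
    refine ⟨.freeze n φ, by simp [ht, Formula.enc, hn, h1], ?_⟩
    rw [hn, val_encNat] at hj
    intro x hx
    rw [Formula.vars, Finset.mem_union, Finset.mem_singleton] at hx
    rcases hx with rfl | hx
    · exact ⟨j, (hj.1 trivial).symm⟩
    · exact h2 x hx
  case satTt =>
    obtain ⟨t, ht⟩ := hg
    intro xs ρ _ φ g a u h ν hf _ _
    rw [ht] at hf
    cases φ <;> simp [Formula.enc] at hf
    simp [Formula.Holds]
  case satProp b =>
    obtain ⟨t, ht⟩ := hg
    intro xs ρ _ φ g a u h ν hf hw _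
    rw [ht] at hf hb
    cases φ <;> simp [Formula.enc] at hf
    rw [hb _ _ hw, List.tail_cons, hf, val_encNat, Formula.Holds]
  case satNeg b =>
    obtain ⟨t, ht⟩ := hg
    intro xs ρ hr φ g a u h ν hf hw hν
    rw [ht] at hf hb
    cases φ <;> simp [Formula.enc] at hf
    rw [Formula.Holds, ← hb xs ρ hr _ g a u h ν hf hw hν]
    cases b <;> simp
  case satConj b₁ b₂ =>
    obtain ⟨t, ht⟩ := hg
    obtain ⟨h1, h2, h3⟩ := hb
    intro xs ρ hr φ g a u h ν hf hw hν
    rw [ht] at hf h1 h2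
    rw [List.tail_cons] at h1 h2
    cases φ <;> simp [Formula.enc] at hf
    obtain ⟨φ', h4, -⟩ := h1 _ rfl
    obtain ⟨rfl, h5⟩ := Formula.enc_append_inj _ (h4.symm.trans hf)
    rw [Formula.Holds, ← h2 xs ρ hr _ _ a u h ν hf hw hν, ← h3 xs ρ hr _ g a u h ν h5 hw hν,
      Bool.and_eq_true]
  case satConstr R neg o j =>
    obtain ⟨⟨t, ht⟩, ⟨t', ht'⟩, ⟨t'', ht''⟩⟩ := hg
    obtain ⟨⟨⟨n, -, hn⟩, h1, h2, h3⟩, h4⟩ := hb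
    intro xs ρ hr φ g a u h ν hf hw hν
    obtain ⟨rfl, rfl⟩ := ofFn_append_inj.1 hr
    rw [ht] at hf hn h4
    rw [List.tail_cons] at hn h4
    rw [ht'] at hn h1
    rw [List.tail_cons] at h1
    rw [hn, val_encNat] at h4
    cases φ <;> simp [Formula.enc] at hf
    rename_i x R' c
    rw [hf] at hn
    obtain ⟨rfl, h5⟩ := encNat_append_inj hn
    simp only [List.cons.injEq, Symb.rel.injEq] at h5
    obtain ⟨rfl, rfl⟩ := h5
    rw [h1, encInt] at ht''
    simp only [List.cons_append, List.cons.injEq, Symb.sign.injEq] at ht''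
    have hz : val (v .z).tail = c.natAbs := by rw [h1, encInt]; simp
    have hd := h2 _ _ hw
    rw [Formula.Holds, ← hν _ j h4, ← hd, ← truth_constr]
    obtain ⟨rfl, -⟩ := ht''
    simp only [decide_eq_true_eq] at h3 ⊢
    by_cases hc : c < 0
    · simp only [if_pos hc, List.map_cons, List.map_nil, termVal_false, termVal_true, hz,
        Bool.toNat_false, add_zero] at h3 ⊢
      rw [← h3]
    · simp only [if_neg hc, List.map_cons, List.map_nil, termVal_false, termVal_true, hz,
        Bool.toNat_false, add_zero] at h3 ⊢
      rw [← h3]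
  case satUntl b =>
    obtain ⟨t, ht⟩ := hg
    obtain ⟨h1, ⟨a', h2⟩, h3⟩ := hb
    intro xs ρ hr φ g a u h ν hf hw hν
    rw [ht] at hf h1 h3
    rw [List.tail_cons] at h1 h3
    cases φ <;> simp [Formula.enc] at hf
    obtain ⟨φ', h4, -⟩ := h1 _ rfl
    obtain ⟨rfl, h5⟩ := Formula.enc_append_inj _ (h4.symm.trans hf)
    obtain ⟨rfl, h6⟩ := encLetter_append_inj (h2.symm.trans hw)
    exact h3 xs ρ hr _ _ _ _ u h ν hf h5 h6 hν
  case satFreeze b j =>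
    obtain ⟨t, ht⟩ := hg
    obtain ⟨⟨⟨n, -, hn⟩, h1, h2⟩, h3⟩ := hb
    intro xs ρ hr φ g a u h ν hf hw hν
    obtain ⟨rfl, rfl⟩ := ofFn_append_inj.1 hr
    rw [ht] at hf hn h3
    rw [List.tail_cons] at hn h3
    cases φ <;> simp [Formula.enc] at hf
    rw [hf] at hn h3
    obtain ⟨rfl, h5⟩ := encNat_append_inj hn
    rw [val_encNat] at h3
    have hd := h1 _ _ hw
    rw [Formula.Holds, ← hd]
    refine h2 _ _ rfl _ g a u h _ h5.symm hw ?_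
    convert hν.update h3 (v .d) using 2
    split <;> rfl
  case untNil =>
    obtain ⟨t, ht⟩ := hg
    intro xs ρ _ φ ψ t₁ t₂ u h ν _ _ hw _
    cases u with
    | nil => simp [UntilHolds]
    | cons a u =>
      rw [ht] at hw
      exact absurd (by simpa using hw.symm) (encLetter_append_ne_sep a _ _)
  case untCons b₁ b₂ b₃ =>
    obtain ⟨h1, h2, ⟨a', h3⟩, h4⟩ := hb
    intro xs ρ hr φ ψ t₁ t₂ u h ν hf hg' hw hν
    cases u with
    | nil => simp [hw, is] at hg
    | cons a u =>
      rw [List.flatMap_cons, List.append_assoc] at hw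
      obtain ⟨rfl, h6⟩ := encLetter_append_inj (h3.symm.trans hw)
      rw [UntilHolds, ← h1 xs ρ hr φ _ _ u h ν hf hw hν, ← h2 xs ρ hr ψ _ _ u h ν hg' hw hν,
        ← h4 xs ρ hr φ ψ _ _ u h ν hf hg' h6 hν, Bool.or_eq_true, Bool.and_eq_true]
  case goal =>
    obtain ⟨hw, hg⟩ := hg
    obtain ⟨⟨u, h1⟩, h2, h3, h4⟩ := hb
    obtain ⟨φ, h5, h6⟩ := h2 _ rfl
    have hg : v .g = [] := by simpa using of_decide_eq_true hg
    rw [hg, List.append_nil] at h5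
    refine ⟨u, φ, by rw [encInstance, h1, h5], ?_, ?_⟩
    · refine (Finset.card_le_card (t := Finset.univ.image fun j : Fin r => val (v (.nm j)))
        fun x hx => ?_).trans (Finset.card_image_le.trans (by simp))
      simpa using h6 x hx
    · rw [models_iff_holds]
      cases u with
      | nil => simp [h1, is] at hw
      | cons a u =>
        rw [List.flatMap_cons, List.append_assoc] at h1
        refine ⟨a, u, rfl, (h4 _ _ rfl φ [] a u _ _ (by simpa using h5) h1 ?_).1 trivial⟩
        intro n j _
        simp [h3 _ _ h1]

/-- All derivable facts are true. -/
theorem sem_of_der {s : List Symb} {q : Pred} {as : List (List Symb)} (h : Der (rule r) s q as) :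
    Sem r q as := by
  induction h with
  | mk i v _ hg _ ih => exact sem_head i v hg ih

/-! ### Completeness of the rules -/

variable {s : List Symb}

/-- Values for the variables of the rules. -/
structure Asg (r : ℕ) where
  /-- the value of `Var.f` -/
  f : List Symb := []
  /-- the value of `Var.g` -/
  g : List Symb := []
  /-- the value of `Var.w` -/
  w : List Symb := []
  /-- the value of `Var.w'` -/
  w' : List Symb := []
  /-- the value of `Var.d` -/
  d : List Symb := []
  /-- the value of `Var.x` -/
  x : List Symb := []
  /-- the value of `Var.y` -/
  y : List Symb := []
  /-- the value of `Var.z` -/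
  z : List Symb := []
  /-- the values of `Var.nm j` -/
  nm : Fin r → List Symb := fun _ => []
  /-- the values of `Var.rg j` -/
  rg : Fin r → List Symb := fun _ => []

/-- The values as a function of the variable. -/
def Asg.toFun (v : Asg r) : Var r → List Symb
  | .f => v.f
  | .g => v.g
  | .w => v.w
  | .w' => v.w'
  | .d => v.d
  | .x => v.x
  | .y => v.y
  | .z => v.z
  | .nm j => v.nm j
  | .rg j => v.rg j

/-- Derives a fact by the rule `i` under the assignment `v`. -/
theorem Asg.der (i : RuleName r) (v : Asg r) {q : Pred} {as : List (List Symb)}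
    (hq : (rule r i).head.1 = q) (has : (rule r i).head.2.map (termVal v.toFun) = as)
    (hg : ∀ g ∈ (rule r i).guard, g.2 (v.toFun g.1).head? = true)
    (hb : ∀ a ∈ (rule r i).body, Der (rule r) s a.1 (a.2.map (termVal v.toFun)))
    (h1 : v.f <:+ s := by first | exact List.nil_suffix | assumption)
    (h2 : v.g <:+ s := by first | exact List.nil_suffix | assumption)
    (h3 : v.w <:+ s := by first | exact List.nil_suffix | assumption)
    (h4 : v.w' <:+ s := by first | exact List.nil_suffix | assumption)
    (h5 : v.d <:+ s := by first | exact List.nil_suffix | assumption)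
    (h6 : v.x <:+ s := by first | exact List.nil_suffix | assumption)
    (h7 : v.y <:+ s := by first | exact List.nil_suffix | assumption)
    (h8 : v.z <:+ s := by first | exact List.nil_suffix | assumption)
    (h9 : ∀ j, v.nm j <:+ s := by first | exact fun _ => List.nil_suffix | assumption)
    (h10 : ∀ j, v.rg j <:+ s := by first | exact fun _ => List.nil_suffix | assumption) :
    Der (rule r) s q as := by
  subst hq has
  refine .mk i v.toFun (fun t => ?_) hg hb
  cases t with
  | nm j => exact h9 j
  | rg j => exact h10 j
  | _ => assumption

theorem suffix_of_append {x y : List Symb} (h : x ++ y <:+ s) : y <:+ s :=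
  (List.suffix_append x y).trans h

theorem suffix_of_cons {a : Symb} {y : List Symb} (h : a :: y <:+ s) : y <:+ s :=
  (List.suffix_cons a y).trans h

theorem der_num_and (n : ℕ) {y : List Symb} (h : encNat n ++ y <:+ s) :
    (n ≠ 0 → Der (rule r) s (.num true) [encNat n ++ y, y]) ∧
      Der (rule r) s (.num false) [encNat n ++ y, y] := by
  have weaken : ∀ x, x <:+ s → Der (rule r) s (.num true) [x, y] →
      Der (rule r) s (.num false) [x, y] := fun x hx hd =>
    Asg.der .numWeaken { x := x, y := y } rfl rfl (by simp [rule])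
      (by simpa [rule, Asg.toFun] using hd)
      (h7 := suffix_of_append h)
  have hy : y <:+ s := suffix_of_append h
  induction n using bits_induction with
  | h0 =>
    exact ⟨fun h0 => absurd rfl h0, Asg.der .numEnd { x := encNat 0 ++ y } rfl rfl
      (by simp [rule, encNat_zero, Asg.toFun]) (by simp [rule])⟩
  | h1 m ih =>
    have := (ih (suffix_of_cons (by simpa [encNat_odd] using h))).2
    have h1 : Der (rule r) s (.num true) [encNat (2 * m + 1) ++ y, y] :=
      Asg.der .numOdd { x := encNat (2 * m + 1) ++ y, y := y } rfl rfl
        (by simp [rule, encNat_odd, Asg.toFun])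
        (by simpa [rule, encNat_odd, Asg.toFun] using this)
    exact ⟨fun _ => h1, weaken _ h h1⟩
  | h2 m hm ih =>
    have := (ih (suffix_of_cons (by simpa [encNat_even hm] using h))).1 hm
    have h1 : Der (rule r) s (.num true) [encNat (2 * m) ++ y, y] :=
      Asg.der .numEven { x := encNat (2 * m) ++ y, y := y } rfl rfl
        (by simp [rule, encNat_even hm, Asg.toFun])
        (by simpa [rule, encNat_even hm, Asg.toFun] using this)
    exact ⟨fun _ => h1, weaken _ h h1⟩

theorem der_num (n : ℕ) {y : List Symb} (h : encNat n ++ y <:+ s) :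
    Der (rule r) s (.num false) [encNat n ++ y, y] :=
  (der_num_and n h).2

theorem der_int (c : ℤ) {y : List Symb} (h : encInt c ++ y <:+ s) :
    Der (rule r) s .int [encInt c ++ y, y] := by
  have hy : y <:+ s := suffix_of_append h
  have h1 := der_num_and (r := r) c.natAbs (y := y) (suffix_of_cons h)
  refine Asg.der (.int (decide (c < 0))) { x := encInt c ++ y, y := y } rfl rfl
    (by simp [rule, encInt, Asg.toFun]) ?_
  simp only [rule, encInt, List.forall_mem_singleton, List.map_cons, List.map_nil, termVal_true,
    termVal_false, Asg.toFun, List.cons_append, List.tail_cons]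
  by_cases hc : c < 0
  · simpa [hc] using h1.1 (by omega)
  · simpa [hc] using h1.2

theorem suffix_ite_tail {x : List Symb} (h : x <:+ s) (p : Prop) [Decidable p] :
    (if p then x.tail else x) <:+ s := by
  split
  · exact (List.tail_suffix x).trans h
  · exact h

theorem length_ite_tail (x : List Symb) :
    (if (digit x.head?).isSome then x.tail else x).length + (digit x.head?).isSome.toNat =
      x.length := by
  cases x with
  | nil => simp [digit]
  | cons a x => cases a <;> simp [digit]

theorem der_cmp {x y z : List Symb} (carry : Bool) (hx : x <:+ s) (hy : y <:+ s) (hz : z <:+ s) :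
    Der (rule r) s (.cmp carry (compare (val x + val y + carry.toNat) (val z))) [x, y, z] := by
  induction hn : x.length + y.length + z.length using Nat.strong_induction_on
    generalizing x y z carry with
  | _ n ih =>
    by_cases h : digit x.head? = none ∧ digit y.head? = none ∧ digit z.head? = none
    · refine Asg.der (.cmpNil carry) { x := x, y := y, z := z } ?_ rfl
        (by simpa [rule, Asg.toFun] using h) (by simp [rule])
      simp [rule, val_eq_zero h.1, val_eq_zero h.2.1, val_eq_zero h.2.2]
    · obtain ⟨carry', hc⟩ : ∃ carry' : Bool, carry'.toNat =
          (digitVal (digit x.head?) + digitVal (digit y.head?) + carry.toNat) / 2 := by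
        have h1 := digitVal_le (digit x.head?)
        have h2 := digitVal_le (digit y.head?)
        have h3 := Bool.toNat_le carry
        rcases Nat.lt_or_ge
          (digitVal (digit x.head?) + digitVal (digit y.head?) + carry.toNat) 2 with h4 | h4
        · exact ⟨false, by simp; omega⟩
        · exact ⟨true, by simp; omega⟩
      rw [compare_step x y z carry carry' hc]
      refine Asg.der (.cmpCons (digit x.head?) (digit y.head?) (digit z.head?) carry carry'
        (compare (val (if (digit x.head?).isSome then x.tail else x) +
          val (if (digit y.head?).isSome then y.tail else y) + carry'.toNat)
        (val (if (digit z.head?).isSome then z.tail else z)))) { x := x, y := y, z := z } rfl rfl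
        (by simpa [rule, Asg.toFun] using hc) ?_
      rw [rule, List.forall_mem_singleton]
      refine ih _ ?_ carry' (suffix_ite_tail hx _) (suffix_ite_tail hy _)
        (suffix_ite_tail hz _) rfl
      have h1 := length_ite_tail x
      have h2 := length_ite_tail y
      have h3 := length_ite_tail z
      have h4 : 0 < (digit x.head?).isSome.toNat + (digit y.head?).isSome.toNat +
          (digit z.head?).isSome.toNat := by
        revert h
        cases digit x.head? <;> cases digit y.head? <;> cases digit z.head? <;> simp
      omega

theorem der_eq {b : Bool} {x y : List Symb} (h : b = true ↔ val x = val y) (hx : x <:+ s)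
    (hy : y <:+ s) : Der (rule r) s (.eq b) [x, y] := by
  have h1 := der_cmp (r := r) (y := []) false hx List.nil_suffix hy
  refine Asg.der (.eq (compare (val x + val [] + false.toNat) (val y))) { x := x, y := y } ?_ rfl
    (by simp [rule, digit, Asg.toFun]) (by simpa [rule, Asg.toFun] using h1)
  have : (compare (val x) (val y)).isEq = b := by
    rw [Bool.eq_iff_iff, h]
    simp
  simpa [rule, val] using this

theorem der_lookup {v : Var r → List Symb} {t : Var r × Bool} {j : Fin r}
    (ht : termVal v t <:+ s) (hv : ∀ i, v (.nm i) <:+ s)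
    (h : IsFirst (fun i => v (.nm i)) j (val (termVal v t))) :
    ∀ a ∈ lookup t j, Der (rule r) s a.1 (a.2.map (termVal v)) := by
  simp only [lookup, List.forall_mem_cons, List.forall_mem_map, List.mem_filter,
    List.mem_finRange, decide_eq_true_eq, true_and, List.map_cons, List.map_nil, termVal_false]
  exact ⟨der_eq (by simp [h.1]) ht (hv j),
    fun i hi => der_eq (by simp [(h.2 i hi).symm]) ht (hv i)⟩

theorem der_mem {a : List ℕ × ℕ} {t x : List Symb} {b : Bool} (h : b = true ↔ val x ∈ a.1)
    (hw : encLetter a ++ t <:+ s) (hx : x <:+ s) :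
    Der (rule r) s (.mem b) [encLetter a ++ t, x] := by
  obtain ⟨l, d⟩ := a
  induction l with
  | nil =>
    obtain rfl : b = false := by simpa using h
    exact Asg.der .memNil { w := encLetter ([], d) ++ t, x := x } rfl rfl
      (by simp [rule, encLetter_nil, Asg.toFun]) (by simp [rule])
  | cons p l ih =>
    have hw1 : encNat p ++ (encLetter (l, d) ++ t) <:+ s :=
      suffix_of_cons (by simpa [encLetter_cons] using hw)
    have hw2 := suffix_of_append hw1
    by_cases hp : val x = p
    · obtain rfl : b = true := by simpa [hp] using h
      have h1 : Der (rule r) s (.eq true) [encNat p ++ (encLetter (l, d) ++ t), x] :=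
        der_eq (by simp [hp]) hw1 hx
      exact Asg.der .memHead { w := encLetter (p :: l, d) ++ t, x := x } rfl rfl
        (by simp [rule, encLetter_cons, Asg.toFun])
        (by simpa [rule, Asg.toFun, encLetter_cons] using h1)
    · have h1 : Der (rule r) s (.eq false) [encNat p ++ (encLetter (l, d) ++ t), x] :=
        der_eq (by simp [Ne.symm hp]) hw1 hx
      have h2 := der_num (r := r) p hw1
      have h3 := ih (by simpa [hp] using h) hw2
      exact Asg.der (.memTail b)
        { w := encLetter (p :: l, d) ++ t, w' := encLetter (l, d) ++ t, x := x } rfl rfl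
        (by simp [rule, encLetter_cons, Asg.toFun])
        (by
          simp only [rule, List.forall_mem_cons, List.not_mem_nil, IsEmpty.forall_iff,
            implies_true, and_true, List.map_cons, List.map_nil, termVal_true, termVal_false,
            Asg.toFun, encLetter_cons, List.cons_append, List.tail_cons, List.append_assoc]
          exact ⟨h1, h2, h3⟩)

theorem der_dat (a : List ℕ × ℕ) (t : List Symb) (hw : encLetter a ++ t <:+ s) :
    Der (rule r) s .dat [encLetter a ++ t, encNat a.2 ++ t] := by
  obtain ⟨l, d⟩ := a
  induction l with
  | nil =>
    exact Asg.der .datHead { w := encLetter ([], d) ++ t } rfl rfl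
      (by simp [rule, encLetter_nil, Asg.toFun]) (by simp [rule])
  | cons p l ih =>
    have hw1 : encNat p ++ (encLetter (l, d) ++ t) <:+ s :=
      suffix_of_cons (by simpa [encLetter_cons] using hw)
    have hw2 := suffix_of_append hw1
    have h2 := der_num (r := r) p hw1
    have h3 := ih hw2
    exact Asg.der .datTail
      { w := encLetter (p :: l, d) ++ t, w' := encLetter (l, d) ++ t, d := encNat d ++ t } rfl rfl
      (by simp [rule, encLetter_cons, Asg.toFun])
      (by
        simp only [rule, List.forall_mem_cons, List.not_mem_nil, IsEmpty.forall_iff,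
          implies_true, and_true, List.map_cons, List.map_nil, termVal_true, termVal_false,
          Asg.toFun, encLetter_cons, List.cons_append, List.tail_cons, List.append_assoc]
        exact ⟨h2, h3⟩)
      (h5 := h3.suffix _ (by simp))

theorem der_next (a : List ℕ × ℕ) (t : List Symb) (hw : encLetter a ++ t <:+ s) :
    Der (rule r) s .next [encLetter a ++ t, t] := by
  have ht : t <:+ s := suffix_of_append hw
  obtain ⟨l, d⟩ := a
  induction l with
  | nil =>
    have h2 := der_num (r := r) d (y := t) (suffix_of_cons hw)
    exact Asg.der .nextLast { w := encLetter ([], d) ++ t, w' := t } rfl rfl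
      (by simp [rule, encLetter_nil, Asg.toFun])
      (by simpa [rule, encLetter_nil, Asg.toFun] using h2)
  | cons p l ih =>
    have hw1 : encNat p ++ (encLetter (l, d) ++ t) <:+ s :=
      suffix_of_cons (by simpa [encLetter_cons] using hw)
    have hw2 := suffix_of_append hw1
    have h2 := der_num (r := r) p hw1
    have h3 := ih hw2
    exact Asg.der .nextTail
      { w := encLetter (p :: l, d) ++ t, x := encLetter (l, d) ++ t, w' := t } rfl rfl
      (by simp [rule, encLetter_cons, Asg.toFun])
      (by
        simp only [rule, List.forall_mem_cons, List.not_mem_nil, IsEmpty.forall_iff,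
          implies_true, and_true, List.map_cons, List.map_nil, termVal_true, termVal_false,
          Asg.toFun, encLetter_cons, List.cons_append, List.tail_cons, List.append_assoc]
        exact ⟨h2, h3⟩)

theorem der_word (u : WrittenWord) (f : List Symb)
    (hw : u.flatMap encLetter ++ Symb.sep :: f <:+ s) :
    Der (rule r) s .word [u.flatMap encLetter ++ Symb.sep :: f, f] := by
  induction u with
  | nil =>
    exact Asg.der .wordNil { w := Symb.sep :: f } rfl rfl (by simp [rule, Asg.toFun])
      (by simp [rule])
  | cons a u ih =>
    rw [List.flatMap_cons, List.append_assoc] at hw ⊢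
    have hw' := suffix_of_append hw
    have h1 := der_next (r := r) a _ hw
    have h2 := ih hw'
    exact Asg.der .wordCons
      { w := encLetter a ++ (u.flatMap encLetter ++ Symb.sep :: f)
        w' := u.flatMap encLetter ++ Symb.sep :: f
        f := f } rfl rfl (by simp [rule])
      (by simpa [rule, Asg.toFun] using ⟨h1, h2⟩) (h1 := suffix_of_cons (suffix_of_append hw'))

theorem der_form {xs : Fin r → List Symb} (hxs : ∀ j, xs j <:+ s) (φ : Formula) :
    ∀ {g : List Symb}, φ.enc ++ g <:+ s → (∀ x ∈ φ.vars, ∃ j, val (xs j) = x) →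
      Der (rule r) s .form ((φ.enc ++ g) :: g :: List.ofFn xs) := by
  induction φ with
  | tt =>
    intro g hf _
    exact Asg.der .formTt { f := Symb.tt :: g, nm := xs } rfl
      (by simp [rule, Asg.toFun, Formula.enc]) (by simp [rule, Asg.toFun]) (by simp [rule])
  | prop p =>
    intro g hf _
    have hg := suffix_of_append hf
    have h1 := der_num (r := r) p (y := g) (suffix_of_cons hf)
    exact Asg.der .formProp { f := Symb.prop :: (encNat p ++ g), g := g, nm := xs } rfl
      (by simp [rule, Asg.toFun, Formula.enc]) (by simp [rule, Asg.toFun])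
      (by simpa [rule, Asg.toFun] using h1)
  | constr x R c =>
    intro g hf hφ
    have hg := suffix_of_append hf
    have hf1 : encNat x ++ Symb.rel R :: (encInt c ++ g) <:+ s :=
      suffix_of_cons (by simpa [Formula.enc] using hf)
    have hf2 := suffix_of_append hf1
    have h1 := der_num (r := r) x hf1
    have h2 := der_int (r := r) c (suffix_of_cons hf2)
    obtain ⟨j, hj⟩ := hφ x (by simp [Formula.vars])
    have h3 : Der (rule r) s (.eq true) [encNat x ++ Symb.rel R :: (encInt c ++ g), xs j] :=
      der_eq (by simp [hj]) hf1 (hxs j)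
    exact Asg.der (.formConstr j)
      { f := Symb.var :: (encNat x ++ Symb.rel R :: (encInt c ++ g))
        y := Symb.rel R :: (encInt c ++ g)
        g := g
        nm := xs } rfl
      (by simp [rule, Asg.toFun, Formula.enc]) (by simp [rule, Asg.toFun])
      (by simpa [rule, Asg.toFun] using ⟨h1, h2, h3⟩) (h1 := by simpa [Formula.enc] using hf)
  | neg φ ih =>
    intro g hf hφ
    have hg := suffix_of_append hf
    have h1 := ih (suffix_of_cons hf) hφ
    exact Asg.der .formNeg { f := Symb.neg :: (φ.enc ++ g), g := g, nm := xs } rfl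
      (by simp [rule, Asg.toFun, Formula.enc]) (by simp [rule, Asg.toFun])
      (by simpa [rule, Asg.toFun] using h1)
  | conj φ ψ ih₁ ih₂ =>
    intro g hf hφ
    simp only [Formula.vars, Finset.mem_union] at hφ
    have hg := suffix_of_append hf
    have hf1 : φ.enc ++ (ψ.enc ++ g) <:+ s := suffix_of_cons (by simpa [Formula.enc] using hf)
    have hf2 := suffix_of_append hf1
    have h1 := ih₁ hf1 fun x hx => hφ x (.inl hx)
    have h2 := ih₂ hf2 fun x hx => hφ x (.inr hx)
    exact Asg.der .formConj
      { f := Symb.conj :: (φ.enc ++ (ψ.enc ++ g)), y := ψ.enc ++ g, g := g, nm := xs } rfl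
      (by simp [rule, Asg.toFun, Formula.enc]) (by simp [rule, Asg.toFun])
      (by simpa [rule, Asg.toFun] using ⟨h1, h2⟩) (h1 := by simpa [Formula.enc] using hf)
  | untl φ ψ ih₁ ih₂ =>
    intro g hf hφ
    simp only [Formula.vars, Finset.mem_union] at hφ
    have hg := suffix_of_append hf
    have hf1 : φ.enc ++ (ψ.enc ++ g) <:+ s := suffix_of_cons (by simpa [Formula.enc] using hf)
    have hf2 := suffix_of_append hf1
    have h1 := ih₁ hf1 fun x hx => hφ x (.inl hx)
    have h2 := ih₂ hf2 fun x hx => hφ x (.inr hx)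
    exact Asg.der .formUntl
      { f := Symb.untl :: (φ.enc ++ (ψ.enc ++ g)), y := ψ.enc ++ g, g := g, nm := xs } rfl
      (by simp [rule, Asg.toFun, Formula.enc]) (by simp [rule, Asg.toFun])
      (by simpa [rule, Asg.toFun] using ⟨h1, h2⟩) (h1 := by simpa [Formula.enc] using hf)
  | freeze x φ ih =>
    intro g hf hφ
    simp only [Formula.vars, Finset.mem_union] at hφ
    have hg := suffix_of_append hf
    have hf1 : encNat x ++ (φ.enc ++ g) <:+ s := suffix_of_cons (by simpa [Formula.enc] using hf)
    have hf2 := suffix_of_append hf1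
    have h1 := der_num (r := r) x hf1
    have h2 := ih hf2 fun x hx => hφ x (.inr hx)
    obtain ⟨j, hj⟩ := hφ x (by simp)
    have h3 : Der (rule r) s (.eq true) [encNat x ++ (φ.enc ++ g), xs j] :=
      der_eq (by simp [hj]) hf1 (hxs j)
    exact Asg.der (.formFreeze j)
      { f := Symb.freeze :: (encNat x ++ (φ.enc ++ g)), y := φ.enc ++ g, g := g, nm := xs } rfl
      (by simp [rule, Asg.toFun, Formula.enc]) (by simp [rule, Asg.toFun])
      (by simpa [rule, Asg.toFun] using ⟨h1, h2, h3⟩) (h1 := by simpa [Formula.enc] using hf)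

theorem exists_bool (p : Prop) : ∃ b : Bool, b = true ↔ p := by
  by_cases h : p
  · exact ⟨true, by simp [h]⟩
  · exact ⟨false, by simp [h]⟩

/-- The premise of completeness for a formula: at every letter its truth value is derivable. -/
def SatDerivable (r : ℕ) (s : List Symb) (xs : Fin r → List Symb) (φ : Formula) : Prop :=
  ∀ (g : List Symb) (a : List ℕ × ℕ) (u : WrittenWord) (t : List Symb) (ν : ℕ → ℤ)
    (ρ : Fin r → List Symb) (b : Bool), φ.enc ++ g <:+ s →
    encLetter a ++ (u.flatMap encLetter ++ Symb.sep :: t) <:+ s → (∀ j, ρ j <:+ s) →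
    Agree ν xs ρ → (b = true ↔ φ.Holds a u ν) →
    Der (rule r) s (.sat b) ((φ.enc ++ g) ::
      (encLetter a ++ (u.flatMap encLetter ++ Symb.sep :: t)) :: (List.ofFn xs ++ List.ofFn ρ))

theorem der_unt {xs : Fin r → List Symb} (hxs : ∀ j, xs j <:+ s) {φ ψ : Formula}
    (hφ : SatDerivable r s xs φ) (hψ : SatDerivable r s xs ψ) {t₁ t₂ t : List Symb}
    (h₁ : φ.enc ++ t₁ <:+ s) (h₂ : ψ.enc ++ t₂ <:+ s) {ν : ℕ → ℤ} {ρ : Fin r → List Symb}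
    (hρ : ∀ j, ρ j <:+ s) (hν : Agree ν xs ρ) (u : WrittenWord) {b : Bool}
    (hw : u.flatMap encLetter ++ Symb.sep :: t <:+ s)
    (hb : b = true ↔ UntilHolds (fun a u => φ.Holds a u ν) (fun a u => ψ.Holds a u ν) u) :
    Der (rule r) s (.unt b) ((φ.enc ++ t₁) :: (ψ.enc ++ t₂) ::
      (u.flatMap encLetter ++ Symb.sep :: t) :: (List.ofFn xs ++ List.ofFn ρ)) := by
  induction u generalizing b with
  | nil =>
    obtain rfl : b = false := by simpa [UntilHolds] using hb
    exact Asg.der .untNil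
      { f := φ.enc ++ t₁, g := ψ.enc ++ t₂, w := Symb.sep :: t, nm := xs, rg := ρ } rfl
      (by simp [rule, Asg.toFun]) (by simp [rule, Asg.toFun]) (by simp [rule])
  | cons a u ih =>
    rw [List.flatMap_cons, List.append_assoc] at hw ⊢
    have hw' := suffix_of_append hw
    obtain ⟨b₁, hb₁⟩ := exists_bool (φ.Holds a u ν)
    obtain ⟨b₂, hb₂⟩ := exists_bool (ψ.Holds a u ν)
    obtain ⟨b₃, hb₃⟩ := exists_bool
      (UntilHolds (fun a u => φ.Holds a u ν) (fun a u => ψ.Holds a u ν) u)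
    obtain rfl : (b₂ || b₁ && b₃) = b := by
      rw [Bool.eq_iff_iff, hb, UntilHolds, ← hb₁, ← hb₂, ← hb₃, Bool.or_eq_true, Bool.and_eq_true]
    have d1 := hφ _ _ _ _ _ _ _ h₁ hw hρ hν hb₁
    have d2 := hψ _ _ _ _ _ _ _ h₂ hw hρ hν hb₂
    have d3 := der_next (r := r) _ _ hw
    have d4 := ih hw' hb₃
    exact Asg.der (.untCons b₁ b₂ b₃)
      { f := φ.enc ++ t₁
        g := ψ.enc ++ t₂
        w := encLetter a ++ (u.flatMap encLetter ++ Symb.sep :: t)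
        w' := u.flatMap encLetter ++ Symb.sep :: t
        nm := xs
        rg := ρ } rfl
      (by simp [rule, Asg.toFun])
      (by
        rw [rule, List.forall_mem_singleton, Bool.not_eq_true', ← Bool.not_eq_true, is_eq_true]
        rintro ⟨t', ht⟩
        exact encLetter_append_ne_sep _ _ _ ht)
      (by simpa [rule, Asg.toFun] using ⟨d1, d2, d3, d4⟩)

/-- Completeness for formulas whose variables are listed by the names at `xs`. -/
theorem satDerivable {xs : Fin r → List Symb} (hxs : ∀ j, xs j <:+ s) (φ : Formula) :
    (∀ x ∈ φ.vars, ∃ j, val (xs j) = x) → SatDerivable r s xs φ := by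
  induction φ with
  | tt =>
    intro hφ g a u t ν ρ b hf hw hρ hν hb
    obtain rfl : b = true := by simpa [Formula.Holds] using hb
    exact Asg.der .satTt
      { f := Symb.tt :: g
        w := encLetter a ++ (u.flatMap encLetter ++ Symb.sep :: t)
        nm := xs
        rg := ρ } rfl
      (by simp [rule, Asg.toFun, Formula.enc]) (by simp [rule, Asg.toFun]) (by simp [rule])
  | prop p =>
    intro hφ g a u t ν ρ b hf hw hρ hν hb
    have d1 : Der (rule r) s (.mem b) [_, encNat p ++ g] :=
      der_mem (by simpa [Formula.Holds] using hb) hw (suffix_of_cons hf)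
    exact Asg.der (.satProp b)
      { f := Symb.prop :: (encNat p ++ g)
        w := encLetter a ++ (u.flatMap encLetter ++ Symb.sep :: t)
        nm := xs
        rg := ρ } rfl
      (by simp [rule, Asg.toFun, Formula.enc]) (by simp [rule, Asg.toFun])
      (by simpa [rule, Asg.toFun] using d1)
  | constr x R c =>
    intro hφ g a u t ν ρ b hf hw hρ hν hb
    have hf1 : encNat x ++ Symb.rel R :: (encInt c ++ g) <:+ s :=
      suffix_of_cons (by simpa [Formula.enc] using hf)
    have hf2 := suffix_of_append hf1
    have hf3 := suffix_of_cons hf2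
    have hf4 : encNat c.natAbs ++ g <:+ s := suffix_of_cons hf3
    obtain ⟨j, hj⟩ := IsFirst.exists (hφ x (by simp [Formula.vars]))
    have d1 := der_num (r := r) x hf1
    have d2 : Der (rule r) s .tail [Symb.rel R :: (encInt c ++ g), encInt c ++ g] :=
      Asg.der .tail { x := Symb.rel R :: (encInt c ++ g) } rfl rfl (by simp [rule]) (by simp [rule])
    have d3 := der_dat (r := r) a _ hw
    have hd := d3.suffix (encNat a.2 ++ (u.flatMap encLetter ++ Symb.sep :: t)) (by simp)
    have hd' : val (encNat a.2 ++ (u.flatMap encLetter ++ Symb.sep :: t)) = a.2 := by simp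
    have hz : val (encNat c.natAbs ++ g) = c.natAbs := by simp
    rw [Formula.Holds, ← hν x j hj, ← truth_constr] at hb
    rw [← Bool.eq_iff_iff] at hb
    obtain ⟨o, ho, d4⟩ : ∃ o, R.truth (if c < 0 then o else o.swap) = b ∧
        if c < 0 then
          Der (rule r) s (.cmp false o) [encNat a.2 ++ (u.flatMap encLetter ++ Symb.sep :: t),
            encNat c.natAbs ++ g, ρ j]
        else Der (rule r) s (.cmp false o) [ρ j, encNat c.natAbs ++ g,
            encNat a.2 ++ (u.flatMap encLetter ++ Symb.sep :: t)] := by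
      by_cases hc : c < 0
      · simp only [if_pos hc] at hb ⊢
        exact ⟨_, hb.symm, by simpa using der_cmp (r := r) false hd hf4 (hρ j)⟩
      · simp only [if_neg hc] at hb ⊢
        exact ⟨_, hb.symm, by simpa using der_cmp (r := r) false (hρ j) hf4 hd⟩
    refine Asg.der (.satConstr R (decide (c < 0)) o j)
      { f := Symb.var :: (encNat x ++ Symb.rel R :: (encInt c ++ g))
        y := Symb.rel R :: (encInt c ++ g)
        z := encInt c ++ g
        w := encLetter a ++ (u.flatMap encLetter ++ Symb.sep :: t)
        d := encNat a.2 ++ (u.flatMap encLetter ++ Symb.sep :: t)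
        nm := xs
        rg := ρ } (by simp [rule, ho])
      (by simp [rule, Asg.toFun, Formula.enc]) (by simp [rule, Asg.toFun, encInt]) ?_
      (h1 := by simpa [Formula.enc] using hf)
    simp only [rule, List.forall_mem_cons, List.forall_mem_append, List.not_mem_nil,
      IsEmpty.forall_iff, implies_true, and_true, List.map_cons, List.map_nil, termVal_false,
      termVal_true, decide_eq_true_eq]
    refine ⟨⟨d1, d2, d3, ?_⟩, der_lookup hf1 hxs (by simpa [Asg.toFun] using hj)⟩
    by_cases hc : c < 0
    · rw [if_pos hc] at d4 ⊢
      exact d4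
    · rw [if_neg hc] at d4 ⊢
      exact d4
  | neg φ ih =>
    intro hφ g a u t ν ρ b hf hw hρ hν hb
    have d1 := ih hφ g a u t ν ρ (!b) (suffix_of_cons hf) hw hρ hν
      (by rw [Formula.Holds] at hb; rw [← not_iff_not, ← hb]; simp)
    exact Asg.der (.satNeg !b)
      { f := Symb.neg :: (φ.enc ++ g)
        w := encLetter a ++ (u.flatMap encLetter ++ Symb.sep :: t)
        nm := xs
        rg := ρ }
      (by simp [rule]) (by simp [rule, Asg.toFun, Formula.enc]) (by simp [rule, Asg.toFun])
      (by simpa [rule, Asg.toFun] using d1)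
  | conj φ ψ ih₁ ih₂ =>
    intro hφ g a u t ν ρ b hf hw hρ hν hb
    simp only [Formula.vars, Finset.mem_union] at hφ
    have hφ₁ := fun x hx => hφ x (.inl hx)
    have hf1 : φ.enc ++ (ψ.enc ++ g) <:+ s := suffix_of_cons (by simpa [Formula.enc] using hf)
    have hf2 := suffix_of_append hf1
    obtain ⟨b₁, hb₁⟩ := exists_bool (φ.Holds a u ν)
    obtain ⟨b₂, hb₂⟩ := exists_bool (ψ.Holds a u ν)
    obtain rfl : (b₁ && b₂) = b := by
      rw [Bool.eq_iff_iff, hb, Formula.Holds, ← hb₁, ← hb₂, Bool.and_eq_true]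
    have d1 := der_form hxs φ hf1 hφ₁
    have d2 := ih₁ hφ₁ _ _ _ _ _ _ _ hf1 hw hρ hν hb₁
    have d3 := ih₂ (fun x hx => hφ x (.inr hx)) _ _ _ _ _ _ _ hf2 hw hρ hν hb₂
    exact Asg.der (.satConj b₁ b₂)
      { f := Symb.conj :: (φ.enc ++ (ψ.enc ++ g))
        g := ψ.enc ++ g
        w := encLetter a ++ (u.flatMap encLetter ++ Symb.sep :: t)
        nm := xs
        rg := ρ } rfl
      (by simp [rule, Asg.toFun, Formula.enc]) (by simp [rule, Asg.toFun])
      (by simpa [rule, Asg.toFun] using ⟨d1, d2, d3⟩) (h1 := by simpa [Formula.enc] using hf)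
  | untl φ ψ ih₁ ih₂ =>
    intro hφ g a u t ν ρ b hf hw hρ hν hb
    simp only [Formula.vars, Finset.mem_union] at hφ
    have hφ₁ := fun x hx => hφ x (.inl hx)
    have hf1 : φ.enc ++ (ψ.enc ++ g) <:+ s := suffix_of_cons (by simpa [Formula.enc] using hf)
    have hf2 := suffix_of_append hf1
    have hw' := suffix_of_append hw
    have d1 := der_form hxs φ hf1 hφ₁
    have d2 := der_next (r := r) a _ hw
    have d3 := der_unt hxs (ih₁ hφ₁) (ih₂ fun x hx => hφ x (.inr hx)) hf1 hf2 hρ hν u hw' hb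
    exact Asg.der (.satUntl b)
      { f := Symb.untl :: (φ.enc ++ (ψ.enc ++ g))
        g := ψ.enc ++ g
        w := encLetter a ++ (u.flatMap encLetter ++ Symb.sep :: t)
        w' := u.flatMap encLetter ++ Symb.sep :: t
        nm := xs
        rg := ρ } rfl
      (by simp [rule, Asg.toFun, Formula.enc]) (by simp [rule, Asg.toFun])
      (by simpa [rule, Asg.toFun] using ⟨d1, d2, d3⟩) (h1 := by simpa [Formula.enc] using hf)
  | freeze x φ ih =>
    intro hφ g a u t ν ρ b hf hw hρ hν hb
    simp only [Formula.vars, Finset.mem_union] at hφ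
    have hf1 : encNat x ++ (φ.enc ++ g) <:+ s := suffix_of_cons (by simpa [Formula.enc] using hf)
    have hf2 := suffix_of_append hf1
    obtain ⟨j, hj⟩ := IsFirst.exists (hφ x (by simp))
    have d1 := der_num (r := r) x hf1
    have d2 := der_dat (r := r) a _ hw
    have hd := d2.suffix (encNat a.2 ++ (u.flatMap encLetter ++ Symb.sep :: t)) (by simp)
    have hd' : val (encNat a.2 ++ (u.flatMap encLetter ++ Symb.sep :: t)) = a.2 := by simp
    have d3 := ih (fun x hx => hφ x (.inr hx)) _ _ _ _ _
      (fun i => if i = j then encNat a.2 ++ (u.flatMap encLetter ++ Symb.sep :: t) else ρ i) b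
      hf2 hw (fun i => by split; exacts [hd, hρ i]) (hν.update hj _) (by rw [hb, hd']; rfl)
    refine Asg.der (.satFreeze b j)
      { f := Symb.freeze :: (encNat x ++ (φ.enc ++ g))
        g := φ.enc ++ g
        w := encLetter a ++ (u.flatMap encLetter ++ Symb.sep :: t)
        d := encNat a.2 ++ (u.flatMap encLetter ++ Symb.sep :: t)
        nm := xs
        rg := ρ } rfl
      (by simp [rule, Asg.toFun, Formula.enc]) (by simp [rule, Asg.toFun]) ?_
      (h1 := by simpa [Formula.enc] using hf)
    simp only [rule, List.forall_mem_cons, List.forall_mem_append, List.not_mem_nil,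
      IsEmpty.forall_iff, implies_true, and_true, List.map_cons, List.map_nil, List.map_append,
      termVal_false, termVal_true, map_names, map_ofFn_var]
    refine ⟨⟨d1, d2, ?_⟩, der_lookup hf1 hxs (by simpa [Asg.toFun] using hj)⟩
    have e (v : Asg r) : (fun i => v.toFun (if i = j then .d else .rg i)) =
        fun i => if i = j then v.d else v.rg i := by
      funext i
      split <;> rfl
    rw [e]
    exact d3

theorem exists_suffix_val_eq (φ : Formula) :
    ∀ {x : ℕ} (g : List Symb), x ∈ φ.vars → ∃ t, t <:+ φ.enc ++ g ∧ val t = x := by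
  induction φ with
  | tt => simp [Formula.vars]
  | prop p => simp [Formula.vars]
  | constr x R c =>
    intro y g hy
    obtain rfl : y = x := by simpa [Formula.vars] using hy
    exact ⟨encNat y ++ (Symb.rel R :: encInt c ++ g),
      by simp [Formula.enc], by simp⟩
  | neg φ ih =>
    intro y g hy
    obtain ⟨t, h1, h2⟩ := ih g hy
    exact ⟨t, h1.trans (List.suffix_cons _ _), h2⟩
  | conj φ ψ ih₁ ih₂ =>
    intro y g hy
    rw [Formula.vars, Finset.mem_union] at hy
    simp only [Formula.enc, List.cons_append, List.append_assoc]
    rcases hy with hy | hy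
    · obtain ⟨t, h1, h2⟩ := ih₁ (ψ.enc ++ g) hy
      exact ⟨t, h1.trans (List.suffix_cons _ _), h2⟩
    · obtain ⟨t, h1, h2⟩ := ih₂ g hy
      exact ⟨t, (h1.trans (List.suffix_append _ _)).trans (List.suffix_cons _ _), h2⟩
  | untl φ ψ ih₁ ih₂ =>
    intro y g hy
    rw [Formula.vars, Finset.mem_union] at hy
    simp only [Formula.enc, List.cons_append, List.append_assoc]
    rcases hy with hy | hy
    · obtain ⟨t, h1, h2⟩ := ih₁ (ψ.enc ++ g) hy
      exact ⟨t, h1.trans (List.suffix_cons _ _), h2⟩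
    · obtain ⟨t, h1, h2⟩ := ih₂ g hy
      exact ⟨t, (h1.trans (List.suffix_append _ _)).trans (List.suffix_cons _ _), h2⟩
  | freeze x φ ih =>
    intro y g hy
    rw [Formula.vars, Finset.mem_union, Finset.mem_singleton] at hy
    simp only [Formula.enc, List.cons_append, List.append_assoc]
    rcases hy with rfl | hy
    · exact ⟨_, List.suffix_cons _ _, by simp⟩
    · obtain ⟨t, h1, h2⟩ := ih g hy
      exact ⟨t, (h1.trans (List.suffix_append _ _)).trans (List.suffix_cons _ _), h2⟩

/-- With `r` pointers, the names of all variables of a formula with at most `r` variables can be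
listed. -/
theorem exists_names (φ : Formula) (h : φ.vars.card ≤ r) :
    ∃ xs : Fin r → List Symb, (∀ j, xs j <:+ φ.enc) ∧ ∀ x ∈ φ.vars, ∃ j, val (xs j) = x := by
  have h1 : ∀ x : φ.vars, ∃ t, t <:+ φ.enc ∧ val t = x := fun x => by
    simpa using exists_suffix_val_eq φ [] x.2
  choose t h1 h2 using h1
  let e := φ.vars.equivFin
  refine ⟨fun j => if hj : j.1 < φ.vars.card then t (e.symm ⟨j, hj⟩) else [], fun j => ?_,
    fun x hx => ⟨⟨e ⟨x, hx⟩, (e ⟨x, hx⟩).2.trans_le h⟩, ?_⟩⟩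
  · dsimp only
    split
    · exact h1 _
    · exact List.nil_suffix
  · simp [h2]

theorem der_goal {u : WrittenWord} {φ : Formula} (hφ : φ.vars.card ≤ r)
    (h : Models u.toDataWord φ) :
    Der (rule r) (encInstance u φ) .goal [encInstance u φ] := by
  obtain ⟨a, v, rfl, hv⟩ := (models_iff_holds u φ).1 h
  obtain ⟨xs, h1, h2⟩ := exists_names φ hφ
  have hs : encInstance (a :: v) φ = encLetter a ++ (v.flatMap encLetter ++ Symb.sep :: φ.enc) := by
    simp [encInstance]
  have hw : encLetter a ++ (v.flatMap encLetter ++ Symb.sep :: φ.enc) <:+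
      encInstance (a :: v) φ := hs ▸ List.suffix_rfl
  have hf : φ.enc ++ [] <:+ encInstance (a :: v) φ := by
    rw [List.append_nil]
    exact suffix_of_cons (suffix_of_append (suffix_of_append hw))
  have hxs : ∀ j, xs j <:+ encInstance (a :: v) φ := fun j =>
    (h1 j).trans (by simpa using hf)
  have d1 := der_word (r := r) (s := encInstance (a :: v) φ) (a :: v) φ.enc List.suffix_rfl
  have d2 := der_form hxs φ hf h2
  have d3 := der_dat (r := r) a _ hw
  have hd := d3.suffix (encNat a.2 ++ (v.flatMap encLetter ++ Symb.sep :: φ.enc)) (by simp)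
  have d4 := satDerivable hxs φ h2 [] a v φ.enc (fun _ => (a.2 : ℤ))
    (fun _ => encNat a.2 ++ (v.flatMap encLetter ++ Symb.sep :: φ.enc)) true hf hw
    (fun _ => hd) (fun _ _ _ => by simp) (by simpa using hv)
  rw [List.append_nil] at d2 d4 hf
  rw [← hs] at d3 d4
  refine Asg.der .goal
    { f := φ.enc
      w := encInstance (a :: v) φ
      d := encNat a.2 ++ (v.flatMap encLetter ++ Symb.sep :: φ.enc)
      nm := xs } rfl rfl ?_ ?_ (h3 := List.suffix_rfl)
  · simp only [rule, List.forall_mem_cons, List.not_mem_nil, IsEmpty.forall_iff, implies_true,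
      and_true, Asg.toFun, List.head?_nil, decide_true]
    rw [Bool.not_eq_true', ← Bool.not_eq_true, is_eq_true, hs]
    rintro ⟨t, ht⟩
    exact encLetter_append_ne_sep _ _ _ ht
  · simp only [rule, List.forall_mem_cons, List.not_mem_nil, IsEmpty.forall_iff, implies_true,
      and_true, List.map_cons, List.map_nil, List.map_append, termVal_false, map_names,
      map_ofFn_var]
    exact ⟨d1, d2, d3, d4⟩

theorem mem_pathChecking_iff_der (r : ℕ) (s : List Symb) :
    s ∈ pathChecking r ↔ Der (rule r) s .goal [s] := by
  constructor
  · rintro ⟨u, φ, rfl, h1, h2⟩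
    exact der_goal h1 h2
  · exact fun h => sem_of_der h

end TPTL

theorem mainTheorem12 (r : ℕ) : InPTime (TPTL.pathChecking r) :=
  letI : Inhabited TPTL.Symb := ⟨.sep⟩
  Datalog.inPTime_of_der (TPTL.rule r) .goal .w _ (TPTL.mem_pathChecking_iff_der r)
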